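/- Let $d\ge 1$ and, for odd $n\ge 3$, let $\mathbb{T}_n^d=(\mathbb{Z}/n\mathbb{Z})^d$ be the discrete torus with nearest-neighbour relation $\mathbf i\sim\mathbf j$, and let $p_{\mathbf i\mathbf j}=\frac1{2d}\mathbf 1_{\mathbf i\sim\mathbf j}$ be the transition matrix of its simple random walk. Attach to the sites of $\mathbb{T}_n^d$ independent Poisson clocks of unit intensity, independent of the initial configuration. In the potlatch process $\mathbf X(t)=(X_{\mathbf i}(t))_{\mathbf i\in\mathbb{T}_n^d}$, with $\mathbf X(0)\ge 0$, when the clock at $\mathbf i$ rings at time $t$ the mass at $\mathbf i$ is redistributed: $X_{\mathbf i}(t)=p_{\mathbf i\mathbf i}X_{\mathbf i}(t-)$ and $X_{\mathbf j}(t)=X_{\mathbf j}(t-)+p_{\mathbf i\mathbf j}X_{\mathbf i}(t-)$ for $\mathbf j\ne\mathbf i$. In the smoothing process $\mathbf Y(t)$, when the clock at $\mathbf k$ rings at time $t$, $Y_{\mathbf k}(t)=\sum_{\mathbf j}p_{\mathbf k\mathbf j}Y_{\mathbf j}(t-)$ and the other values do not change. Let $\gamma_1^{(1)}=1-\cos(2\pi/n)$,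 let $\mathcal D$ denote the distribution of a random object, and let $d_W^{(2)}$ be the $L^2$-Wasserstein distance (for the Euclidean norm). For the smoothing process started from unit mass at $\mathbf 0$ and zero mass elsewhere, let $$\mathcal E(t)=\frac1{4dn^d}\sum_{\mathbf i\sim\mathbf j}(Y_{\mathbf i}(t)-Y_{\mathbf j}(t))^2,\qquad \mathcal V(t)=n^{-d}\sum_{\mathbf i}\big(Y_{\mathbf i}(t)-\overline Y(t)\big)^2,\qquad \overline Y(t)=n^{-d}\sum_{\mathbf i}Y_{\mathbf i}(t),$$ where the first sum is over ordered pairs of neighbours. There are constants $\alpha_1,\alpha_2,\alpha_3>0$ depending only on $d$ with the following properties, in which $n$ is always odd. (0) There are $n_0\ge 3$ and $t_0>0$ (depending on $d$) such that for all $n\ge n_0$ and $t\ge t_0$, $$\frac{\alpha_1 n^{-d}}{t^{d/2+1}\wedge n^{d+2}}\,e^{-2\gamma_1^{(1)}d^{-1}t}\le \mathbb E\,\mathcal E(t)\le \frac{\alpha_2 n^{-d}}{t^{d/2+1}\wedge n^{d+2}}\,e^{-\left(2\gamma_1^{(1)}d^{-1}-\alpha_3 n^{-(d+4)}\right)t},$$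 $$\frac{\alpha_1 n^{-d}}{t^{d/2}\wedge n^{d}}\,e^{-\left(2\gamma_1^{(1)}d^{-1}+\alpha_3 n^{-(d+4)}\right)t}\le \mathbb E\,\mathcal V(t)\le \frac{\alpha_2 n^{-d}}{t^{d/2}\wedge n^{d}}\,e^{-\left(2\gamma_1^{(1)}d^{-1}-\alpha_3 n^{-(d+4)}\right)t}.$$ (i) There is $n_0\ge 3$ (depending on $d$) such that for every $n\ge n_0$ the potlatch process on $\mathbb{T}_n^d$ with $X_{\mathbf j}(0)=1$ for all $\mathbf j$ converges in distribution, as $t\to\infty$, to a random vector $\mathbf X(\infty)$ whose distribution is stationary for the potlatch process, and for all $\mathbf i\in\mathbb{T}_n^d$ and $t\ge 0$ (the right-hand sides being $+\infty$ at $t=0$), $$d^{(2)}_W(\mathcal D(X_{\mathbf i}(t)),\mathcal D(X_{\mathbf i}(\infty)))\le\sqrt{\frac{\alpha_2}{t^{d/2+1}\wedge n^{d+2}}}\;\exp\left(-\left(\frac{\gamma_1^{(1)}}d-\frac{\alpha_3}{2n^{d+4}}\right)t\right),$$ $$d^{(2)}_W(\mathcal D(\mathbf X(t)),\mathcal D(\mathbf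 X(\infty)))\le\sqrt{\frac{\alpha_2 n^d}{t^{d/2+1}\wedge n^{d+2}}}\;\exp\left(-\left(\frac{\gamma_1^{(1)}}d-\frac{\alpha_3}{2n^{d+4}}\right)t\right).$$ (ii) For all real $\mu,\zeta$ there are $\eta>0$ and $n_0\ge 3$ (depending only on $\mu$, $\zeta$ and $d$) such that for every $n\ge n_0$ and every potlatch process on $\mathbb{T}_n^d$ whose initial masses $X_{\mathbf j}(0)\ge 0$ satisfy $\mathbb E X_{\mathbf j}(0)=\mu$ and $\mathbb E X_{\mathbf j}(0)^2\le\zeta$ for all $\mathbf j$ and $\operatorname{Cov}(X_{\mathbf j}(0),X_{\mathbf k}(0))=0$ for $\mathbf j\ne\mathbf k$, the process converges in distribution, as $t\to\infty$, to a random vector $\mathbf X(\infty)$ whose distribution is stationary for the potlatch process, and for all $\mathbf i\in\mathbb{T}_n^d$ and $t\ge 0$ (the right-hand sides being $+\infty$ at $t=0$), $$d^{(2)}_W(\mathcal D(X_{\mathbf i}(t)),\mathcal D(X_{\mathbf i}(\infty)))\le\sqrt{\frac{\eta}{t^{d/2}\wedge n^{d}}}\;\exp\left(-\left(\frac{\gamma_1^{(1)}}d-\frac{\alpha_3}{2n^{d+4}}\right)t\right),$$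 $$d^{(2)}_W(\mathcal D(\mathbf X(t)),\mathcal D(\mathbf X(\infty)))\le\sqrt{\frac{\eta n^d}{t^{d/2}\wedge n^{d}}}\;\exp\left(-\left(\frac{\gamma_1^{(1)}}d-\frac{\alpha_3}{2n^{d+4}}\right)t\right).$$ -/

import Mathlib

open MeasureTheory ProbabilityTheory Filter Topology
open scoped NNReal ENNReal

noncomputable section

/-- The `L²`-Wasserstein distance: the infimum over all couplings `π` of `μ` and `ν` of
`(∫ dist(x, y)² dπ(x, y))^(1/2)`, as an extended nonnegative real. -/
def wasserstein2 {E : Type*} [PseudoEMetricSpace E] [MeasurableSpace E] (μ ν : Measure E) : ℝ≥0∞ :=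
  (⨅ (π : Measure (E × E)) (_ : π.map Prod.fst = μ ∧ π.map Prod.snd = ν),
    ∫⁻ z, edist z.1 z.2 ^ 2 ∂π) ^ (1 / 2 : ℝ)

/-- `N` is (the counting process of) a Poisson process of unit intensity: it starts at `0`, has
nondecreasing right-continuous paths almost surely, and has independent increments over disjoint
intervals, the increment over `(s, t]` being Poisson distributed with mean `t - s`. -/
structure IsPoissonClock {Ω : Type*} [MeasurableSpace Ω] (N : ℝ≥0 → Ω → ℕ) (P : Measure Ω) :
    Prop where
  measurable : ∀ t, Measurable (N t)
  zero : ∀ᵐ ω ∂P, N 0 ω = 0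
  mono : ∀ᵐ ω ∂P, Monotone fun t => N t ω
  rightCont : ∀ᵐ ω ∂P, ∀ t, ContinuousWithinAt (fun s => N s ω) (Set.Ici t) t
  indepIncrements : HasIndepIncrements N P
  law : ∀ s t, s ≤ t → HasLaw (fun ω => N t ω - N s ω) (poissonMeasure (t - s)) P

/-- `X` is a process of nonnegative initial mass configurations on a finite set `S` of sites,
driven by independent Poisson clocks `N i`, `i ∈ S`, which are jointly independent of `X 0`:
when the clock at `i` rings, the configuration `x` before the ring is replaced by `update i x`,
and nothing happens between rings. The dynamics is expressed on time intervals `(s, t]` which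
contain no ring at all, or exactly one ring (of the clock at `i`). As almost surely the rings are
isolated and no two clocks ring simultaneously, this determines the path of `X` from `X 0` and
from the clocks, and at a ring `t` of clock `i` it says that `X(t) = update i (X(t-))`. -/
structure IsClockDriven {S : Type*} [Fintype S]
    (update : S → EuclideanSpace ℝ S → EuclideanSpace ℝ S)
    {Ω : Type*} [MeasurableSpace Ω] (N : S → ℝ≥0 → Ω → ℕ) (X : ℝ≥0 → Ω → EuclideanSpace ℝ S)
    (P : Measure Ω) : Prop where
  clock : ∀ i, IsPoissonClock (N i) P
  indep_clocks : iIndepFun (fun i ω t => N i t ω) P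
  indep_initial : IndepFun (X 0) (fun ω i t => N i t ω) P
  measurable : ∀ t, Measurable (X t)
  nonneg : ∀ᵐ ω ∂P, ∀ j, 0 ≤ X 0 ω j
  hold : ∀ᵐ ω ∂P, ∀ s t, s ≤ t → (∀ j, N j t ω = N j s ω) → X t ω = X s ω
  ring : ∀ᵐ ω ∂P, ∀ s t, s ≤ t → ∀ i, N i t ω = N i s ω + 1 →
    (∀ j, j ≠ i → N j t ω = N j s ω) → X t ω = update i (X s ω)

/-- A ring at `i` in the potlatch process with transition matrix `p`: the mass at `i` is
redistributed over all sites in proportion to the `i`-th row of `p`. -/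
def potlatchUpdate {S : Type*} [Fintype S] [DecidableEq S] (p : S → S → ℝ) (i : S)
    (x : EuclideanSpace ℝ S) : EuclideanSpace ℝ S :=
  WithLp.toLp 2 fun j => if j = i then p i i * x i else x j + p i j * x i

/-- A ring at `k` in the smoothing process with transition matrix `p`: the value at `k` is
replaced by the average of all values with weights given by the `k`-th row of `p`. -/
def smoothingUpdate {S : Type*} [Fintype S] [DecidableEq S] (p : S → S → ℝ) (k : S)
    (y : EuclideanSpace ℝ S) : EuclideanSpace ℝ S :=
  WithLp.toLp 2 fun j => if j = k then ∑ l, p k l * y l else y j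

/-- `X` is a potlatch process with transition matrix `p`. -/
def IsPotlatch {S : Type*} [Fintype S] [DecidableEq S] (p : S → S → ℝ)
    {Ω : Type*} [MeasurableSpace Ω] (X : ℝ≥0 → Ω → EuclideanSpace ℝ S) (P : Measure Ω) : Prop :=
  ∃ N : S → ℝ≥0 → Ω → ℕ, IsClockDriven (potlatchUpdate p) N X P

/-- `Y` is a smoothing process with transition matrix `p`. -/
def IsSmoothing {S : Type*} [Fintype S] [DecidableEq S] (p : S → S → ℝ)
    {Ω : Type*} [MeasurableSpace Ω] (Y : ℝ≥0 → Ω → EuclideanSpace ℝ S) (P : Measure Ω) : Prop :=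
  ∃ N : S → ℝ≥0 → Ω → ℕ, IsClockDriven (smoothingUpdate p) N Y P

/-- `ν` is a stationary distribution of the potlatch process with transition matrix `p`: a
potlatch process with initial distribution `ν` has distribution `ν` at all times. -/
def IsPotlatchStationary {S : Type*} [Fintype S] [DecidableEq S] (p : S → S → ℝ)
    (ν : Measure (EuclideanSpace ℝ S)) : Prop :=
  ∀ (Ω : Type) [MeasurableSpace Ω] (P : Measure Ω) [IsProbabilityMeasure P]
    (Z : ℝ≥0 → Ω → EuclideanSpace ℝ S),
    IsPotlatch p Z P → P.map (Z 0) = ν → ∀ t, P.map (Z t) = ν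

/-- The discrete torus `(ℤ/nℤ)^d`. -/
abbrev Torus (d n : ℕ) : Type := Fin d → ZMod n

/-- Neighboring vertices of the torus differ by `± 1` in exactly one coordinate. -/
def torusAdj {d n : ℕ} (i j : Torus d n) : Prop :=
  ∃ k : Fin d, j = i + Pi.single k 1 ∨ j = i - Pi.single k 1

open Classical in
/-- The transition matrix of the simple random walk on the torus `(ℤ/nℤ)^d`, `d ≥ 1`, `n ≥ 3`
(where every vertex has `2d` neighbors). -/
def torusWalk (d n : ℕ) (i j : Torus d n) : ℝ :=
  if torusAdj i j then 1 / (2 * d) else 0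

open Classical in
/-- The energy functional `(1 / (4 d n^d)) ∑_{i ∼ j} (y_i - y_j)²`, the sum being over ordered
pairs of neighbors in the torus. -/
def torusEnergy {d n : ℕ} [NeZero n] (y : EuclideanSpace ℝ (Torus d n)) : ℝ :=
  1 / (4 * d * (n : ℝ) ^ d) *
    ∑ i : Torus d n, ∑ j : Torus d n, if torusAdj i j then (y i - y j) ^ 2 else 0

/-- The average `n^{-d} ∑_i y_i`. -/
def torusMean {d n : ℕ} [NeZero n] (y : EuclideanSpace ℝ (Torus d n)) : ℝ :=
  ((n : ℝ) ^ d)⁻¹ * ∑ i : Torus d n, y i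

/-- The variance functional `n^{-d} ∑_i (y_i - ȳ)²`. -/
def torusVariance {d n : ℕ} [NeZero n] (y : EuclideanSpace ℝ (Torus d n)) : ℝ :=
  ((n : ℝ) ^ d)⁻¹ * ∑ i : Torus d n, (y i - torusMean y) ^ 2

/-- The spectral gap `1 - cos(2π/n)` of the simple random walk on `ℤ/nℤ`. -/
def cycleGap (n : ℕ) : ℝ := 1 - Real.cos (2 * Real.pi / n)

/-- `√(A / D) · exp(-r t)` in the extended nonnegative reals; it is `∞` if `A > 0` and `D = 0`. -/
def sqrtExpBound (A D r t : ℝ) : ℝ≥0∞ :=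
  (ENNReal.ofReal A / ENNReal.ofReal D) ^ (1 / 2 : ℝ) * ENNReal.ofReal (Real.exp (-r * t))

end

/-!
The law at time `t` of a process driven by independent Poisson clocks is the explicit uniformized
semigroup `clockLaw` applied to the initial law (`IsClockDriven.map_eq_clockLaw`), so that all
assertions become statements about `clockLaw`.

**Smoothing process.** Let `hₖ(t)` be the second moment of the Fourier coefficient at the frequency
`k` of the smoothing process started from a unit mass, `λₖ` the eigenvalue of `1 - p` at `k`, and
`N = n ^ d`. A ring changes only one value, by `(p y - y)`, and Parseval's identity turns the
resulting drift into the closed linear system (`exists_isSpectralSystem`)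
`hₖ' = -2 λₖ hₖ + g` with `g = N⁻¹ ∑ⱼ λⱼ² hⱼ` and `hₖ(0) = 1`.
Energy and variance are, up to the factor `N⁻¹`, the quantities `e = N⁻¹ ∑ₖ λₖ hₖ` and
`v = N⁻¹ ∑_{k ≠ 0} hₖ`. As `g ≥ 0`, one has `hₖ(t) ≥ exp (-2 λₖ t)`, and counting small eigenvalues
gives the lower bounds (`spectral_lower_bound`). For the upper bounds let
`θ = 2 λ₁ - 6400 n ^ (-(d + 4))` with the spectral gap `λ₁`. By variation of constants
`exp (θ t) g(t)` solves a renewal equation with the kernel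
`N⁻¹ ∑ₖ λₖ² exp (-(2 λₖ - θ) t)`. The kernel has mass at most `3 / 4` (`renewal_mass_le`): the
correction `6400 n ^ (-(d + 4))` is what makes the contribution of the `2 d` lowest frequencies
small. It decays like the heat kernel with two more derivatives (`renewal_kernel_le`), and the
solution inherits this decay (`renewal_le`). Integrating `e' = -g` and
`(v + (1 - N⁻¹) e)' = -2 e` backwards from infinity bounds `e` and `v`
(`exists_spectral_upper_bound`).

**Potlatch process.** The updates of the potlatch and of the smoothing process are adjoint, hence
second moments of linear observables of the potlatch process are integrals against the law of the
smoothing process started from a unit mass (`lintegral_potlatch_sq`), also for differences of two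
potlatch processes using the same clocks (`lintegral_coupledLaw_sq`). The second moment of the
total mass of the smoothing process is `h₀ = 2 - e`. Therefore the fluctuations around the constant
configuration of a law with unit means, seen from the smoothing process, have size at most `e`
as long as its potlatch second moments are at most `2` (`IsMomentBound.fluctuation_le`). This
applies to the laws at all times of the process started from unit masses, which stay in a compact
simplex, and shows that their subsequential limits are stationary
(`IsMomentBound.exists_stationary`).

An initial configuration `x` with mean `m` is coupled with `m z`, where `z` is independent and has
the stationary law. Deviations of `x` from its mean contribute at most `σ v` to the mean square
distance at a site, and the fluctuations of `z` at most `τ e`, without a cross term since `z` has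
unit means (`IsMomentBound.exists_coupling`). For unit masses `σ = 0` and `τ = 1`; for uncorrelated
masses with a common mean and second moments at most `ζ` both constants can be taken to be `ζ`.
-/

/-! ### The semigroup of a clock-driven Markov chain -/

section ClockLaw

variable {ι Z Z' : Type*} [Fintype ι] [MeasurableSpace Z] [MeasurableSpace Z']

/-- The sum over all sites of the laws of the configuration after a ring at that site. It is the
number of sites times the transition operator of the embedded jump chain. -/
noncomputable def ringOp (u : ι → Z → Z) (μ : Measure Z) : Measure Z := ∑ i, μ.map (u i)

/-- The probability that a prescribed sequence of `m` sites is the sequence of rings up to time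
`t`, when `ι` is the set of sites. -/
noncomputable def ringWeight (ι : Type*) [Fintype ι] (t : ℝ≥0) (m : ℕ) : ℝ :=
  Real.exp (-(Fintype.card ι * t)) * (t : ℝ) ^ m / m.factorial

/-- The law at time `t` of the process with initial law `μ` to which the map `u i` is applied at
the rings of a unit rate Poisson clock at `i`. It is given by uniformization: the rings are
decomposed by the number `m` of rings of all the clocks up to time `t`. -/
noncomputable def clockLaw (u : ι → Z → Z) (t : ℝ≥0) (μ : Measure Z) : Measure Z :=
  Measure.sum fun m : ℕ => ENNReal.ofReal (ringWeight ι t m) • (ringOp u)^[m] μ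

lemma ringWeight_nonneg (t : ℝ≥0) (m : ℕ) : 0 ≤ ringWeight ι t m := by
  unfold ringWeight; positivity

lemma hasSum_ringWeight_mul_card_pow (t : ℝ≥0) :
    HasSum (fun m => ringWeight ι t m * (Fintype.card ι : ℝ) ^ m) 1 := by
  have h := hasSum_one_poissonMeasure (Fintype.card ι * t)
  convert h using 1
  funext m
  simp only [ringWeight]
  push_cast
  rw [mul_pow]; ring

lemma ringOp_apply {u : ι → Z → Z} (hu : ∀ i, Measurable (u i)) (μ : Measure Z) {A : Set Z}
    (hA : MeasurableSet A) : ringOp u μ A = ∑ i, μ (u i ⁻¹' A) := by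
  simp only [ringOp, Measure.coe_finsetSum, Finset.sum_apply]
  exact Finset.sum_congr rfl fun i _ => Measure.map_apply (hu i) hA

lemma lintegral_ringOp {u : ι → Z → Z} (hu : ∀ i, Measurable (u i)) (μ : Measure Z)
    {f : Z → ℝ≥0∞} (hf : Measurable f) :
    ∫⁻ z, f z ∂(ringOp u μ) = ∑ i, ∫⁻ z, f (u i z) ∂μ := by
  rw [ringOp, lintegral_finsetSum_measure]
  exact Finset.sum_congr rfl fun i _ => lintegral_map hf (hu i)

lemma lintegral_clockLaw (u : ι → Z → Z) (t : ℝ≥0) (μ : Measure Z) (f : Z → ℝ≥0∞) :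
    ∫⁻ z, f z ∂(clockLaw u t μ) =
      ∑' m, ENNReal.ofReal (ringWeight ι t m) * ∫⁻ z, f z ∂((ringOp u)^[m] μ) := by
  rw [clockLaw, lintegral_sum_measure]
  simp [lintegral_smul_measure]

lemma clockLaw_apply (u : ι → Z → Z) (t : ℝ≥0) (μ : Measure Z) {A : Set Z}
    (hA : MeasurableSet A) :
    clockLaw u t μ A = ∑' m, ENNReal.ofReal (ringWeight ι t m) * (ringOp u)^[m] μ A := by
  rw [clockLaw, Measure.sum_apply _ hA]
  simp

lemma ringOp_univ {u : ι → Z → Z} (hu : ∀ i, Measurable (u i)) (μ : Measure Z) :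
    ringOp u μ Set.univ = Fintype.card ι * μ Set.univ := by
  simp [ringOp_apply hu μ MeasurableSet.univ]

lemma ringOp_iterate_univ {u : ι → Z → Z} (hu : ∀ i, Measurable (u i)) (μ : Measure Z) (m : ℕ) :
    (ringOp u)^[m] μ Set.univ = (Fintype.card ι : ℝ≥0∞) ^ m * μ Set.univ := by
  induction m with
  | zero => simp
  | succ m ih => rw [Function.iterate_succ_apply', ringOp_univ hu, ih]; ring

lemma tsum_ofReal_ringWeight_mul_card_pow (t : ℝ≥0) :
    ∑' m, ENNReal.ofReal (ringWeight ι t m) * (Fintype.card ι : ℝ≥0∞) ^ m = 1 := by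
  have h := hasSum_ringWeight_mul_card_pow (ι := ι) t
  rw [← ENNReal.ofReal_one, ← h.tsum_eq, ENNReal.ofReal_tsum_of_nonneg _ h.summable]
  · refine tsum_congr fun m => ?_
    rw [ENNReal.ofReal_mul (ringWeight_nonneg t m), ENNReal.ofReal_pow (by positivity)]
    simp
  · exact fun m => mul_nonneg (ringWeight_nonneg t m) (by positivity)

lemma isProbabilityMeasure_clockLaw {u : ι → Z → Z} (hu : ∀ i, Measurable (u i)) (t : ℝ≥0)
    (μ : Measure Z) [IsProbabilityMeasure μ] : IsProbabilityMeasure (clockLaw u t μ) := by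
  refine ⟨?_⟩
  rw [clockLaw_apply u t μ MeasurableSet.univ]
  simpa [ringOp_iterate_univ hu] using tsum_ofReal_ringWeight_mul_card_pow (ι := ι) t

lemma map_ringOp {u : ι → Z → Z} {u' : ι → Z' → Z'} (hu : ∀ i, Measurable (u i))
    (hu' : ∀ i, Measurable (u' i)) {φ : Z → Z'} (hφ : Measurable φ)
    (h : ∀ i z, φ (u i z) = u' i (φ z)) (μ : Measure Z) :
    (ringOp u μ).map φ = ringOp u' (μ.map φ) := by
  ext A hA
  rw [Measure.map_apply hφ hA, ringOp_apply hu _ (hφ hA), ringOp_apply hu' _ hA]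
  refine Finset.sum_congr rfl fun i _ => ?_
  rw [Measure.map_apply hφ (hu' i hA), ← Set.preimage_comp, ← Set.preimage_comp]
  congr 2
  funext z
  exact h i z

lemma map_ringOp_iterate {u : ι → Z → Z} {u' : ι → Z' → Z'} (hu : ∀ i, Measurable (u i))
    (hu' : ∀ i, Measurable (u' i)) {φ : Z → Z'} (hφ : Measurable φ)
    (h : ∀ i z, φ (u i z) = u' i (φ z)) (μ : Measure Z) (m : ℕ) :
    ((ringOp u)^[m] μ).map φ = (ringOp u')^[m] (μ.map φ) := by
  induction m with
  | zero => rfl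
  | succ m ih =>
    rw [Function.iterate_succ_apply', Function.iterate_succ_apply', map_ringOp hu hu' hφ h, ih]

/-- A map that intertwines the updates intertwines the semigroups. -/
lemma map_clockLaw {u : ι → Z → Z} {u' : ι → Z' → Z'} (hu : ∀ i, Measurable (u i))
    (hu' : ∀ i, Measurable (u' i)) {φ : Z → Z'} (hφ : Measurable φ)
    (h : ∀ i z, φ (u i z) = u' i (φ z)) (t : ℝ≥0) (μ : Measure Z) :
    (clockLaw u t μ).map φ = clockLaw u' t (μ.map φ) := by
  ext A hA
  rw [Measure.map_apply hφ hA, clockLaw_apply _ _ _ (hφ hA), clockLaw_apply _ _ _ hA]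
  refine tsum_congr fun m => ?_
  rw [← map_ringOp_iterate hu hu' hφ h, Measure.map_apply hφ hA]

lemma ringOp_smul (u : ι → Z → Z) (c : ℝ≥0∞) (μ : Measure Z) :
    ringOp u (c • μ) = c • ringOp u μ := by
  simp [ringOp, Finset.smul_sum, Measure.map_smul]

lemma ringOp_sum {u : ι → Z → Z} (hu : ∀ i, Measurable (u i)) (μ : ℕ → Measure Z) :
    ringOp u (Measure.sum μ) = Measure.sum fun m => ringOp u (μ m) := by
  ext A hA
  rw [ringOp_apply hu _ hA, Measure.sum_apply _ hA]
  simp only [ringOp_apply hu _ hA, Measure.sum_apply _ (hu _ hA)]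
  rw [Summable.tsum_finsetSum (fun _ _ => ENNReal.summable)]

lemma ringOp_iterate_clockLaw {u : ι → Z → Z} (hu : ∀ i, Measurable (u i)) (t : ℝ≥0)
    (μ : Measure Z) (j : ℕ) : (ringOp u)^[j] (clockLaw u t μ) =
      Measure.sum fun m : ℕ => ENNReal.ofReal (ringWeight ι t m) • (ringOp u)^[j + m] μ := by
  induction j with
  | zero => simp [clockLaw]
  | succ j ih =>
    rw [Function.iterate_succ_apply', ih, ringOp_sum hu]
    congr 1
    funext m
    rw [ringOp_smul, ← Function.iterate_succ_apply' (ringOp u)]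
    rw [Nat.succ_eq_add_one, add_right_comm]

lemma sum_antidiagonal_ringWeight (s t : ℝ≥0) (l : ℕ) :
    ∑ p ∈ Finset.HasAntidiagonal.antidiagonal l, ringWeight ι s p.1 * ringWeight ι t p.2 =
      ringWeight ι (s + t) l := by
  simp only [ringWeight]
  have h : ∀ p ∈ Finset.HasAntidiagonal.antidiagonal l,
      Real.exp (-(Fintype.card ι * s)) * (s : ℝ) ^ p.1 / p.1.factorial *
        (Real.exp (-(Fintype.card ι * t)) * (t : ℝ) ^ p.2 / p.2.factorial) =
      Real.exp (-(Fintype.card ι * (s + t))) / l.factorial *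
        ((s : ℝ) ^ p.1 * (t : ℝ) ^ p.2 * (l.choose p.1 : ℝ)) := by
    intro p hp
    have hl := Finset.HasAntidiagonal.mem_antidiagonal.1 hp
    have h1 : ((l.choose p.1 : ℝ)) * p.1.factorial * p.2.factorial = l.factorial := by
      have := Nat.choose_mul_factorial_mul_factorial (n := l) (k := p.1) (by omega)
      rw [show l - p.1 = p.2 by omega] at this
      exact_mod_cast this
    have h2 : Real.exp (-(Fintype.card ι * ((s : ℝ) + t))) =
        Real.exp (-(Fintype.card ι * s)) * Real.exp (-(Fintype.card ι * t)) := by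
      rw [← Real.exp_add]; ring_nf
    rw [h2, ← h1]
    have : (l.choose p.1 : ℝ) ≠ 0 := by
      exact_mod_cast (Nat.choose_pos (by omega)).ne'
    field_simp
  rw [Finset.sum_congr rfl h, ← Finset.mul_sum, NNReal.coe_add,
    (Commute.all (s : ℝ) t).add_pow']
  rw [mul_div_right_comm]
  congr 1
  refine Finset.sum_congr rfl fun p _ => ?_
  simp [nsmul_eq_mul]; ring

/-- The semigroup property. -/
lemma clockLaw_clockLaw {u : ι → Z → Z} (hu : ∀ i, Measurable (u i)) (s t : ℝ≥0)
    (μ : Measure Z) : clockLaw u s (clockLaw u t μ) = clockLaw u (s + t) μ := by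
  ext A hA
  rw [clockLaw_apply _ _ _ hA, clockLaw_apply _ _ _ hA]
  simp only [ringOp_iterate_clockLaw hu, Measure.sum_apply _ hA, Measure.smul_apply, smul_eq_mul,
    ← ENNReal.tsum_mul_left]
  rw [← ENNReal.tsum_prod (f := fun j m => ENNReal.ofReal (ringWeight ι s j) *
    (ENNReal.ofReal (ringWeight ι t m) * (ringOp u)^[j + m] μ A)),
    ← Finset.HasAntidiagonal.sigmaAntidiagonalEquivProd.tsum_eq, ENNReal.tsum_sigma']
  refine tsum_congr fun l => ?_
  rw [tsum_fintype, ← sum_antidiagonal_ringWeight, ENNReal.ofReal_sum_of_nonneg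
    (fun p _ => mul_nonneg (ringWeight_nonneg _ _) (ringWeight_nonneg _ _)), Finset.sum_mul,
    ← Finset.sum_coe_sort (Finset.HasAntidiagonal.antidiagonal l)]
  refine Finset.sum_congr rfl fun p _ => ?_
  have hl := Finset.HasAntidiagonal.mem_antidiagonal.1 p.2
  simp only [Finset.HasAntidiagonal.sigmaAntidiagonalEquivProd_apply]
  rw [ENNReal.ofReal_mul (ringWeight_nonneg _ _), hl, mul_assoc]

lemma clockLaw_zero (u : ι → Z → Z) (μ : Measure Z) : clockLaw u 0 μ = μ := by
  ext A hA
  rw [clockLaw_apply _ _ _ hA, tsum_eq_single 0]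
  · simp [ringWeight]
  · intro m hm
    simp [ringWeight, hm]

/-- Considering only the event that the clocks ring at most once during the last `h` units of time
gives a lower bound for the law at time `t + h`. -/
lemma smul_add_ringOp_le_clockLaw {u : ι → Z → Z} (hu : ∀ i, Measurable (u i)) (t h : ℝ≥0)
    (μ ρ : Measure Z) (hρ : ρ ≤ clockLaw u t μ) :
    ENNReal.ofReal (Real.exp (-(Fintype.card ι * h))) • (ρ + (h : ℝ≥0∞) • ringOp u ρ) ≤
      clockLaw u (t + h) μ := by
  rw [add_comm t h, ← clockLaw_clockLaw hu]
  refine Measure.le_iff.2 fun A hA => ?_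
  rw [clockLaw_apply _ _ _ hA]
  refine le_trans ?_ (ENNReal.sum_le_tsum (Finset.range 2))
  simp only [Finset.sum_range_succ, Finset.sum_range_zero, zero_add, ringWeight,
    Measure.smul_apply, Measure.add_apply, smul_eq_mul, mul_add, Function.iterate_zero, id,
    Function.iterate_one, pow_zero, pow_one, Nat.factorial, Nat.cast_one, div_one, mul_one]
  rw [ENNReal.ofReal_mul (by positivity), ENNReal.ofReal_coe_nnreal, ← mul_assoc]
  refine add_le_add (mul_le_mul_right (hρ A) _) (mul_le_mul_right ?_ _)
  · rw [ringOp_apply hu _ hA, ringOp_apply hu _ hA]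
    exact Finset.sum_le_sum fun i _ => hρ _

/-- A duality of the updates with respect to `F` gives a duality of the semigroups. -/
lemma lintegral_lintegral_clockLaw {u : ι → Z → Z} {u' : ι → Z' → Z'}
    (hu : ∀ i, Measurable (u i)) (hu' : ∀ i, Measurable (u' i)) {F : Z → Z' → ℝ≥0∞}
    (hF : Measurable (Function.uncurry F)) (h : ∀ i z z', F (u i z) z' = F z (u' i z'))
    (t : ℝ≥0) (μ : Measure Z) (ν : Measure Z') [IsFiniteMeasure μ] [IsFiniteMeasure ν] :
    ∫⁻ z, ∫⁻ z', F z z' ∂ν ∂(clockLaw u t μ) = ∫⁻ z, ∫⁻ z', F z z' ∂(clockLaw u' t ν) ∂μ := by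
  have hfin : ∀ (ν : Measure Z') [IsFiniteMeasure ν], IsFiniteMeasure (ringOp u' ν) := by
    intro ν _
    refine ⟨?_⟩
    rw [ringOp_univ hu']
    exact ENNReal.mul_lt_top (by simp) (measure_lt_top _ _)
  have hit : ∀ m, IsFiniteMeasure ((ringOp u')^[m] ν) := by
    intro m
    induction m with
    | zero => simpa
    | succ m ih => rw [Function.iterate_succ_apply']; exact hfin _
  have hm : ∀ (κ : Measure Z') [IsFiniteMeasure κ], Measurable fun z => ∫⁻ z', F z z' ∂κ :=
    fun κ _ => hF.lintegral_prod_right'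
  have key : ∀ m : ℕ, ∀ κ : Measure Z', IsFiniteMeasure κ →
      ∫⁻ z, ∫⁻ z', F z z' ∂κ ∂((ringOp u)^[m] μ) =
        ∫⁻ z, ∫⁻ z', F z z' ∂((ringOp u')^[m] κ) ∂μ := by
    intro m
    induction m with
    | zero => intro κ _; rfl
    | succ m ih =>
      intro κ hκ
      rw [Function.iterate_succ_apply', Function.iterate_succ_apply, lintegral_ringOp hu _ (hm κ),
        ← ih _ (hfin κ)]
      have : ∀ z, ∫⁻ z', F z z' ∂(ringOp u' κ) = ∑ i, ∫⁻ z', F (u i z) z' ∂κ := by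
        intro z
        rw [lintegral_ringOp hu' κ (f := F z) (hF.comp measurable_prodMk_left)]
        exact Finset.sum_congr rfl fun i _ => lintegral_congr fun z' => (h i z z').symm
      simp only [this]
      exact (lintegral_finsetSum _ fun i _ => (hm κ).comp (hu i)).symm
  rw [lintegral_clockLaw]
  simp only [lintegral_clockLaw]
  rw [lintegral_tsum]
  · refine tsum_congr fun m => ?_
    rw [key m ν inferInstance, lintegral_const_mul']
    simp
  · intro m
    have := hit m
    exact ((hm _).const_mul _).aemeasurable

end ClockLaw

section LinearObservable

variable {ι Z κ : Type*} [Fintype ι] [MeasurableSpace Z] [Fintype κ]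

omit [Fintype κ] in
lemma exists_lintegral_ringOp_iterate_dirac {u : ι → Z → Z} (hu : ∀ i, Measurable (u i))
    {f : Z → κ → ℝ} (hf : Measurable f) (hf0 : ∀ z k, 0 ≤ f z k)
    (T : (κ → ℝ) →L[ℝ] (κ → ℝ)) (hT : ∀ z, ∑ i, f (u i z) = T (f z)) (m : ℕ) (k : κ) :
    ∀ z₀, 0 ≤ (T ^ m) (f z₀) k ∧
      ∫⁻ z, ENNReal.ofReal (f z k) ∂((ringOp u)^[m] (Measure.dirac z₀)) =
        ENNReal.ofReal ((T ^ m) (f z₀) k) := by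
  have hfk : Measurable fun z => ENNReal.ofReal (f z k) :=
    ((measurable_pi_apply k).comp hf).ennreal_ofReal
  have hadd : ∀ (m : ℕ) (s : Finset ι) (ν : ι → Measure Z),
      (ringOp u)^[m] (∑ i ∈ s, ν i) = ∑ i ∈ s, (ringOp u)^[m] (ν i) := by
    intro m s ν
    induction m with
    | zero => rfl
    | succ m ih =>
      simp only [Function.iterate_succ_apply', ih]
      ext A hA
      simp only [ringOp_apply hu _ hA, Measure.coe_finsetSum, Finset.sum_apply]
      exact Finset.sum_comm
  induction m with
  | zero => intro z₀; exact ⟨hf0 z₀ k, by simp [lintegral_dirac' _ hfk]⟩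
  | succ m ih =>
    intro z₀
    have h1 : (T ^ (m + 1)) (f z₀) k = ∑ i, (T ^ m) (f (u i z₀)) k := by
      rw [pow_succ, mul_apply_eq_comp, ← hT, map_sum, Finset.sum_apply]
    refine ⟨h1 ▸ Finset.sum_nonneg fun i _ => (ih _).1, ?_⟩
    have h2 : ringOp u (Measure.dirac z₀) = ∑ i, Measure.dirac (u i z₀) := by
      simp only [ringOp, Measure.map_dirac' (hu _)]
    rw [Function.iterate_succ_apply, h2, hadd, lintegral_finsetSum_measure, h1,
      ENNReal.ofReal_sum_of_nonneg fun i _ => (ih _).1]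
    exact Finset.sum_congr rfl fun i _ => (ih _).2

/-- Kolmogorov's equation for a nonnegative vector-valued observable `f` whose sum over all rings
is a linear function `T` of the observable: the expectation `F` of `f` solves `F' = T F - |ι| F`. -/
lemma exists_hasDerivAt_lintegral_clockLaw_dirac {u : ι → Z → Z} (hu : ∀ i, Measurable (u i))
    {f : Z → κ → ℝ} (hf : Measurable f) (hf0 : ∀ z k, 0 ≤ f z k)
    (T : (κ → ℝ) →L[ℝ] (κ → ℝ)) (hT : ∀ z, ∑ i, f (u i z) = T (f z)) (z₀ : Z) :
    ∃ F : ℝ → κ → ℝ, F 0 = f z₀ ∧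
      (∀ t, HasDerivAt F (T (F t) - (Fintype.card ι : ℝ) • F t) t) ∧
      ∀ (t : ℝ≥0) (k : κ), 0 ≤ F t k ∧
        ∫⁻ z, ENNReal.ofReal (f z k) ∂(clockLaw u t (Measure.dirac z₀)) =
          ENNReal.ofReal (F t k) := by
  set K : ℝ := ((Fintype.card ι : ℕ) : ℝ)
  refine ⟨fun t => Real.exp (-(K * t)) • NormedSpace.exp (t • T) (f z₀), by simp, ?_, ?_⟩
  · intro t
    have h1 : HasDerivAt (fun t : ℝ => Real.exp (-(K * t))) (Real.exp (-(K * t)) * -(K * 1)) t :=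
      (((hasDerivAt_id t).const_mul K).neg).exp
    have h2 : HasDerivAt (fun t : ℝ => NormedSpace.exp (t • T) (f z₀))
        ((T * NormedSpace.exp (t • T)) (f z₀)) t :=
      (hasDerivAt_exp_smul_const' (𝕂 := ℝ) T t).clm_apply (hasDerivAt_const t (f z₀)) |>.congr_deriv
        (by simp)
    refine (h1.smul h2).congr_deriv ?_
    simp only [map_smul, mul_apply_eq_comp, smul_smul]
    rw [sub_eq_add_neg, ← neg_smul]
    congr 2
    ring
  · intro t k
    have hS : HasSum (fun m : ℕ => ((m.factorial : ℝ)⁻¹ • ((t : ℝ) • T) ^ m))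
        (NormedSpace.exp ((t : ℝ) • T)) := NormedSpace.exp_series_hasSum_exp' (𝕂 := ℝ) _
    have hS2 : HasSum (fun m : ℕ => ringWeight ι t m * (T ^ m) (f z₀) k)
        (Real.exp (-(K * t)) * NormedSpace.exp ((t : ℝ) • T) (f z₀) k) := by
      have h3 := (hS.mapL (ContinuousLinearMap.apply ℝ (κ → ℝ) (f z₀)))
      have h4 := (Pi.hasSum.1 h3 k).mul_left (Real.exp (-(K * t)))
      have e : (fun m : ℕ => ringWeight ι t m * (T ^ m) (f z₀) k) = fun m : ℕ =>
          Real.exp (-(K * t)) * ContinuousLinearMap.apply ℝ (κ → ℝ) (f z₀)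
            (((m.factorial : ℝ)⁻¹ • ((t : ℝ) • T) ^ m)) k := by
        funext m
        simp only [ringWeight, ContinuousLinearMap.apply_apply, smul_apply,
          smul_pow, Pi.smul_apply, smul_eq_mul, K]
        field_simp
      rw [e]
      exact h4
    have hnn := fun m : ℕ => mul_nonneg (ringWeight_nonneg (ι := ι) t m)
      (exists_lintegral_ringOp_iterate_dirac hu hf hf0 T hT m k z₀).1
    refine ⟨hS2.nonneg hnn, ?_⟩
    simp only [Pi.smul_apply, smul_eq_mul]
    rw [lintegral_clockLaw, ← hS2.tsum_eq, ENNReal.ofReal_tsum_of_nonneg hnn hS2.summable]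
    refine tsum_congr fun m => ?_
    rw [(exists_lintegral_ringOp_iterate_dirac hu hf hf0 T hT m k z₀).2,
      ENNReal.ofReal_mul (ringWeight_nonneg t m)]

end LinearObservable

/-! ### The law of a clock-driven process -/

section ClockDriven

variable {S : Type*} [Fintype S] {Z : Type*} [MeasurableSpace Z]

/-- A row of increments of the clocks is simple if at most one clock rings, and only once. -/
def IsSimpleRow (v : S → ℕ) : Prop := v = 0 ∨ ∃ i, v i = 1 ∧ ∀ j, j ≠ i → v j = 0

open Classical in
/-- The effect on a configuration of a simple row of increments of the clocks; a row which is not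
simple has no effect. -/
noncomputable def rowUpdate (u : S → Z → Z) (v : S → ℕ) (x : Z) : Z :=
  if h : ∃ i, v i = 1 ∧ ∀ j, j ≠ i → v j = 0 then u h.choose x else x

/-- The configuration after the first `k` rows of increments. -/
noncomputable def rowRun (u : S → Z → Z) (x : Z) (δ : ℕ → S → ℕ) : ℕ → Z
  | 0 => x
  | k + 1 => rowUpdate u (δ k) (rowRun u x δ k)

omit [MeasurableSpace Z] in
lemma rowUpdate_zero (u : S → Z → Z) (x : Z) : rowUpdate u 0 x = x := by
  simp [rowUpdate]

omit [MeasurableSpace Z] in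
lemma rowUpdate_single (u : S → Z → Z) {v : S → ℕ} {i : S} (hi : v i = 1)
    (hj : ∀ j, j ≠ i → v j = 0) (x : Z) : rowUpdate u v x = u i x := by
  have h : ∃ i, v i = 1 ∧ ∀ j, j ≠ i → v j = 0 := ⟨i, hi, hj⟩
  rw [rowUpdate, dif_pos h]
  congr 1
  by_contra hne
  have := hj _ hne
  rw [h.choose_spec.1] at this
  exact one_ne_zero this

lemma measurable_rowUpdate {u : S → Z → Z} (hu : ∀ i, Measurable (u i)) :
    Measurable fun p : (S → ℕ) × Z => rowUpdate u p.1 p.2 := by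
  refine measurable_from_prod_countable_right fun v => ?_
  by_cases h : ∃ i, v i = 1 ∧ ∀ j, j ≠ i → v j = 0
  · simpa only [rowUpdate, dif_pos h] using hu _
  · simpa only [rowUpdate, dif_neg h] using measurable_id'

lemma measurable_rowRun {u : S → Z → Z} (hu : ∀ i, Measurable (u i)) (k : ℕ) :
    Measurable fun p : Z × (ℕ → S → ℕ) => rowRun u p.1 p.2 k := by
  induction k with
  | zero => exact measurable_fst
  | succ k ih =>
    exact (measurable_rowUpdate hu).comp
      (((measurable_pi_apply k).comp measurable_snd).prodMk ih)

omit [MeasurableSpace Z] in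
lemma rowRun_congr (u : S → Z → Z) (x : Z) {δ δ' : ℕ → S → ℕ} {k : ℕ}
    (h : ∀ l < k, δ l = δ' l) : rowRun u x δ k = rowRun u x δ' k := by
  induction k with
  | zero => rfl
  | succ k ih =>
    rw [rowRun, rowRun, ih fun l hl => h l (by omega), h k (by omega)]

/-- The rows before `k` are all simple. -/
def simpleRows (k : ℕ) : Set (ℕ → S → ℕ) := {δ | ∀ l < k, IsSimpleRow (δ l)}

lemma measurableSet_simpleRows (k : ℕ) : MeasurableSet (simpleRows k : Set (ℕ → S → ℕ)) := by
  have : (simpleRows k : Set (ℕ → S → ℕ)) =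
      ⋂ l, ⋂ (_ : l < k), (fun δ : ℕ → S → ℕ => δ l) ⁻¹' {v | IsSimpleRow v} := by
    ext; simp [simpleRows]
  rw [this]
  exact MeasurableSet.iInter fun l => MeasurableSet.iInter fun _ =>
    measurable_pi_apply l (Set.to_countable _).measurableSet

variable {Ω : Type*} [MeasurableSpace Ω] {P : Measure Ω} [IsProbabilityMeasure P]

/-- The law of the discretized chain on the event that the first `k` rows are simple. -/
noncomputable def simpleLaw (u : S → Z → Z) (P : Measure Ω) (x : Ω → Z) (δ : ℕ → S → Ω → ℕ)
    (k : ℕ) : Measure Z :=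
  (P.restrict {ω | (fun l i => δ l i ω) ∈ simpleRows k}).map
    fun ω => rowRun u (x ω) (fun l i => δ l i ω) k

variable {u : S → Z → Z} {x : Ω → Z} {δ : ℕ → S → Ω → ℕ}

lemma indepFun_past_row (hx : Measurable x) (hδ : ∀ l i, Measurable (δ l i))
    (hind : iIndepFun (fun (p : ℕ × S) => δ p.1 p.2) P)
    (hxδ : IndepFun x (fun ω (l : ℕ) i => δ l i ω) P) (k : ℕ) :
    IndepFun (fun ω => (x ω, fun (l : ℕ) i => if l < k then δ l i ω else 0))
      (fun ω i => δ k i ω) P := by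
  classical
  have h1 := hind.indepFun_finset (Finset.range k ×ˢ Finset.univ) ({k} ×ˢ Finset.univ)
    (by
      rw [Finset.disjoint_left]
      rintro ⟨a, b⟩ h h'
      simp at h h'
      omega) (fun p => hδ p.1 p.2)
  let φ : ((↥(Finset.range k ×ˢ (Finset.univ : Finset S))) → ℕ) → (ℕ → S → ℕ) := fun f l i =>
    if h : l < k then f ⟨(l, i), by simp [h]⟩ else 0
  let ψ : ((↥(({k} : Finset ℕ) ×ˢ (Finset.univ : Finset S))) → ℕ) → (S → ℕ) := fun f i =>
    f ⟨(k, i), by simp⟩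
  have hφ : Measurable φ := by
    refine measurable_pi_lambda _ fun l => measurable_pi_lambda _ fun i => ?_
    by_cases h : l < k
    · simpa only [φ, dif_pos h] using measurable_pi_apply _
    · simpa only [φ, dif_neg h] using measurable_const
  have hψ : Measurable ψ := measurable_pi_lambda _ fun i => measurable_pi_apply _
  have h2 := h1.comp hφ hψ
  have e1 : (φ ∘ fun ω (p : ↥(Finset.range k ×ˢ (Finset.univ : Finset S))) =>
      δ p.1.1 p.1.2 ω) = fun ω (l : ℕ) i => if l < k then δ l i ω else 0 := by
    funext ω l i
    by_cases h : l < k <;> simp [φ, h]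
  have e2 : (ψ ∘ fun ω (p : ↥(({k} : Finset ℕ) ×ˢ (Finset.univ : Finset S))) =>
      δ p.1.1 p.1.2 ω) = fun ω i => δ k i ω := rfl
  have h3 : IndepFun (fun ω (l : ℕ) i => if l < k then δ l i ω else 0) (fun ω i => δ k i ω) P := by
    rw [← e1, ← e2]; exact h2
  have hM : Measurable fun ω (l : ℕ) i => if l < k then δ l i ω else 0 := by
    refine measurable_pi_lambda _ fun l => measurable_pi_lambda _ fun i => ?_
    by_cases h : l < k <;> simp [h, hδ l i]
  have hR : Measurable fun ω i => δ k i ω := measurable_pi_lambda _ fun i => hδ k i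
  have h4 : IndepFun x (fun ω => ((fun (l : ℕ) i => if l < k then δ l i ω else 0),
      (fun i => δ k i ω))) P := by
    refine hxδ.comp (φ := id) (ψ := fun f : ℕ → S → ℕ =>
      ((fun (l : ℕ) i => if l < k then f l i else 0), (fun i => f k i))) measurable_id ?_
    refine Measurable.prodMk ?_ (measurable_pi_apply k)
    refine measurable_pi_lambda _ fun l => measurable_pi_lambda _ fun i => ?_
    by_cases h : l < k
    · simp only [h, if_true]
      exact (measurable_pi_apply i).comp (measurable_pi_apply l)
    · simp [h]
  rw [indepFun_iff_map_prod_eq_prod_map_map (by fun_prop) (by fun_prop)] at h3 h4 ⊢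
  have h5 : IndepFun x (fun ω (l : ℕ) i => if l < k then δ l i ω else 0) P :=
    ((indepFun_iff_map_prod_eq_prod_map_map (by fun_prop) (by fun_prop)).2 h4).comp
      measurable_id measurable_fst
  rw [indepFun_iff_map_prod_eq_prod_map_map (by fun_prop) (by fun_prop)] at h5
  have := Measure.isProbabilityMeasure_map (μ := P) hx.aemeasurable
  have := Measure.isProbabilityMeasure_map (μ := P) hM.aemeasurable
  have := Measure.isProbabilityMeasure_map (μ := P) hR.aemeasurable
  rw [h3] at h4
  rw [h5, ← MeasurableEquiv.prodAssoc.map_measurableEquiv_injective.eq_iff,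
    Measure.prodAssoc_prod, ← h4, Measure.map_map (by fun_prop) (by fun_prop)]
  rfl

omit [IsProbabilityMeasure P] in
lemma measure_row_eq {h : ℝ≥0} (hδ : ∀ l i, Measurable (δ l i))
    (hind : iIndepFun (fun (p : ℕ × S) => δ p.1 p.2) P)
    (hlaw : ∀ l i, P.map (δ l i) = poissonMeasure h) (k : ℕ) (v : S → ℕ) :
    P {ω | (fun i => δ k i ω) = v} = ∏ i, poissonMeasure h {v i} := by
  have h1 : iIndepFun (fun i => δ k i) P :=
    hind.precomp (g := fun i : S => (k, i)) fun i j hij => (Prod.ext_iff.1 hij).2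
  have h2 := h1.measure_inter_preimage_eq_mul Finset.univ (sets := fun i => {v i})
    fun i _ => measurableSet_singleton _
  have e : {ω | (fun i => δ k i ω) = v} = ⋂ i ∈ Finset.univ, δ k i ⁻¹' {v i} := by
    ext ω; simp [funext_iff]
  rw [e, h2]
  refine Finset.prod_congr rfl fun i _ => ?_
  rw [← hlaw k i, Measure.map_apply (hδ k i) (measurableSet_singleton _)]

omit [IsProbabilityMeasure P] in
lemma simpleLaw_apply (hu : ∀ i, Measurable (u i)) (hx : Measurable x)
    (hδ : ∀ l i, Measurable (δ l i)) (k : ℕ) {A : Set Z} (hA : MeasurableSet A) :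
    simpleLaw u P x δ k A = P {ω | (fun l i => δ l i ω) ∈ simpleRows k ∧
      rowRun u (x ω) (fun l i => δ l i ω) k ∈ A} := by
  have hD : Measurable fun ω (l : ℕ) i => δ l i ω :=
    measurable_pi_lambda _ fun l => measurable_pi_lambda _ fun i => hδ l i
  have hr : Measurable fun ω => rowRun u (x ω) (fun l i => δ l i ω) k :=
    (measurable_rowRun hu k).comp (hx.prodMk hD)
  rw [simpleLaw, Measure.map_apply hr hA, Measure.restrict_apply (hr hA), Set.inter_comm]
  rfl

lemma measure_simple_inter_row (hu : ∀ i, Measurable (u i)) (hx : Measurable x)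
    (hδ : ∀ l i, Measurable (δ l i)) (hind : iIndepFun (fun (p : ℕ × S) => δ p.1 p.2) P)
    (hxδ : IndepFun x (fun ω (l : ℕ) i => δ l i ω) P) (k : ℕ) {A : Set Z} (hA : MeasurableSet A)
    (v : S → ℕ) :
    P {ω | ((fun l i => δ l i ω) ∈ simpleRows k ∧ rowRun u (x ω) (fun l i => δ l i ω) k ∈ A) ∧
      (fun i => δ k i ω) = v} = simpleLaw u P x δ k A * P {ω | (fun i => δ k i ω) = v} := by
  let B : Set (Z × (ℕ → S → ℕ)) := {p | p.2 ∈ simpleRows k ∧ rowRun u p.1 p.2 k ∈ A}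
  have hB : MeasurableSet B :=
    (measurable_snd (measurableSet_simpleRows k)).inter (measurable_rowRun hu k hA)
  have hi := (indepFun_past_row hx hδ hind hxδ k).measure_inter_preimage_eq_mul B {v} hB
    (measurableSet_singleton _)
  have e : ∀ ω, (x ω, fun (l : ℕ) i => if l < k then δ l i ω else 0) ∈ B ↔
      ((fun l i => δ l i ω) ∈ simpleRows k ∧ rowRun u (x ω) (fun l i => δ l i ω) k ∈ A) := by
    intro ω
    have h1 : ∀ l < k, (fun i => if l < k then δ l i ω else 0) = fun i => δ l i ω := by
      intro l hl; simp [hl]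
    refine and_congr ?_ ?_
    · refine forall₂_congr fun l hl => ?_
      change IsSimpleRow (fun i => if l < k then δ l i ω else 0) ↔ IsSimpleRow (fun i => δ l i ω)
      rw [h1 l hl]
    · change rowRun u (x ω) (fun (l : ℕ) i => if l < k then δ l i ω else 0) k ∈ A ↔ _
      rw [rowRun_congr u (x ω) h1]
  have e1 : (fun ω => (x ω, fun (l : ℕ) i => if l < k then δ l i ω else 0)) ⁻¹' B =
      {ω | (fun l i => δ l i ω) ∈ simpleRows k ∧ rowRun u (x ω) (fun l i => δ l i ω) k ∈ A} := by
    ext ω; exact e ω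
  have e2 : {ω | ((fun l i => δ l i ω) ∈ simpleRows k ∧
      rowRun u (x ω) (fun l i => δ l i ω) k ∈ A) ∧ (fun i => δ k i ω) = v} =
      (fun ω => (x ω, fun (l : ℕ) i => if l < k then δ l i ω else 0)) ⁻¹' B ∩
        (fun ω i => δ k i ω) ⁻¹' {v} := by
    ext ω; exact and_congr (e ω).symm Iff.rfl
  rw [simpleLaw_apply hu hx hδ k hA, ← e1, e2, hi]
  rfl

omit [Fintype S] in
lemma isSimpleRow_iff [DecidableEq S] (v : S → ℕ) :
    IsSimpleRow v ↔ ∃ o : Option S, v = o.elim 0 fun i => Pi.single i 1 := by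
  constructor
  · rintro (h | ⟨i, hi, hj⟩)
    · exact ⟨none, h⟩
    · refine ⟨some i, funext fun j => ?_⟩
      by_cases h : j = i
      · subst h; simp [hi]
      · simp [hj j h, h]
  · rintro ⟨_ | i, rfl⟩
    · exact Or.inl rfl
    · exact Or.inr ⟨i, by simp, fun j hj => by simp [hj]⟩

/-- One step of the discretization: no clock rings, or exactly one clock rings. -/
lemma simpleLaw_succ {h : ℝ≥0} (hu : ∀ i, Measurable (u i)) (hx : Measurable x)
    (hδ : ∀ l i, Measurable (δ l i)) (hind : iIndepFun (fun (p : ℕ × S) => δ p.1 p.2) P)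
    (hlaw : ∀ l i, P.map (δ l i) = poissonMeasure h)
    (hxδ : IndepFun x (fun ω (l : ℕ) i => δ l i ω) P) (k : ℕ) :
    simpleLaw u P x δ (k + 1) = ENNReal.ofReal (Real.exp (-(Fintype.card S * h))) •
      (simpleLaw u P x δ k + (h : ℝ≥0∞) • ringOp u (simpleLaw u P x δ k)) := by
  classical
  ext A hA
  let row : Option S → S → ℕ := fun o => o.elim 0 fun i => Pi.single i 1
  let V : Option S → Z → Z := fun o => o.elim id u
  have hV : ∀ o, Measurable (V o) := by
    rintro (_ | i)
    · exact measurable_id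
    · exact hu i
  have hrow : Function.Injective row := by
    rintro (_ | i) (_ | j) hij
    · rfl
    · have := congrFun hij j; simp [row] at this
    · have := congrFun hij i; simp [row] at this
    · have := congrFun hij i
      by_cases hne : i = j
      · rw [hne]
      · simp [row, hne] at this
  have hupd : ∀ o z, rowUpdate u (row o) z = V o z := by
    rintro (_ | i) z
    · exact rowUpdate_zero u z
    · exact rowUpdate_single u (i := i) (by simp [row]) (fun j hj => by simp [row, hj]) z
  have hset : {ω | (fun l i => δ l i ω) ∈ simpleRows (k + 1) ∧
      rowRun u (x ω) (fun l i => δ l i ω) (k + 1) ∈ A} =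
      ⋃ o, {ω | ((fun l i => δ l i ω) ∈ simpleRows k ∧
        rowRun u (x ω) (fun l i => δ l i ω) k ∈ V o ⁻¹' A) ∧ (fun i => δ k i ω) = row o} := by
    ext ω
    simp only [Set.mem_ofPred_eq, Set.mem_iUnion, Set.mem_preimage, rowRun]
    constructor
    · rintro ⟨h1, h2⟩
      obtain ⟨o, ho⟩ := (isSimpleRow_iff _).1 (h1 k (Nat.lt_succ_self k))
      refine ⟨o, ⟨fun l hl => h1 l (by omega), ?_⟩, ho⟩
      rw [← hupd]
      have ho' : (fun i => δ k i ω) = row o := ho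
      rwa [ho'] at h2
    · rintro ⟨o, ⟨h1, h2⟩, h3⟩
      refine ⟨fun l hl => ?_, ?_⟩
      · rcases Nat.lt_succ_iff_lt_or_eq.1 hl with hl | rfl
        · exact h1 l hl
        · exact (isSimpleRow_iff _).2 ⟨o, h3⟩
      · rw [h3, hupd]; exact h2
  have hD : Measurable fun ω (l : ℕ) i => δ l i ω :=
    measurable_pi_lambda _ fun l => measurable_pi_lambda _ fun i => hδ l i
  have hr : Measurable fun ω => rowRun u (x ω) (fun l i => δ l i ω) k :=
    (measurable_rowRun hu k).comp (hx.prodMk hD)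
  rw [simpleLaw_apply hu hx hδ _ hA, hset, measure_iUnion]
  · simp_rw [measure_simple_inter_row hu hx hδ hind hxδ k (hV _ hA), measure_row_eq hδ hind hlaw]
    rw [tsum_fintype, Fintype.sum_option]
    have p0 : ∏ i, poissonMeasure h {row none i} =
        ENNReal.ofReal (Real.exp (-(Fintype.card S * h))) := by
      simp only [row, Option.elim_none, Pi.zero_apply, poissonMeasure_singleton, pow_zero, mul_one,
        Nat.factorial_zero, Nat.cast_one, div_one, Finset.prod_const, Finset.card_univ]
      rw [← ENNReal.ofReal_pow (by positivity), ← Real.exp_nat_mul]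
      ring_nf
    have p1 : ∀ j, ∏ i, poissonMeasure h {row (some j) i} =
        ENNReal.ofReal (Real.exp (-(Fintype.card S * h))) * h := by
      intro j
      rw [← ENNReal.ofReal_coe_nnreal, ← ENNReal.ofReal_mul (by positivity)]
      simp only [row, Option.elim_some, poissonMeasure_singleton]
      rw [← ENNReal.ofReal_prod_of_nonneg fun i _ => by positivity]
      congr 1
      have : ∀ i, Real.exp (-h) * (h : ℝ) ^ (Pi.single j 1 : S → ℕ) i /
          ((Pi.single j 1 : S → ℕ) i).factorial = Real.exp (-h) * if i = j then (h : ℝ) else 1 := by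
        intro i
        by_cases hij : i = j
        · subst hij; simp
        · simp [hij]
      rw [Finset.prod_congr rfl fun i _ => this i, Finset.prod_mul_distrib, Finset.prod_const,
        ← Real.exp_nat_mul]
      simp
    rw [p0]
    simp only [p1, Measure.smul_apply, Measure.add_apply, smul_eq_mul, ringOp_apply hu _ hA]
    rw [mul_add, Finset.mul_sum, Finset.mul_sum, mul_comm]
    congr 1
    refine Finset.sum_congr rfl fun i _ => ?_
    change simpleLaw u P x δ k (u i ⁻¹' A) * _ = _
    ring
  · intro o o' hne
    rw [Function.onFun, Set.disjoint_left]
    rintro ω ⟨_, h1⟩ ⟨_, h2⟩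
    exact hne (hrow (h1.symm.trans h2))
  · intro o
    refine MeasurableSet.inter (MeasurableSet.inter (hD (measurableSet_simpleRows k))
      (hr (hV o hA))) ?_
    exact (measurable_pi_lambda _ fun i => hδ k i) (measurableSet_singleton (row o))

/-- The discretized chain is dominated by the clock law, and its mass, the probability that all
rows are simple, is explicit. -/
lemma simpleLaw_le_clockLaw {h : ℝ≥0} (hu : ∀ i, Measurable (u i)) (hx : Measurable x)
    (hδ : ∀ l i, Measurable (δ l i)) (hind : iIndepFun (fun (p : ℕ × S) => δ p.1 p.2) P)
    (hlaw : ∀ l i, P.map (δ l i) = poissonMeasure h)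
    (hxδ : IndepFun x (fun ω (l : ℕ) i => δ l i ω) P) (k : ℕ) :
    simpleLaw u P x δ k ≤ clockLaw u (k * h) (P.map x) ∧ simpleLaw u P x δ k Set.univ =
      ENNReal.ofReal ((Real.exp (-(Fintype.card S * h)) * (1 + Fintype.card S * h)) ^ k) := by
  induction k with
  | zero =>
    have : simpleLaw u P x δ 0 = P.map x := by
      simp [simpleLaw, simpleRows, rowRun]
    have hp := Measure.isProbabilityMeasure_map (μ := P) hx.aemeasurable
    refine ⟨by simp [this, clockLaw_zero], by simp [this]⟩
  | succ k ih =>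
    rw [simpleLaw_succ hu hx hδ hind hlaw hxδ]
    constructor
    · have := smul_add_ringOp_le_clockLaw hu (k * h) h (P.map x) _ ih.1
      convert this using 2
      push_cast; ring
    · simp only [Measure.smul_apply, Measure.add_apply, smul_eq_mul, ringOp_univ hu, ih.2]
      rw [pow_succ, ENNReal.ofReal_mul (by positivity), ENNReal.ofReal_mul (by positivity),
        ENNReal.ofReal_add (by positivity) (by positivity), ENNReal.ofReal_mul (by positivity)]
      simp
      ring

end ClockDriven

/-- The law at time `t` of a process driven by independent Poisson clocks. On the event that at most
one clock rings, and only once, in each interval of a mesh of `[0, t]`, the path follows the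
discretized chain, so that its law is dominated by the clock law there. The probability of this
event tends to `1` as the mesh is refined, and domination of probability measures is equality. -/
theorem IsClockDriven.map_eq_clockLaw {S : Type*} [Fintype S]
    {u : S → EuclideanSpace ℝ S → EuclideanSpace ℝ S} (hu : ∀ i, Measurable (u i))
    {Ω : Type*} [MeasurableSpace Ω] {P : Measure Ω} [IsProbabilityMeasure P]
    {N : S → ℝ≥0 → Ω → ℕ} {X : ℝ≥0 → Ω → EuclideanSpace ℝ S} (hX : IsClockDriven u N X P)
    (t : ℝ≥0) : P.map (X t) = clockLaw u t (P.map (X 0)) := by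
  have hp := Measure.isProbabilityMeasure_map (μ := P) (hX.measurable t).aemeasurable
  have hp0 := Measure.isProbabilityMeasure_map (μ := P) (hX.measurable 0).aemeasurable
  have hpc := isProbabilityMeasure_clockLaw hu t (P.map (X 0))
  refine Measure.eq_of_le_of_isProbabilityMeasure ?_
  refine Measure.le_iff.2 fun A hA => ?_
  -- the mesh of the discretization is `t / m`
  have key : ∀ m : ℕ, 0 < m → P.map (X t) A ≤ clockLaw u t (P.map (X 0)) A +
      (1 - ENNReal.ofReal (Real.exp (-(Fintype.card S * t)) *
        (1 + (Fintype.card S * t) / m) ^ m)) := by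
    intro m hm
    set h : ℝ≥0 := t / m
    have hmh : (m : ℝ≥0) * h = t := by
      have : (m : ℝ≥0) ≠ 0 := by exact_mod_cast hm.ne'
      simp only [h]; field_simp
    let δ : ℕ → S → Ω → ℕ := fun l i ω => N i ((l + 1 : ℕ) * h) ω - N i ((l : ℕ) * h) ω
    have hmono : Monotone fun l : ℕ => (l : ℝ≥0) * h := by
      intro a b hab
      exact mul_le_mul_left (by exact_mod_cast hab) h
    have hδ : ∀ l i, Measurable (δ l i) := fun l i =>
      ((hX.clock i).measurable _).sub ((hX.clock i).measurable _)
    have hind0 : iIndepFun (fun (p : S × ℕ) => δ p.2 p.1) P := by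
      refine iIndepFun_uncurry' (X := fun i l => δ l i) (fun i l => hδ l i) ?_ ?_
      · refine hX.indep_clocks.comp
          (fun _ f (l : ℕ) => f ((l + 1 : ℕ) * h) - f ((l : ℕ) * h)) fun i => ?_
        fun_prop
      · intro i
        exact (hX.clock i).indepIncrements.nat hmono
    have hind : iIndepFun (fun (p : ℕ × S) => δ p.1 p.2) P :=
      hind0.precomp (g := Prod.swap) Prod.swap_injective
    have hlaw : ∀ l i, P.map (δ l i) = poissonMeasure h := by
      intro l i
      have := ((hX.clock i).law _ _ (hmono (Nat.le_succ l))).map_eq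
      rw [show ((l.succ : ℕ) : ℝ≥0) * h - (l : ℝ≥0) * h = h by
        rw [Nat.cast_succ, add_mul, one_mul, add_tsub_cancel_left]] at this
      exact this
    have hxδ : IndepFun (X 0) (fun ω (l : ℕ) i => δ l i ω) P := by
      refine hX.indep_initial.comp (φ := id) (ψ := fun f (l : ℕ) i =>
        f i ((l + 1 : ℕ) * h) - f i ((l : ℕ) * h)) measurable_id ?_
      fun_prop
    obtain ⟨h1, h2⟩ := simpleLaw_le_clockLaw hu (hX.measurable 0) hδ hind hlaw hxδ m
    rw [hmh] at h1
    have hG : NullMeasurableSet {ω | (fun l i => δ l i ω) ∈ simpleRows m} P := by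
      refine MeasurableSet.nullMeasurableSet ?_
      exact (measurable_pi_lambda _ fun l => measurable_pi_lambda _ fun i => hδ l i)
        (measurableSet_simpleRows m)
    have hrun : ∀ᵐ ω ∂P, (fun l i => δ l i ω) ∈ simpleRows m →
        rowRun (Z := EuclideanSpace ℝ S) u (X 0 ω) (fun l i => δ l i ω) m = X t ω := by
      have hmon : ∀ᵐ ω ∂P, ∀ i, Monotone fun t => N i t ω :=
        ae_all_iff.2 fun i => (hX.clock i).mono
      filter_upwards [hX.hold, hX.ring, hmon] with ω hh hr hm hs
      have : ∀ k ≤ m, rowRun u (X 0 ω) (fun l i => δ l i ω) k = X (k * h) ω := by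
        intro k
        induction k with
        | zero => intro _; simp [rowRun]
        | succ k ih =>
          intro hk
          rw [rowRun, ih (by omega)]
          have hle := hmono (Nat.le_succ k)
          have hNle : ∀ j, N j (k * h) ω ≤ N j ((k + 1 : ℕ) * h) ω := fun j => hm j hle
          rcases hs k (by omega) with h0 | ⟨i, hi, hj⟩
          · have hz : ∀ j, N j ((k + 1 : ℕ) * h) ω = N j (k * h) ω := by
              intro j
              have : N j ((k + 1 : ℕ) * h) ω - N j (k * h) ω = 0 := congrFun h0 j
              have := hNle j
              omega
            rw [hh _ _ hle hz]
            have h0' : (fun i => δ k i ω) = 0 := h0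
            rw [h0', rowUpdate_zero]
          · rw [rowUpdate_single u hi hj]
            refine (hr _ _ hle i ?_ ?_).symm
            · have h3 : N i ((k + 1 : ℕ) * h) ω - N i (k * h) ω = 1 := hi
              have := hNle i
              simp only [Nat.succ_eq_add_one]
              omega
            · intro j hji
              have h3 : N j ((k + 1 : ℕ) * h) ω - N j (k * h) ω = 0 := hj j hji
              have := hNle j
              simp only [Nat.succ_eq_add_one]
              omega
      rw [this m le_rfl, hmh]
    set G := {ω | (fun l i => δ l i ω) ∈ simpleRows m}
    have hGm : P G = ENNReal.ofReal (Real.exp (-(Fintype.card S * t)) *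
        (1 + (Fintype.card S * t) / m) ^ m) := by
      have e1 : P G = simpleLaw u P (X 0) δ m Set.univ := by
        rw [simpleLaw_apply hu (hX.measurable 0) hδ m MeasurableSet.univ]
        simp [G]
      rw [e1, h2]
      congr 1
      have hm' : (m : ℝ) ≠ 0 := by exact_mod_cast hm.ne'
      rw [mul_pow, ← Real.exp_nat_mul]
      simp only [h, NNReal.coe_div, NNReal.coe_natCast]
      congr 2
      · field_simp
      · ring
    rw [← hGm, Measure.map_apply (hX.measurable t) hA]
    have hGA : P (X t ⁻¹' A ∩ G) ≤ clockLaw u t (P.map (X 0)) A := by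
      refine le_trans ?_ (h1 A)
      rw [simpleLaw_apply hu (hX.measurable 0) hδ m hA]
      refine measure_mono_ae ?_
      filter_upwards [hrun] with ω hω hmem
      exact ⟨hmem.2, by rw [hω hmem.2]; exact hmem.1⟩
    calc P (X t ⁻¹' A) ≤ P (X t ⁻¹' A ∩ G) + P Gᶜ := by
          refine (measure_mono ?_).trans (measure_union_le _ _)
          intro ω hω
          by_cases hg : ω ∈ G
          · exact Or.inl ⟨hω, hg⟩
          · exact Or.inr hg
      _ ≤ _ := by
          rw [prob_compl_eq_one_sub₀ hG]
          gcongr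
  have hlim : Tendsto (fun m : ℕ => clockLaw u t (P.map (X 0)) A +
      (1 - ENNReal.ofReal (Real.exp (-(Fintype.card S * t)) *
        (1 + (Fintype.card S * t) / m) ^ m))) atTop
      (𝓝 (clockLaw u t (P.map (X 0)) A + (1 - ENNReal.ofReal 1))) := by
    refine Tendsto.const_add _ (ENNReal.Tendsto.sub tendsto_const_nhds
      (ENNReal.tendsto_ofReal ?_) (Or.inl (by simp)))
    have := (Real.tendsto_one_add_div_pow_exp (Fintype.card S * t)).const_mul
      (Real.exp (-(Fintype.card S * t)))
    rwa [← Real.exp_add, neg_add_cancel, Real.exp_zero] at this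
  rw [ENNReal.ofReal_one, tsub_self, add_zero] at hlim
  exact ge_of_tendsto hlim (eventually_atTop.2 ⟨1, fun m hm => key m hm⟩)

/-! ### Fourier analysis on the torus -/

section Fourier

variable {d n : ℕ} [NeZero n]

/-- The character of the torus with frequency `k`. -/
noncomputable def torusChar (k x : Torus d n) : ℂ := ∏ i, ZMod.stdAddChar (k i * x i)

/-- The eigenvalue `1 - d⁻¹ ∑ᵢ cos (2π kᵢ / n)` of the negative generator `1 - p` of the simple
random walk, for the character with frequency `k`. -/
noncomputable def torusEigenvalue (k : Torus d n) : ℝ :=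
  1 - (d : ℝ)⁻¹ * ∑ i, (ZMod.stdAddChar (k i) : ℂ).re

/-- The Fourier coefficient of `y` at the frequency `k`. -/
noncomputable def torusFourier (y : Torus d n → ℝ) (k : Torus d n) : ℂ :=
  ∑ x, (y x : ℂ) * torusChar k x

lemma torusChar_add (k x y : Torus d n) :
    torusChar k (x + y) = torusChar k x * torusChar k y := by
  simp [torusChar, mul_add, AddChar.map_add_eq_mul, Finset.prod_mul_distrib]

lemma torusChar_neg (k x : Torus d n) :
    torusChar k (-x) = (starRingEnd ℂ) (torusChar k x) := by
  simp only [torusChar, Pi.neg_apply, mul_neg, map_prod]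
  refine Finset.prod_congr rfl fun i _ => ?_
  rw [ZMod.stdAddChar_apply, ZMod.stdAddChar_apply, AddChar.map_neg_eq_inv, Circle.coe_inv_eq_conj]

lemma torusChar_zero_right (k : Torus d n) : torusChar k 0 = 1 := by
  simp [torusChar]

lemma torusChar_zero_left (x : Torus d n) : torusChar 0 x = 1 := by
  simp [torusChar]

lemma normSq_torusChar (k x : Torus d n) : Complex.normSq (torusChar k x) = 1 := by
  have h : (torusChar k x) * (starRingEnd ℂ) (torusChar k x) = 1 := by
    rw [← torusChar_neg, ← torusChar_add, add_neg_cancel, torusChar_zero_right]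
  rw [Complex.mul_conj] at h
  exact_mod_cast h

lemma torusChar_single (k : Torus d n) (i : Fin d) (a : ZMod n) :
    torusChar k (Pi.single i a) = ZMod.stdAddChar (k i * a) := by
  rw [torusChar, Finset.prod_eq_single i]
  · simp
  · intro j _ hj; simp [hj]
  · simp

lemma sum_torusChar (x : Torus d n) :
    ∑ k : Torus d n, torusChar k x = if x = 0 then ((n : ℂ) ^ d) else 0 := by
  have h1 : ∑ k : Torus d n, torusChar k x =
      ∏ i, ∑ a : ZMod n, (ZMod.stdAddChar (a * x i) : ℂ) := by
    rw [Finset.prod_univ_sum, Fintype.piFinset_univ]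
    rfl
  have h2 : ∀ i, ∑ a : ZMod n, (ZMod.stdAddChar (a * x i) : ℂ) =
      if x i = 0 then (n : ℂ) else 0 := by
    intro i
    have := AddChar.sum_mulShift (x i) (ZMod.isPrimitive_stdAddChar n)
    rw [this]
    simp [ZMod.card]
  rw [h1]
  simp only [h2]
  by_cases hx : x = 0
  · subst hx; simp
  · rw [if_neg hx]
    obtain ⟨i, hi⟩ := Function.ne_iff.1 hx
    exact Finset.prod_eq_zero (Finset.mem_univ i) (if_neg hi)

/-- Parseval's identity. -/
lemma sum_torusFourier_mul_conj (y z : Torus d n → ℝ) :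
    ∑ k, torusFourier y k * (starRingEnd ℂ) (torusFourier z k) =
      (n : ℂ) ^ d * ∑ x, (y x : ℂ) * z x := by
  have h : ∀ k, torusFourier y k * (starRingEnd ℂ) (torusFourier z k) =
      ∑ x, ∑ x', (y x : ℂ) * z x' * torusChar k (x - x') := by
    intro k
    simp only [torusFourier, map_sum, map_mul, Complex.conj_ofReal, Finset.sum_mul_sum,
      sub_eq_add_neg, torusChar_add, torusChar_neg]
    refine Finset.sum_congr rfl fun x _ => Finset.sum_congr rfl fun x' _ => ?_
    ring
  simp only [h]
  rw [Finset.sum_comm, Finset.mul_sum]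
  refine Finset.sum_congr rfl fun x _ => ?_
  rw [Finset.sum_comm, Finset.sum_eq_single x]
  · rw [← Finset.mul_sum, sum_torusChar, sub_self, if_pos rfl]; ring
  · intro x' _ hx
    rw [← Finset.mul_sum, sum_torusChar, if_neg (sub_ne_zero.2 hx.symm), mul_zero]
  · simp

lemma sum_normSq_torusFourier (y : Torus d n → ℝ) :
    ∑ k, Complex.normSq (torusFourier y k) = (n : ℝ) ^ d * ∑ x, y x ^ 2 := by
  have h := sum_torusFourier_mul_conj y y
  simp only [Complex.mul_conj] at h
  have h2 : ((∑ k, Complex.normSq (torusFourier y k) : ℝ) : ℂ) =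
      (((n : ℝ) ^ d * ∑ x, y x ^ 2 : ℝ) : ℂ) := by
    push_cast
    rw [h]
    simp [sq]
  exact_mod_cast h2

omit [NeZero n] in
lemma torusAdj_comm {i j : Torus d n} : torusAdj i j ↔ torusAdj j i := by
  constructor <;> rintro ⟨k, rfl | rfl⟩ <;> exact ⟨k, by simp⟩

omit [NeZero n] in
lemma torusWalk_comm (i j : Torus d n) : torusWalk d n i j = torusWalk d n j i := by
  by_cases h : torusAdj i j
  · simp [torusWalk, h, torusAdj_comm.1 h]
  · simp [torusWalk, h, mt torusAdj_comm.1 h]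

omit [NeZero n] in
lemma one_ne_neg_one_zmod (hn : 3 ≤ n) : (1 : ZMod n) ≠ -1 := by
  intro h
  have h2 : ((2 : ℕ) : ZMod n) = 0 := by
    push_cast
    linear_combination h
  rw [ZMod.natCast_eq_zero_iff] at h2
  have := Nat.le_of_dvd (by norm_num) h2
  omega

omit [NeZero n] in
lemma one_ne_zero_zmod (hn : 3 ≤ n) : (1 : ZMod n) ≠ 0 := by
  have : Fact (1 < n) := ⟨by omega⟩
  exact one_ne_zero

/-- The `2 d` neighbors of a site are distinct. -/
lemma sum_torusWalk_mul (hn : 3 ≤ n) (l : Torus d n) (f : Torus d n → ℝ) :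
    ∑ j, torusWalk d n l j * f j =
      1 / (2 * d) * ∑ i, (f (l + Pi.single i 1) + f (l - Pi.single i 1)) := by
  classical
  have h1 := one_ne_zero_zmod hn
  have h2 := one_ne_neg_one_zmod hn
  let nb : Fin d × Bool → Torus d n := fun p => l + Pi.single p.1 (if p.2 then 1 else -1)
  have hnb : Function.Injective nb := by
    rintro ⟨i, a⟩ ⟨j, b⟩ h
    have h' : (Pi.single i (if a then 1 else -1) : Torus d n) = Pi.single j (if b then 1 else -1) :=
      add_left_cancel h
    have hi := congrFun h' i
    by_cases hij : i = j
    · subst hij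
      rw [Pi.single_eq_same, Pi.single_eq_same] at hi
      cases a <;> cases b <;> simp_all
    · rw [Pi.single_eq_same, Pi.single_eq_of_ne hij] at hi
      cases a <;> simp_all
  have himg : Finset.univ.filter (fun j => torusAdj l j) = Finset.univ.image nb := by
    ext j
    rw [Finset.mem_filter]
    simp only [Finset.mem_univ, true_and, Finset.mem_image, Prod.exists,
      Bool.exists_bool, torusAdj, nb]
    constructor
    · rintro ⟨k, h | h⟩
      · exact ⟨k, Or.inr (by simp [h])⟩
      · exact ⟨k, Or.inl (by simp [h, sub_eq_add_neg, Pi.single_neg])⟩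
    · rintro ⟨k, h | h⟩
      · exact ⟨k, Or.inr (by simp [← h, sub_eq_add_neg, Pi.single_neg])⟩
      · exact ⟨k, Or.inl (by simp [← h])⟩
  have e : ∀ j, torusWalk d n l j * f j = 1 / (2 * d) * if torusAdj l j then f j else 0 := by
    intro j; unfold torusWalk; split_ifs <;> simp
  simp only [e]
  rw [← Finset.mul_sum, ← Finset.sum_filter, himg, Finset.sum_image fun a _ b _ h => hnb h,
    Fintype.sum_prod_type]
  congr 1
  refine Finset.sum_congr rfl fun i _ => ?_
  simp [nb, sub_eq_add_neg, Pi.single_neg]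

lemma sum_torusWalk (hd : 1 ≤ d) (hn : 3 ≤ n) (l : Torus d n) : ∑ j, torusWalk d n l j = 1 := by
  have h := sum_torusWalk_mul hn l fun _ => 1
  simp only [mul_one] at h
  rw [h]
  have : (d : ℝ) ≠ 0 := by exact_mod_cast (by omega : d ≠ 0)
  simp
  field_simp
  norm_num

/-- The increment `p y - y` which the rings of the smoothing process bring about. -/
noncomputable def torusLaplace (y : Torus d n → ℝ) (l : Torus d n) : ℝ :=
  ∑ j, torusWalk d n l j * y j - y l

lemma torusFourier_torusLaplace (hd : 1 ≤ d) (hn : 3 ≤ n) (y : Torus d n → ℝ) (k : Torus d n) :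
    torusFourier (torusLaplace y) k = -(torusEigenvalue k : ℂ) * torusFourier y k := by
  have hd' : (d : ℂ) ≠ 0 := by exact_mod_cast (by omega : d ≠ 0)
  have hshift : ∀ a : Torus d n, ∑ l, (y (l + a) : ℂ) * torusChar k l =
      torusFourier y k * torusChar k (-a) := by
    intro a
    rw [torusFourier, Finset.sum_mul, ← Equiv.sum_comp (Equiv.addRight a)
      fun x => (y x : ℂ) * torusChar k x * torusChar k (-a)]
    refine Finset.sum_congr rfl fun l _ => ?_
    simp only [Equiv.coe_addRight]
    rw [mul_assoc, ← torusChar_add, add_neg_cancel_right]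
  have hre : ∀ i : Fin d, torusChar k (-(Pi.single i 1)) + torusChar k (Pi.single i 1) =
      2 * ((ZMod.stdAddChar (k i) : ℂ).re : ℂ) := by
    intro i
    rw [torusChar_neg, add_comm, Complex.add_conj, torusChar_single, mul_one]
    push_cast; ring
  have h1 : torusFourier (torusLaplace y) k = (1 / (2 * d)) *
      ∑ i : Fin d, (∑ l, (y (l + Pi.single i 1) : ℂ) * torusChar k l +
        ∑ l, (y (l + -(Pi.single i 1)) : ℂ) * torusChar k l) - torusFourier y k := by
    simp only [torusFourier, torusLaplace, sum_torusWalk_mul hn]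
    rw [eq_sub_iff_add_eq, ← Finset.sum_add_distrib]
    simp only [← Finset.sum_add_distrib]
    rw [Finset.sum_comm, Finset.mul_sum]
    refine Finset.sum_congr rfl fun l _ => ?_
    push_cast
    rw [sub_mul, sub_add_cancel, mul_assoc, Finset.sum_mul]
    congr 1
    refine Finset.sum_congr rfl fun i _ => ?_
    rw [← sub_eq_add_neg]
    ring
  rw [h1]
  simp only [hshift, neg_neg, ← mul_add, hre]
  rw [torusEigenvalue, ← Finset.mul_sum, ← Finset.mul_sum]
  push_cast
  field_simp
  ring

lemma sum_torusLaplace_sq (hd : 1 ≤ d) (hn : 3 ≤ n) (y : Torus d n → ℝ) :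
    ∑ l, torusLaplace y l ^ 2 = ((n : ℝ) ^ d)⁻¹ *
      ∑ k, torusEigenvalue k ^ 2 * Complex.normSq (torusFourier y k) := by
  have hn' : ((n : ℝ) ^ d) ≠ 0 := pow_ne_zero _ (by exact_mod_cast (NeZero.ne n))
  rw [eq_inv_mul_iff_mul_eq₀ hn', ← sum_normSq_torusFourier]
  refine Finset.sum_congr rfl fun k _ => ?_
  rw [torusFourier_torusLaplace hd hn, Complex.normSq_mul, Complex.normSq_neg,
    Complex.normSq_ofReal]
  ring

lemma torusFourier_smoothingUpdate (l : Torus d n) (y : EuclideanSpace ℝ (Torus d n))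
    (k : Torus d n) : torusFourier (smoothingUpdate (torusWalk d n) l y) k =
      torusFourier y k + torusLaplace y l * torusChar k l := by
  have e : ∀ x, ((smoothingUpdate (torusWalk d n) l y x : ℝ) : ℂ) * torusChar k x =
      (y x : ℂ) * torusChar k x + if x = l then (torusLaplace y l : ℂ) * torusChar k l else 0 := by
    intro x
    by_cases h : x = l
    · subst h
      simp [smoothingUpdate, torusLaplace]
      ring
    · simp [smoothingUpdate, h]
  simp only [torusFourier]
  rw [Finset.sum_congr rfl fun x _ => e x, Finset.sum_add_distrib]
  simp

/-- The drift of the squared Fourier coefficients under the smoothing process. -/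
lemma sum_normSq_torusFourier_smoothingUpdate (hd : 1 ≤ d) (hn : 3 ≤ n)
    (y : EuclideanSpace ℝ (Torus d n)) (k : Torus d n) :
    ∑ l, Complex.normSq (torusFourier (smoothingUpdate (torusWalk d n) l y) k) =
      ((n : ℝ) ^ d - 2 * torusEigenvalue k) * Complex.normSq (torusFourier y k) +
        ((n : ℝ) ^ d)⁻¹ *
          ∑ j, torusEigenvalue j ^ 2 * Complex.normSq (torusFourier y j) := by
  have e : ∀ l, Complex.normSq (torusFourier (smoothingUpdate (torusWalk d n) l y) k) =
      Complex.normSq (torusFourier y k) + torusLaplace y l ^ 2 +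
        2 * (torusFourier y k * (starRingEnd ℂ) (torusLaplace y l * torusChar k l)).re := by
    intro l
    rw [torusFourier_smoothingUpdate, Complex.normSq_add, Complex.normSq_mul, normSq_torusChar,
      Complex.normSq_ofReal]
    ring
  have h2 : ∑ l, (torusFourier y k * (starRingEnd ℂ) (torusLaplace y l * torusChar k l)).re =
      -torusEigenvalue k * Complex.normSq (torusFourier y k) := by
    rw [← Complex.re_sum, ← Finset.mul_sum, ← map_sum]
    have := torusFourier_torusLaplace hd hn y k
    rw [torusFourier] at this
    rw [this, map_mul, map_neg, Complex.conj_ofReal, mul_left_comm, Complex.mul_conj]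
    rw [← Complex.ofReal_neg, ← Complex.ofReal_mul, Complex.ofReal_re]
  rw [Finset.sum_congr rfl fun l _ => e l, Finset.sum_add_distrib, Finset.sum_add_distrib,
    ← Finset.mul_sum, h2, sum_torusLaplace_sq hd hn]
  simp [ZMod.card]
  ring

lemma torusEnergy_eq (hd : 1 ≤ d) (hn : 3 ≤ n) (y : EuclideanSpace ℝ (Torus d n)) :
    torusEnergy y = ((n : ℝ) ^ d)⁻¹ * (((n : ℝ) ^ d)⁻¹ *
      ∑ k, torusEigenvalue k * Complex.normSq (torusFourier y k)) := by
  have hn' : ((n : ℝ) ^ d) ≠ 0 := pow_ne_zero _ (by exact_mod_cast (NeZero.ne n))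
  have hd' : (d : ℝ) ≠ 0 := by exact_mod_cast (by omega : d ≠ 0)
  have h1 : ((n : ℝ) ^ d)⁻¹ * ∑ k, torusEigenvalue k * Complex.normSq (torusFourier y k) =
      - ∑ x, y x * torusLaplace y x := by
    rw [inv_mul_eq_iff_eq_mul₀ hn']
    have h := sum_torusFourier_mul_conj y (torusLaplace y)
    have h2 : ∀ k, torusFourier y k * (starRingEnd ℂ) (torusFourier (torusLaplace y) k) =
        ((-(torusEigenvalue k * Complex.normSq (torusFourier y k)) : ℝ) : ℂ) := by
      intro k
      rw [torusFourier_torusLaplace hd hn, map_mul, map_neg, Complex.conj_ofReal, mul_left_comm,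
        Complex.mul_conj]
      push_cast; ring
    simp only [h2] at h
    have h3 : ∑ k, -(torusEigenvalue k * Complex.normSq (torusFourier y k)) =
        (n : ℝ) ^ d * ∑ x, y x * torusLaplace y x := by exact_mod_cast h
    rw [Finset.sum_neg_distrib] at h3
    linarith
  classical
  have h4 : ∀ i j, (if torusAdj i j then (y i - y j) ^ 2 else 0) = 2 * d *
      (torusWalk d n i j * y i ^ 2 - 2 * (y i * (torusWalk d n i j * y j)) +
        torusWalk d n j i * y j ^ 2) := by
    intro i j
    rw [torusWalk_comm j i]
    unfold torusWalk
    split_ifs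
    · field_simp; ring
    · simp
  rw [h1, torusEnergy]
  simp only [h4, ← Finset.mul_sum, Finset.sum_add_distrib, Finset.sum_sub_distrib]
  rw [Finset.sum_comm (f := fun i j => torusWalk d n j i * y j ^ 2)]
  simp only [← Finset.sum_mul, sum_torusWalk hd hn, torusLaplace, mul_sub, Finset.sum_sub_distrib]
  have : ∀ x, y x * y x = y x ^ 2 := fun x => (sq _).symm
  simp only [this]
  field_simp
  ring

lemma torusFourier_zero (y : Torus d n → ℝ) : torusFourier y 0 = ((∑ x, y x : ℝ) : ℂ) := by
  simp [torusFourier, torusChar_zero_left]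

lemma torusVariance_eq (y : EuclideanSpace ℝ (Torus d n)) :
    torusVariance y = ((n : ℝ) ^ d)⁻¹ * (((n : ℝ) ^ d)⁻¹ *
      ∑ k ∈ Finset.univ.erase 0, Complex.normSq (torusFourier y k)) := by
  have hn' : ((n : ℝ) ^ d) ≠ 0 := pow_ne_zero _ (by exact_mod_cast (NeZero.ne n))
  have h := sum_normSq_torusFourier (y : Torus d n → ℝ)
  rw [← Finset.add_sum_erase _ _ (Finset.mem_univ 0), torusFourier_zero, Complex.normSq_ofReal] at h
  rw [torusVariance]
  congr 1
  rw [eq_inv_mul_iff_mul_eq₀ hn', eq_sub_of_add_eq' h]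
  simp only [sub_sq, Finset.sum_add_distrib, Finset.sum_sub_distrib, mul_assoc, ← Finset.mul_sum,
    ← Finset.sum_mul]
  simp [torusMean, ZMod.card]
  field_simp
  ring

lemma torusEigenvalue_zero (hd : 1 ≤ d) : torusEigenvalue (0 : Torus d n) = 0 := by
  have hd' : (d : ℝ) ≠ 0 := by exact_mod_cast (by omega : d ≠ 0)
  simp [torusEigenvalue, hd']

lemma sum_torusEigenvalue (hn : 3 ≤ n) : ∑ k : Torus d n, torusEigenvalue k = (n : ℝ) ^ d := by
  have h : ∀ i : Fin d, ∑ k : Torus d n, (ZMod.stdAddChar (k i) : ℂ).re = 0 := by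
    intro i
    have h1 := sum_torusChar (Pi.single i 1 : Torus d n)
    rw [if_neg (by simpa [Pi.single_eq_zero_iff] using one_ne_zero_zmod hn)] at h1
    simp only [torusChar_single, mul_one] at h1
    rw [← Complex.re_sum, h1, Complex.zero_re]
  simp only [torusEigenvalue, Finset.sum_sub_distrib, ← Finset.mul_sum]
  rw [Finset.sum_comm]
  simp [h, ZMod.card]

end Fourier

/-! ### Spectral estimates for the simple random walk on the torus -/

section Spectrum

variable {d n : ℕ} [NeZero n]

/-- The eigenvalue `1 - cos (2π a / n)` of the simple random walk on the cycle. -/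
noncomputable def cosGap (a : ZMod n) : ℝ := 1 - (ZMod.stdAddChar a : ℂ).re

lemma cosGap_eq (a : ZMod n) : cosGap a = 1 - Real.cos (2 * Real.pi * a.valMinAbs / n) := by
  have h := ZMod.stdAddChar_coe (N := n) a.valMinAbs
  rw [ZMod.coe_valMinAbs] at h
  rw [cosGap, h]
  have : (2 * Real.pi * Complex.I * (a.valMinAbs : ℂ) / n : ℂ) =
      ((2 * Real.pi * a.valMinAbs / n : ℝ) : ℂ) * Complex.I := by push_cast; ring
  rw [this, Complex.exp_ofReal_mul_I_re]

lemma natCast_pos_of_neZero : (0 : ℝ) < n := by exact_mod_cast Nat.pos_of_ne_zero (NeZero.ne n)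

lemma abs_valMinAbs_le (a : ZMod n) : (|a.valMinAbs| : ℝ) ≤ n / 2 := by
  have h1 := ZMod.natAbs_valMinAbs_le a
  have h3 : ((a.valMinAbs.natAbs : ℕ) : ℝ) ≤ n / 2 :=
    (Nat.cast_le.2 h1).trans (by simpa using Nat.cast_div_le (α := ℝ) (m := n) (n := 2))
  have h4 : (a.valMinAbs.natAbs : ℝ) = |(a.valMinAbs : ℝ)| := by
    rw [Nat.cast_natAbs]; push_cast; rfl
  rwa [h4] at h3

lemma abs_angle_eq (a : ZMod n) : |2 * Real.pi * a.valMinAbs / n| =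
    2 * Real.pi * |(a.valMinAbs : ℝ)| / n := by
  have hn := natCast_pos_of_neZero (n := n)
  rw [abs_div, abs_mul, abs_of_pos hn, abs_of_pos Real.two_pi_pos]

lemma abs_angle_le (a : ZMod n) : |2 * Real.pi * a.valMinAbs / n| ≤ Real.pi := by
  have hn := natCast_pos_of_neZero (n := n)
  rw [abs_angle_eq, div_le_iff₀ hn]
  have := mul_le_mul_of_nonneg_left (abs_valMinAbs_le a) Real.two_pi_pos.le
  linarith

lemma le_cosGap (a : ZMod n) : 8 * (a.valMinAbs : ℝ) ^ 2 / n ^ 2 ≤ cosGap a := by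
  have hn := natCast_pos_of_neZero (n := n)
  have h := Real.cos_le_one_sub_mul_cos_sq (abs_angle_le a)
  rw [cosGap_eq]
  have h2 : 2 / Real.pi ^ 2 * (2 * Real.pi * a.valMinAbs / n) ^ 2 =
      8 * (a.valMinAbs : ℝ) ^ 2 / n ^ 2 := by
    have := Real.pi_pos.ne'
    field_simp
    ring
  linarith

lemma cosGap_le (a : ZMod n) : cosGap a ≤ 2 * Real.pi ^ 2 * (a.valMinAbs : ℝ) ^ 2 / n ^ 2 := by
  have h := Real.one_sub_sq_div_two_le_cos (x := 2 * Real.pi * a.valMinAbs / n)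
  rw [cosGap_eq]
  have h2 : (2 * Real.pi * a.valMinAbs / n) ^ 2 / 2 =
      2 * Real.pi ^ 2 * (a.valMinAbs : ℝ) ^ 2 / n ^ 2 := by ring
  linarith

lemma cosGap_nonneg (a : ZMod n) : 0 ≤ cosGap a :=
  le_trans (by positivity) (le_cosGap a)

lemma cosGap_zero : cosGap (0 : ZMod n) = 0 := by simp [cosGap]

omit [NeZero n] in
lemma valMinAbs_one (hn : 3 ≤ n) : (1 : ZMod n).valMinAbs = 1 := by
  have := ZMod.valMinAbs_natCast_of_le_half (n := n) (a := 1) (by omega)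
  simpa using this

omit [NeZero n] in
lemma valMinAbs_neg_one (hn : 3 ≤ n) : (-1 : ZMod n).valMinAbs = -1 := by
  rw [ZMod.valMinAbs_neg_of_ne_half, valMinAbs_one hn]
  rw [ZMod.val_one'' (by omega)]
  omega

lemma cosGap_one (hn : 3 ≤ n) : cosGap (1 : ZMod n) = cycleGap n := by
  rw [cosGap_eq, valMinAbs_one hn, cycleGap]; simp

lemma cosGap_neg_one (hn : 3 ≤ n) : cosGap (-1 : ZMod n) = cycleGap n := by
  rw [cosGap_eq, valMinAbs_neg_one hn, cycleGap, ← Real.cos_neg]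
  congr 2; push_cast; ring

lemma le_cycleGap (hn : 3 ≤ n) : 8 / (n : ℝ) ^ 2 ≤ cycleGap n := by
  have := le_cosGap (1 : ZMod n)
  rw [cosGap_one hn, valMinAbs_one hn] at this
  simpa using this

lemma cycleGap_le (hn : 3 ≤ n) : cycleGap n ≤ 20 / (n : ℝ) ^ 2 := by
  have h := cosGap_le (1 : ZMod n)
  rw [cosGap_one hn, valMinAbs_one hn] at h
  refine h.trans ?_
  have hpi : Real.pi ^ 2 ≤ 10 := by
    have := Real.pi_lt_d2
    have := Real.pi_pos
    nlinarith
  gcongr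
  push_cast
  linarith

lemma cycleGap_pos (hn : 3 ≤ n) : 0 < cycleGap n :=
  lt_of_lt_of_le (by have := natCast_pos_of_neZero (n := n); positivity) (le_cycleGap hn)

lemma one_sub_cos_le_cosGap {m : ℕ} {a : ZMod n} (hm : (m : ℝ) ≤ |(a.valMinAbs : ℝ)|) :
    1 - Real.cos (2 * Real.pi * m / n) ≤ cosGap a := by
  have hn := natCast_pos_of_neZero (n := n)
  rw [cosGap_eq, ← Real.cos_abs (2 * Real.pi * a.valMinAbs / n)]
  have := Real.cos_le_cos_of_nonneg_of_le_pi (x := 2 * Real.pi * m / n)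
    (y := |2 * Real.pi * a.valMinAbs / n|) (by positivity) (abs_angle_le a) (by
      rw [abs_angle_eq]
      gcongr)
  linarith

lemma cycleGap_le_cosGap {a : ZMod n} (ha : a ≠ 0) : cycleGap n ≤ cosGap a := by
  have h1 : 1 ≤ a.valMinAbs.natAbs := by
    rw [Nat.one_le_iff_ne_zero, Ne, Int.natAbs_eq_zero, ZMod.valMinAbs_eq_zero]; exact ha
  have h2 : ((1 : ℕ) : ℝ) ≤ |(a.valMinAbs : ℝ)| := by
    rw [← Int.cast_abs, ← Nat.cast_natAbs]; exact_mod_cast h1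
  have := one_sub_cos_le_cosGap h2
  simpa [cycleGap] using this

/-- The second eigenvalue of the cycle is at least twice the first one. -/
lemma two_mul_cycleGap_le_cosGap (hn : 4 ≤ n) {a : ZMod n} (h0 : a ≠ 0) (h1 : a ≠ 1)
    (h2 : a ≠ -1) : 2 * cycleGap n ≤ cosGap a := by
  have h : 2 ≤ a.valMinAbs.natAbs := by
    by_contra hlt
    have : a.valMinAbs = 0 ∨ a.valMinAbs = 1 ∨ a.valMinAbs = -1 := by omega
    have hc := ZMod.coe_valMinAbs a
    rcases this with h | h | h <;> rw [h] at hc <;> simp_all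
  have h3 : ((2 : ℕ) : ℝ) ≤ |(a.valMinAbs : ℝ)| := by
    rw [← Int.cast_abs, ← Nat.cast_natAbs]; exact_mod_cast h
  have h4 := one_sub_cos_le_cosGap h3
  have hnpos := natCast_pos_of_neZero (n := n)
  have h5 : Real.cos (2 * Real.pi * (2 : ℕ) / n) = 2 * Real.cos (2 * Real.pi / n) ^ 2 - 1 := by
    rw [← Real.cos_two_mul]; congr 1; push_cast; ring
  have h6 : 0 ≤ Real.cos (2 * Real.pi / n) := by
    refine Real.cos_nonneg_of_mem_Icc ⟨?_, ?_⟩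
    · have : 0 ≤ 2 * Real.pi / n := by positivity
      linarith [Real.pi_pos]
    · rw [div_le_iff₀ hnpos]
      have : (4 : ℝ) ≤ n := by exact_mod_cast hn
      nlinarith [Real.pi_pos]
  rw [h5] at h4
  unfold cycleGap
  nlinarith [Real.cos_le_one (2 * Real.pi / n)]

lemma torusEigenvalue_eq (hd : 1 ≤ d) (k : Torus d n) :
    torusEigenvalue k = (d : ℝ)⁻¹ * ∑ i, cosGap (k i) := by
  have hd' : (d : ℝ) ≠ 0 := by exact_mod_cast (by omega : d ≠ 0)
  simp only [torusEigenvalue, cosGap, Finset.sum_sub_distrib]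
  simp
  field_simp

lemma torusEigenvalue_nonneg (hd : 1 ≤ d) (k : Torus d n) : 0 ≤ torusEigenvalue k := by
  rw [torusEigenvalue_eq hd]
  exact mul_nonneg (by positivity) (Finset.sum_nonneg fun i _ => cosGap_nonneg _)

lemma torusEigenvalue_le_two (hd : 1 ≤ d) (k : Torus d n) : torusEigenvalue k ≤ 2 := by
  have hd' : (0 : ℝ) < d := by exact_mod_cast hd
  rw [torusEigenvalue_eq hd, inv_mul_le_iff₀ hd']
  calc ∑ i, cosGap (k i) ≤ ∑ _i : Fin d, (2 : ℝ) := Finset.sum_le_sum fun i _ => by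
        rw [cosGap_eq]; linarith [Real.neg_one_le_cos (2 * Real.pi * (k i).valMinAbs / n)]
    _ = d * 2 := by simp

lemma cycleGap_div_le_torusEigenvalue (hd : 1 ≤ d) {k : Torus d n} (hk : k ≠ 0) :
    cycleGap n / d ≤ torusEigenvalue k := by
  obtain ⟨i, hi⟩ := Function.ne_iff.1 hk
  rw [torusEigenvalue_eq hd, div_eq_inv_mul]
  gcongr
  exact (cycleGap_le_cosGap hi).trans
    (Finset.single_le_sum (f := fun i => cosGap (k i)) (fun i _ => cosGap_nonneg _)
      (Finset.mem_univ i))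

/-- The frequencies `± eᵢ` of the torus. -/
def torusAxes (d n : ℕ) : Finset (Torus d n) :=
  Finset.univ.image fun p : Fin d × Bool => Pi.single p.1 (if p.2 then 1 else -1)

omit [NeZero n] in
lemma card_torusAxes_le : (torusAxes d n).card ≤ 2 * d := by
  refine Finset.card_image_le.trans ?_
  simp [mul_comm]

lemma torusEigenvalue_of_mem_torusAxes (hd : 1 ≤ d) (hn : 3 ≤ n) {k : Torus d n}
    (hk : k ∈ torusAxes d n) : torusEigenvalue k = cycleGap n / d := by
  simp only [torusAxes, Finset.mem_image, Finset.mem_univ, true_and] at hk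
  obtain ⟨⟨i, b⟩, rfl⟩ := hk
  rw [torusEigenvalue_eq hd, Finset.sum_eq_single i, div_eq_inv_mul]
  · cases b
    · simp [cosGap_neg_one hn]
    · simp [cosGap_one hn]
  · intro j _ hj; simp [hj, cosGap_zero]
  · simp

/-- Away from `0` and `± eᵢ` the eigenvalues are at least twice the spectral gap. -/
lemma two_mul_cycleGap_div_le_torusEigenvalue (hd : 1 ≤ d) (hn : 4 ≤ n) {k : Torus d n}
    (h0 : k ≠ 0) (hk : k ∉ torusAxes d n) : 2 * (cycleGap n / d) ≤ torusEigenvalue k := by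
  have hd' : (0 : ℝ) < d := by exact_mod_cast hd
  obtain ⟨i, hi⟩ := Function.ne_iff.1 h0
  have key : 2 * cycleGap n ≤ ∑ i, cosGap (k i) := by
    by_cases h : ∃ j, j ≠ i ∧ k j ≠ 0
    · obtain ⟨j, hji, hj⟩ := h
      have hs := Finset.sum_le_sum_of_subset_of_nonneg (f := fun i => cosGap (k i))
        (Finset.subset_univ {i, j}) (fun i _ _ => cosGap_nonneg _)
      rw [Finset.sum_pair hji.symm] at hs
      have := cycleGap_le_cosGap hi
      have := cycleGap_le_cosGap hj
      simp only [Pi.zero_apply] at *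
      linarith
    · push Not at h
      have hki : k = Pi.single i (k i) := by
        funext j
        by_cases hj : j = i
        · subst hj; simp
        · simp [hj, h j hj]
      refine le_trans (two_mul_cycleGap_le_cosGap hn hi ?_ ?_)
        (Finset.single_le_sum (f := fun i => cosGap (k i)) (fun i _ => cosGap_nonneg _)
          (Finset.mem_univ i))
      · intro h1
        refine hk (Finset.mem_image.2 ⟨(i, true), Finset.mem_univ _, ?_⟩)
        rw [hki, h1]; simp
      · intro h1
        refine hk (Finset.mem_image.2 ⟨(i, false), Finset.mem_univ _, ?_⟩)
        rw [hki, h1]; simp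
  rw [torusEigenvalue_eq hd, ← mul_div_assoc, div_eq_inv_mul]
  gcongr

/-- A Gaussian sum is compared with a telescoping one. -/
lemma sum_exp_neg_sq_le {b : ℝ} (hb : 0 < b) (M : ℕ) :
    ∑ j ∈ Finset.range M, Real.exp (-(b * j) ^ 2) ≤ 1 + 2 / b := by
  have h1 : ∀ j : ℕ, Real.exp (-(b * (j + 1 : ℕ)) ^ 2) ≤
      2 / b * (1 / (1 + b * j)) - 2 / b * (1 / (1 + b * (j + 1 : ℕ))) := by
    intro j
    have hj : 0 ≤ b * j := by positivity
    set s := b * j with hs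
    have hs' : b * ((j + 1 : ℕ) : ℝ) = s + b := by rw [hs]; push_cast; ring
    rw [hs']
    have h2 : Real.exp (-(s + b) ^ 2) ≤ 1 / (1 + (s + b) ^ 2) := by
      rw [Real.exp_neg, one_div]
      gcongr
      linarith [Real.add_one_le_exp ((s + b) ^ 2)]
    refine h2.trans ?_
    have h3 : 2 / b * (1 / (1 + s)) - 2 / b * (1 / (1 + (s + b))) =
        2 / ((1 + s) * (1 + (s + b))) := by
      field_simp
      ring
    rw [h3, div_le_div_iff₀ (by positivity) (by positivity)]
    nlinarith [sq_nonneg (s + b - 1)]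
  cases M with
  | zero => simp; positivity
  | succ M =>
    rw [Finset.sum_range_succ']
    have h2 := Finset.sum_le_sum (s := Finset.range M) fun j _ => h1 j
    rw [Finset.sum_range_sub' (fun j : ℕ => 2 / b * (1 / (1 + b * j)))] at h2
    have h3 : 0 ≤ 2 / b * (1 / (1 + b * (M : ℝ))) := by positivity
    simp at h2 h3 ⊢
    linarith

lemma sum_exp_neg_cosGap_le {τ : ℝ} (hτ : 0 < τ) :
    ∑ a : ZMod n, Real.exp (-(τ * cosGap a)) ≤ 2 * (1 + 2 * (n / √(8 * τ))) := by
  have hn := natCast_pos_of_neZero (n := n)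
  set b := √(8 * τ) / n with hb
  have hs : 0 < √(8 * τ) := by positivity
  have hb0 : 0 < b := by positivity
  have hb2 : b ^ 2 = 8 * τ / n ^ 2 := by rw [hb, div_pow, Real.sq_sqrt (by positivity)]
  have h1 : ∀ a : ZMod n, Real.exp (-(τ * cosGap a)) ≤
      Real.exp (-(b * a.val) ^ 2) + Real.exp (-(b * (n - a.val : ℕ)) ^ 2) := by
    intro a
    have h2 : Real.exp (-(τ * cosGap a)) ≤ Real.exp (-(b * a.valMinAbs.natAbs) ^ 2) := by
      rw [Real.exp_le_exp, neg_le_neg_iff, mul_pow, hb2]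
      have h3 : ((a.valMinAbs.natAbs : ℕ) : ℝ) ^ 2 = (a.valMinAbs : ℝ) ^ 2 := by
        rw [Nat.cast_natAbs]; push_cast; exact sq_abs _
      rw [h3]
      calc 8 * τ / n ^ 2 * (a.valMinAbs : ℝ) ^ 2 = τ * (8 * (a.valMinAbs : ℝ) ^ 2 / n ^ 2) := by ring
        _ ≤ _ := by gcongr; exact le_cosGap a
    refine h2.trans ?_
    rw [ZMod.valMinAbs_natAbs_eq_min]
    rcases min_choice a.val (n - a.val) with h | h <;> rw [h]
    · linarith [Real.exp_pos (-(b * (n - a.val : ℕ)) ^ 2)]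
    · linarith [Real.exp_pos (-(b * a.val) ^ 2)]
  have h2 : ∀ f : ℕ → ℝ, ∑ a : ZMod n, f a.val = ∑ j ∈ Finset.range n, f j := by
    intro f
    refine Finset.sum_nbij ZMod.val (fun a _ => Finset.mem_range.2 (ZMod.val_lt a))
      (ZMod.val_injective n).injOn ?_ fun a _ => rfl
    intro j hj
    exact ⟨(j : ZMod n), by simp, ZMod.val_cast_of_lt (by simpa using hj)⟩
  refine (Finset.sum_le_sum fun a _ => h1 a).trans ?_
  rw [Finset.sum_add_distrib, h2 fun j => Real.exp (-(b * j) ^ 2),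
    h2 fun j => Real.exp (-(b * (n - j : ℕ)) ^ 2)]
  have h3 := sum_exp_neg_sq_le hb0 n
  have h4 : ∑ j ∈ Finset.range n, Real.exp (-(b * (n - j : ℕ)) ^ 2) ≤ 1 + 2 / b := by
    have h5 := sum_exp_neg_sq_le hb0 (n + 1)
    rw [Finset.sum_range_succ'] at h5
    have h6 : ∑ j ∈ Finset.range n, Real.exp (-(b * (n - j : ℕ)) ^ 2) =
        ∑ j ∈ Finset.range n, Real.exp (-(b * (j + 1 : ℕ)) ^ 2) := by
      rw [← Finset.sum_range_reflect]
      refine Finset.sum_congr rfl fun j hj => ?_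
      have := Finset.mem_range.1 hj
      congr 5
      omega
    rw [h6]
    exact (le_add_of_nonneg_right (Real.exp_pos _).le).trans h5
  have h5 : 2 / b = 2 * (n / √(8 * τ)) := by rw [hb]; field_simp
  rw [h5] at h3 h4
  linarith

lemma average_exp_neg_cosGap_le {τ : ℝ} (hτ : 0 ≤ τ) :
    (n : ℝ)⁻¹ * ∑ a : ZMod n, Real.exp (-(τ * cosGap a)) ≤ 2 * ((n : ℝ)⁻¹ + (√(1 + τ))⁻¹) := by
  have hn := natCast_pos_of_neZero (n := n)
  rcases le_or_gt 1 τ with h | h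
  · have h1 := sum_exp_neg_cosGap_le (n := n) (τ := τ) (by linarith)
    have h2 : 2 * √(1 + τ) ≤ √(8 * τ) := by
      refine Real.le_sqrt_of_sq_le ?_
      rw [mul_pow, Real.sq_sqrt (by linarith)]
      linarith
    have hpos : 0 < √(1 + τ) := Real.sqrt_pos.2 (by linarith)
    have h8 : 0 < √(8 * τ) := by linarith
    calc (n : ℝ)⁻¹ * ∑ a : ZMod n, Real.exp (-(τ * cosGap a))
        ≤ (n : ℝ)⁻¹ * (2 * (1 + 2 * (n / √(8 * τ)))) := by gcongr
      _ = 2 * (n : ℝ)⁻¹ + 4 * (√(8 * τ))⁻¹ := by field_simp; ring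
      _ ≤ 2 * (n : ℝ)⁻¹ + 4 * (2 * √(1 + τ))⁻¹ := by gcongr
      _ = _ := by rw [mul_inv]; ring
  · have h1 : ∑ a : ZMod n, Real.exp (-(τ * cosGap a)) ≤ n := by
      calc _ ≤ ∑ _a : ZMod n, (1 : ℝ) := Finset.sum_le_sum fun a _ => by
            rw [Real.exp_le_one_iff]
            have := mul_nonneg hτ (cosGap_nonneg a)
            linarith
        _ = n := by simp [ZMod.card]
    have h2 : √(1 + τ) ≤ 2 := by
      rw [Real.sqrt_le_left (by norm_num)]; linarith
    have hpos : 0 < √(1 + τ) := Real.sqrt_pos.2 (by linarith)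
    have h3 : 2⁻¹ ≤ (√(1 + τ))⁻¹ := by gcongr
    calc (n : ℝ)⁻¹ * ∑ a : ZMod n, Real.exp (-(τ * cosGap a)) ≤ (n : ℝ)⁻¹ * n := by gcongr
      _ = 1 := by field_simp
      _ ≤ _ := by
        have : 0 ≤ (n : ℝ)⁻¹ := by positivity
        linarith

lemma sum_exp_neg_torusEigenvalue (hd : 1 ≤ d) (t : ℝ) :
    ∑ k : Torus d n, Real.exp (-(t * torusEigenvalue k)) =
      (∑ a : ZMod n, Real.exp (-(t / d * cosGap a))) ^ d := by
  have h : ∀ k : Torus d n, Real.exp (-(t * torusEigenvalue k)) =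
      ∏ i, Real.exp (-(t / d * cosGap (k i))) := by
    intro k
    rw [torusEigenvalue_eq hd, ← Real.exp_sum, Finset.sum_neg_distrib, ← Finset.mul_sum]
    congr 1; ring
  simp only [h]
  rw [← Fintype.piFinset_univ, ← Finset.prod_univ_sum (t := fun _ => Finset.univ)
    (f := fun _ (a : ZMod n) => Real.exp (-(t / d * cosGap a)))]
  simp

/-- The on-diagonal heat kernel bound for the simple random walk on the torus. -/
lemma average_exp_neg_torusEigenvalue_le (hd : 1 ≤ d) {t : ℝ} (ht : 0 ≤ t) :
    ((n : ℝ) ^ d)⁻¹ * ∑ k : Torus d n, Real.exp (-(t * torusEigenvalue k)) ≤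
      (4 * d) ^ d * (((n : ℝ) ^ d)⁻¹ + (1 + t) ^ (-((d : ℝ) / 2))) := by
  have hn := natCast_pos_of_neZero (n := n)
  have hd' : (1 : ℝ) ≤ d := by exact_mod_cast hd
  have h1 := average_exp_neg_cosGap_le (n := n) (τ := t / d) (by positivity)
  have h2 : (√(1 + t / d))⁻¹ ≤ d * (√(1 + t))⁻¹ := by
    have h3 : √(1 + t) ≤ d * √(1 + t / d) := by
      rw [← Real.sqrt_sq (by linarith : (0 : ℝ) ≤ d), ← Real.sqrt_mul (by positivity)]
      refine Real.sqrt_le_sqrt ?_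
      rw [Real.sqrt_sq (by linarith)]
      have : (d : ℝ) ^ 2 * (1 + t / d) = d ^ 2 + d * t := by field_simp
      rw [this]
      nlinarith
    have p1 : 0 < √(1 + t) := Real.sqrt_pos.2 (by linarith)
    have p2 : 0 < √(1 + t / d) := Real.sqrt_pos.2 (by positivity)
    rw [inv_le_iff_one_le_mul₀ p2, mul_assoc, mul_comm, mul_assoc, inv_mul_eq_div, le_div_iff₀ p1,
      one_mul]
    linarith
  set A := (n : ℝ)⁻¹ with hA
  set B := (√(1 + t))⁻¹ with hB
  have hA0 : 0 ≤ A := by positivity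
  have hB0 : 0 ≤ B := by positivity
  have h3 : (n : ℝ)⁻¹ * ∑ a : ZMod n, Real.exp (-(t / d * cosGap a)) ≤ 4 * d * max A B := by
    have := le_max_left A B
    have := le_max_right A B
    have hm : 0 ≤ max A B := hA0.trans (le_max_left A B)
    have : A ≤ d * max A B := by nlinarith [le_max_left A B]
    have : d * B ≤ d * max A B := mul_le_mul_of_nonneg_left (le_max_right A B) (by linarith)
    linarith
  have hBd : B ^ d = (1 + t) ^ (-((d : ℝ) / 2)) := by
    rw [hB, inv_pow, Real.rpow_neg (by linarith), Real.sqrt_eq_rpow, ← Real.rpow_natCast,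
      ← Real.rpow_mul (by linarith)]
    congr 2
    ring
  rw [sum_exp_neg_torusEigenvalue hd, ← inv_pow, ← mul_pow]
  calc _ ≤ (4 * d * max A B) ^ d := by
        refine pow_le_pow_left₀ (mul_nonneg hA0 (Finset.sum_nonneg fun a _ => ?_)) h3 d
        exact (Real.exp_pos _).le
    _ = (4 * d) ^ d * (max A B) ^ d := mul_pow _ _ _
    _ ≤ (4 * d) ^ d * (A ^ d + B ^ d) := by
        gcongr
        rcases max_choice A B with h | h <;> rw [h]
        · linarith [pow_nonneg hB0 d]
        · linarith [pow_nonneg hA0 d]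
    _ = _ := by rw [hBd]

end Spectrum

/-! ### Decay of solutions of a renewal equation -/

section Renewal

/-- The decay profile `(1 + t) ^ (-a) + M`, comparable to the inverse of `min ((1 + t) ^ a) M⁻¹`. -/
noncomputable def decayProfile (a M t : ℝ) : ℝ := (1 + t) ^ (-a) + M

lemma decayProfile_nonneg {a M t : ℝ} (hM : 0 ≤ M) (ht : 0 ≤ t) : 0 ≤ decayProfile a M t :=
  add_nonneg (Real.rpow_nonneg (by linarith) _) hM

lemma decayProfile_pos {a M t : ℝ} (hM : 0 ≤ M) (ht : 0 ≤ t) : 0 < decayProfile a M t :=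
  add_pos_of_pos_of_nonneg (Real.rpow_pos_of_pos (by linarith) _) hM

lemma decayProfile_anti {a M s t : ℝ} (ha : 0 ≤ a) (hs : 0 ≤ s) (hst : s ≤ t) :
    decayProfile a M t ≤ decayProfile a M s := by
  unfold decayProfile
  gcongr ?_ + M
  exact Real.rpow_le_rpow_of_nonpos (by linarith) (by linarith) (by linarith)

lemma decayProfile_mul_le {a M δ t : ℝ} (ha : 0 ≤ a) (hM : 0 ≤ M) (h0 : 0 < δ) (h1 : δ ≤ 1)
    (ht : 0 ≤ t) : decayProfile a M (δ * t) ≤ δ ^ (-a) * decayProfile a M t := by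
  unfold decayProfile
  rw [mul_add, ← Real.mul_rpow h0.le (by linarith)]
  refine add_le_add ?_ ?_
  · exact Real.rpow_le_rpow_of_nonpos (by positivity) (by nlinarith) (by linarith)
  · exact le_mul_of_one_le_left hM (Real.one_le_rpow_of_pos_of_le_one_of_nonpos h0 h1 (by linarith))

lemma continuousOn_decayProfile (a M : ℝ) : ContinuousOn (decayProfile a M) (Set.Ici 0) := by
  unfold decayProfile
  refine ContinuousOn.add (ContinuousOn.rpow_const (by fun_prop) ?_) continuousOn_const
  intro t ht
  left
  have : (0 : ℝ) ≤ t := ht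
  positivity

/-- A solution of a renewal equation with a kernel of mass less than one decays like the kernel, if
the latter has a regularly varying bound: in the convolution either the kernel or the solution is
evaluated at a time comparable to `t`. -/
lemma renewal_le {a M C : ℝ} (ha : 1 ≤ a) (hM : 0 ≤ M) (hC : 0 ≤ C) {K G : ℝ → ℝ}
    (hK : Continuous K) (hG : Continuous G) (hK0 : ∀ t, 0 ≤ t → 0 ≤ K t)
    (hG0 : ∀ t, 0 ≤ t → 0 ≤ G t) (hKC : ∀ t, 0 ≤ t → K t ≤ C * decayProfile a M t)
    (hKi : ∀ t, 0 ≤ t → ∫ s in (0)..t, K s ≤ 3 / 4) (hGi : ∀ t, 0 ≤ t → ∫ s in (0)..t, G s ≤ 3)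
    (hGK : ∀ t, 0 ≤ t → G t = K t + ∫ s in (0)..t, K (t - s) * G s) (t : ℝ) (ht : 0 ≤ t) :
    G t ≤ 8 * (C + 3 * C * (1 / (7 * a)) ^ (-a)) * decayProfile a M t := by
  set δ : ℝ := 1 / (7 * a) with hδ
  have ha0 : 0 < a := by linarith
  have hδ0 : 0 < δ := by positivity
  have hδ1 : δ ≤ 1 / 7 := by
    rw [hδ]; exact one_div_le_one_div_of_le (by norm_num) (by linarith)
  have hδa : (1 - δ) ^ (-a) ≤ 7 / 6 := by
    have h1 := one_add_mul_self_le_rpow_one_add (s := -δ) (by linarith) ha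
    have h2 : a * -δ = -(1 / 7) := by rw [hδ]; field_simp
    rw [h2, ← sub_eq_add_neg 1 δ] at h1
    rw [Real.rpow_neg (by linarith)]
    refine inv_le_of_inv_le₀ (by norm_num) ?_
    linarith
  obtain ⟨τ, hτ, hmax⟩ := isCompact_Icc.exists_isMaxOn (Set.nonempty_Icc.2 ht)
    (hG.continuousOn.div ((continuousOn_decayProfile a M).mono Set.Icc_subset_Ici_self)
      fun s hs => (decayProfile_pos hM hs.1).ne')
  set w := decayProfile a M
  set m := G τ / w τ with hm
  have hτ0 := hτ.1
  have hw : ∀ s, 0 ≤ s → 0 < w s := fun s hs => decayProfile_pos hM hs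
  have hm0 : 0 ≤ m := div_nonneg (hG0 _ hτ0) (hw _ hτ0).le
  have hGm : ∀ s, 0 ≤ s → s ≤ t → G s ≤ m * w s := fun s h0 h1 => by
    have := hmax (Set.mem_Icc.2 ⟨h0, h1⟩)
    exact (div_le_iff₀ (hw s h0)).1 this
  have hGτ : G τ = m * w τ := by rw [hm, div_mul_cancel₀ _ (hw _ hτ0).ne']
  have hint : ∀ x y, IntervalIntegrable (fun s => K (τ - s) * G s) volume x y := fun x y =>
    Continuous.intervalIntegrable (by fun_prop) _ _
  set r := (1 - δ) * τ
  have hr0 : 0 ≤ r := mul_nonneg (by linarith) hτ0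
  have hrτ : r ≤ τ := by nlinarith
  have hsplit := intervalIntegral.integral_add_adjacent_intervals (hint 0 r) (hint r τ)
  have b1 : ∫ s in (0)..r, K (τ - s) * G s ≤ 3 * C * δ ^ (-a) * w τ := by
    calc ∫ s in (0)..r, K (τ - s) * G s ≤ ∫ s in (0)..r, C * (δ ^ (-a) * w τ) * G s := by
          refine intervalIntegral.integral_mono_on hr0 (hint 0 r)
            (Continuous.intervalIntegrable (by fun_prop) _ _) fun s hs => ?_
          refine mul_le_mul_of_nonneg_right ?_ (hG0 s hs.1)
          have h1 : δ * τ ≤ τ - s := by have := hs.2; simp only [r] at this; linarith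
          refine (hKC _ ((mul_nonneg hδ0.le hτ0).trans h1)).trans ?_
          refine mul_le_mul_of_nonneg_left ?_ hC
          exact (decayProfile_anti ha0.le (mul_nonneg hδ0.le hτ0) h1).trans
            (decayProfile_mul_le ha0.le hM hδ0 (by linarith) hτ0)
      _ = C * (δ ^ (-a) * w τ) * ∫ s in (0)..r, G s := intervalIntegral.integral_const_mul _ _
      _ ≤ C * (δ ^ (-a) * w τ) * 3 := by
          refine mul_le_mul_of_nonneg_left (hGi r hr0) ?_
          have := hw τ hτ0
          positivity
      _ = _ := by ring
  have b2 : ∫ s in r..τ, K (τ - s) * G s ≤ 7 / 8 * m * w τ := by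
    have hKint : ∀ x y, IntervalIntegrable (fun s => K (τ - s)) volume x y := fun x y =>
      Continuous.intervalIntegrable (by fun_prop) _ _
    calc ∫ s in r..τ, K (τ - s) * G s ≤ ∫ s in r..τ, K (τ - s) * (m * (7 / 6 * w τ)) := by
          refine intervalIntegral.integral_mono_on hrτ (hint r τ)
            ((hKint r τ).mul_const _) fun s hs => ?_
          have hs0 : 0 ≤ s := hr0.trans hs.1
          refine mul_le_mul_of_nonneg_left ?_ (hK0 _ (by linarith [hs.2]))
          refine (hGm s hs0 (hs.2.trans hτ.2)).trans (mul_le_mul_of_nonneg_left ?_ hm0)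
          refine (decayProfile_anti ha0.le hr0 hs.1).trans
            ((decayProfile_mul_le ha0.le hM (by linarith) (by linarith) hτ0).trans ?_)
          exact mul_le_mul_of_nonneg_right hδa (hw τ hτ0).le
      _ = (∫ s in r..τ, K (τ - s)) * (m * (7 / 6 * w τ)) := intervalIntegral.integral_mul_const _ _
      _ ≤ 3 / 4 * (m * (7 / 6 * w τ)) := by
          refine mul_le_mul_of_nonneg_right ?_
            (mul_nonneg hm0 (mul_nonneg (by norm_num) (hw τ hτ0).le))
          rw [intervalIntegral.integral_comp_sub_left (fun s => K s), sub_self]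
          exact hKi _ (by linarith)
      _ = _ := by ring
  have h3 := hGK τ hτ0
  rw [← hsplit, hGτ] at h3
  have h4 := hKC τ hτ0
  have h5 : m * w τ ≤ (C + 3 * C * δ ^ (-a) + 7 / 8 * m) * w τ := by
    simp only [w] at *
    linarith
  have h6 := le_of_mul_le_mul_right h5 (hw τ hτ0)
  refine (hGm t ht le_rfl).trans (mul_le_mul_of_nonneg_right ?_ (hw t ht).le)
  linarith

/-- Two functions are compared by means of their derivatives, backwards from infinity, where the
integrable function `F` is small. -/
lemma le_of_deriv_le_of_integral_le {F F' Ψ Ψ' : ℝ → ℝ} {B : ℝ} (hF : ∀ t, HasDerivAt F (F' t) t)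
    (hΨ : ∀ t, 0 ≤ t → HasDerivAt Ψ (Ψ' t) t) (h : ∀ t, 0 ≤ t → Ψ' t ≤ F' t)
    (hF0 : ∀ t, 0 ≤ t → 0 ≤ F t) (hΨ0 : ∀ t, 0 ≤ t → 0 ≤ Ψ t)
    (hB : ∀ t, 0 ≤ t → ∫ s in (0)..t, F s ≤ B) (t : ℝ) (ht : 0 ≤ t) : F t ≤ Ψ t := by
  by_contra! hlt
  have hmono : MonotoneOn (F - Ψ) (Set.Ici 0) := by
    have hd : ∀ t, 0 ≤ t → HasDerivAt (F - Ψ) (F' t - Ψ' t) t := fun t ht => (hF t).sub (hΨ t ht)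
    refine monotoneOn_of_deriv_nonneg (convex_Ici 0)
      (fun t ht => (hd t ht).continuousAt.continuousWithinAt) ?_ ?_
    · intro t ht
      rw [interior_Ici] at ht
      exact (hd t (le_of_lt ht)).differentiableAt.differentiableWithinAt
    · intro t ht
      rw [interior_Ici] at ht
      rw [(hd t (le_of_lt ht)).deriv]
      linarith [h t (le_of_lt ht)]
  set η := F t - Ψ t
  have hη : 0 < η := sub_pos.2 hlt
  have hle : ∀ s, t ≤ s → η ≤ F s := by
    intro s hs
    have h1 := hmono (Set.mem_Ici.2 ht) (Set.mem_Ici.2 (ht.trans hs)) hs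
    have h2 := hΨ0 s (ht.trans hs)
    simp only [Pi.sub_apply] at h1
    linarith
  have hc : Continuous F := continuous_iff_continuousAt.2 fun t => (hF t).continuousAt
  have hi : ∀ x y, IntervalIntegrable F volume x y := fun x y => hc.intervalIntegrable _ _
  set s := t + (|B| + 1) / η
  have hts : t ≤ s := le_add_of_nonneg_right (by positivity)
  have h1 : ∫ _ in t..s, η ≤ ∫ x in t..s, F x :=
    intervalIntegral.integral_mono_on hts (by simp) (hi _ _) fun x hx => hle x hx.1
  have h2 : 0 ≤ ∫ x in (0)..t, F x :=
    intervalIntegral.integral_nonneg ht fun x hx => hF0 x hx.1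
  have h3 := intervalIntegral.integral_add_adjacent_intervals (hi 0 t) (hi t s)
  have h4 := hB s (ht.trans hts)
  rw [intervalIntegral.integral_const] at h1
  have h5 : (s - t) • η = |B| + 1 := by
    simp only [s, smul_eq_mul, add_sub_cancel_left]; field_simp
  rw [h5] at h1
  linarith [le_abs_self B]

/-- An integrable function whose derivative is bounded by a decay profile of exponent `a + 1` times
an exponential is bounded by a decay profile of exponent `a` times the same exponential. -/
lemma le_decayProfile_of_deriv {F φ : ℝ → ℝ} {a M M' θ c C B : ℝ} (hM : 0 ≤ M)
    (hθ : 0 ≤ θ) (hc : 0 < c) (hca : c ≤ a) (hcM : c * M' ≤ θ * M) (hC : 0 ≤ C)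
    (hF : ∀ t, HasDerivAt F (-φ t) t)
    (hφ : ∀ t, 0 ≤ t → φ t ≤ C * decayProfile (a + 1) M' t * Real.exp (-θ * t))
    (hF0 : ∀ t, 0 ≤ t → 0 ≤ F t) (hB : ∀ t, 0 ≤ t → ∫ s in (0)..t, F s ≤ B) (t : ℝ)
    (ht : 0 ≤ t) : F t ≤ C / c * decayProfile a M t * Real.exp (-θ * t) := by
  refine le_of_deriv_le_of_integral_le (F := F) (F' := fun t => -φ t)
    (Ψ := fun t => C / c * decayProfile a M t * Real.exp (-θ * t))
    (Ψ' := fun t => C / c * (1 * (-a) * (1 + t) ^ (-a - 1)) * Real.exp (-θ * t) +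
      C / c * decayProfile a M t * (Real.exp (-θ * t) * (-θ * 1))) hF ?_ ?_ hF0 ?_ hB t ht
  · intro t ht
    have h1 : HasDerivAt (decayProfile a M) (1 * (-a) * (1 + t) ^ (-a - 1)) t := by
      have := (((hasDerivAt_id t).const_add 1).rpow_const (p := -a)
        (Or.inl (by simp only [id]; positivity))).add_const M
      exact this
    exact (h1.const_mul _).mul (((hasDerivAt_id t).const_mul (-θ)).exp)
  · intro t ht
    have hE := Real.exp_pos (-θ * t)
    have h1 := hφ t ht
    have hp1 : 0 ≤ (1 + t) ^ (-a - 1) := Real.rpow_nonneg (by linarith) _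
    have hp2 : 0 ≤ (1 + t) ^ (-a) := Real.rpow_nonneg (by linarith) _
    have h2 : c * decayProfile (a + 1) M' t ≤ a * (1 + t) ^ (-a - 1) + θ * decayProfile a M t := by
      unfold decayProfile
      rw [show -(a + 1) = -a - 1 by ring, mul_add, mul_add]
      have := mul_le_mul_of_nonneg_right hca hp1
      have := mul_nonneg hθ hp2
      linarith
    have h3 : C * decayProfile (a + 1) M' t ≤
        C / c * (a * (1 + t) ^ (-a - 1) + θ * decayProfile a M t) := by
      calc C * decayProfile (a + 1) M' t = C / c * (c * decayProfile (a + 1) M' t) := by field_simp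
        _ ≤ _ := mul_le_mul_of_nonneg_left h2 (by positivity)
    have h4 := mul_le_mul_of_nonneg_right h3 hE.le
    have : C / c * (1 * (-a) * (1 + t) ^ (-a - 1)) * Real.exp (-θ * t) +
      C / c * decayProfile a M t * (Real.exp (-θ * t) * (-θ * 1)) =
      -(C / c * (a * (1 + t) ^ (-a - 1) + θ * decayProfile a M t) * Real.exp (-θ * t)) := by ring
    rw [this]
    linarith
  · intro t ht
    have := decayProfile_nonneg (a := a) hM ht
    positivity

end Renewal

/-! ### The second moments of the Fourier coefficients -/

section SpectralSystem

variable {κ : Type*} [Fintype κ]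

/-- The system of differential equations solved by the second moments `h t k` of the Fourier
coefficients of the smoothing process started from a unit mass; `lam k` are the eigenvalues, and
`N` is the number of sites. -/
structure IsSpectralSystem (lam : κ → ℝ) (N : ℝ) (h : ℝ → κ → ℝ) : Prop where
  init : ∀ k, h 0 k = 1
  deriv : ∀ t k, HasDerivAt (fun t => h t k)
    (-(2 * lam k) * h t k + N⁻¹ * ∑ j, lam j ^ 2 * h t j) t
  nonneg : ∀ t, 0 ≤ t → ∀ k, 0 ≤ h t k

namespace IsSpectralSystem

variable {lam : κ → ℝ} {N : ℝ} {h : ℝ → κ → ℝ} (H : IsSpectralSystem lam N h)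
include H

lemma continuous (k : κ) : Continuous fun t => h t k :=
  continuous_iff_continuousAt.2 fun t => (H.deriv t k).continuousAt

lemma continuous_forcing : Continuous fun t => N⁻¹ * ∑ j, lam j ^ 2 * h t j := by
  have := H.continuous
  fun_prop

lemma forcing_nonneg (hN : 0 < N) {t : ℝ} (ht : 0 ≤ t) : 0 ≤ N⁻¹ * ∑ j, lam j ^ 2 * h t j := by
  have := H.nonneg t ht
  have : 0 ≤ ∑ j, lam j ^ 2 * h t j :=
    Finset.sum_nonneg fun j _ => mul_nonneg (sq_nonneg _) (this j)
  positivity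

/-- Variation of constants. -/
lemma eq_exp_add_integral (k : κ) (t : ℝ) : h t k = Real.exp (-(2 * lam k) * t) +
    ∫ s in (0)..t, Real.exp (-(2 * lam k) * (t - s)) * (N⁻¹ * ∑ j, lam j ^ 2 * h s j) := by
  have h1 : ∀ s, HasDerivAt (fun s => Real.exp (-(2 * lam k) * (t - s)) * h s k)
      (Real.exp (-(2 * lam k) * (t - s)) * (N⁻¹ * ∑ j, lam j ^ 2 * h s j)) s := by
    intro s
    have h2 : HasDerivAt (fun s => Real.exp (-(2 * lam k) * (t - s)))
        (Real.exp (-(2 * lam k) * (t - s)) * (-(2 * lam k) * -1)) s :=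
      (((hasDerivAt_id s).const_sub t).const_mul _).exp
    refine (h2.mul (H.deriv s k)).congr_deriv ?_
    ring
  have hc := H.continuous_forcing
  have h3 := intervalIntegral.integral_eq_sub_of_hasDerivAt (a := 0) (b := t) (fun s _ => h1 s)
    (Continuous.intervalIntegrable (by fun_prop) _ _)
  rw [h3, H.init]
  simp

lemma exp_le (hN : 0 < N) (k : κ) {t : ℝ} (ht : 0 ≤ t) : Real.exp (-(2 * lam k) * t) ≤ h t k := by
  rw [H.eq_exp_add_integral k t]
  refine le_add_of_nonneg_right (intervalIntegral.integral_nonneg ht fun s hs => ?_)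
  exact mul_nonneg (Real.exp_pos _).le (H.forcing_nonneg hN hs.1)

lemma integral_exp_mul_le {θ t : ℝ} (ht : 0 ≤ t) {k : κ} (hk : θ < 2 * lam k) :
    ∫ s in (0)..t, Real.exp (θ * s) * h s k ≤
      (1 + ∫ s in (0)..t, Real.exp (θ * s) * (N⁻¹ * ∑ j, lam j ^ 2 * h s j)) /
        (2 * lam k - θ) := by
  have h1 : ∀ s, HasDerivAt (fun s => Real.exp (θ * s) * h s k)
      (-(2 * lam k - θ) * (Real.exp (θ * s) * h s k) +
        Real.exp (θ * s) * (N⁻¹ * ∑ j, lam j ^ 2 * h s j)) s := by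
    intro s
    have h2 : HasDerivAt (fun s => Real.exp (θ * s)) (Real.exp (θ * s) * (θ * 1)) s :=
      ((hasDerivAt_id s).const_mul _).exp
    refine (h2.mul (H.deriv s k)).congr_deriv ?_
    ring
  have hc := H.continuous_forcing
  have hk' := H.continuous k
  have i1 : IntervalIntegrable (fun s => -(2 * lam k - θ) * (Real.exp (θ * s) * h s k))
    volume 0 t := Continuous.intervalIntegrable (by fun_prop) _ _
  have i2 : IntervalIntegrable (fun s => Real.exp (θ * s) * (N⁻¹ * ∑ j, lam j ^ 2 * h s j))
    volume 0 t := Continuous.intervalIntegrable (by fun_prop) _ _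
  have h3 := intervalIntegral.integral_eq_sub_of_hasDerivAt (a := 0) (b := t) (fun s _ => h1 s)
    (i1.add i2)
  rw [intervalIntegral.integral_add i1 i2, intervalIntegral.integral_const_mul, H.init] at h3
  rw [le_div_iff₀ (by linarith)]
  have h4 := mul_nonneg (Real.exp_pos (θ * t)).le (H.nonneg t ht k)
  simp only [mul_zero, Real.exp_zero, one_mul] at h3
  linarith

/-- The exponentially tilted mass of the forcing term is bounded, provided that the tilted mass of
the renewal kernel is less than one. -/
lemma integral_exp_mul_forcing_le (hN : 0 < N) {θ : ℝ}
    (hθ : ∀ k, lam k ≠ 0 → θ < 2 * lam k)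
    (hκ : N⁻¹ * ∑ k, lam k ^ 2 / (2 * lam k - θ) ≤ 3 / 4) {t : ℝ} (ht : 0 ≤ t) :
    ∫ s in (0)..t, Real.exp (θ * s) * (N⁻¹ * ∑ j, lam j ^ 2 * h s j) ≤ 3 := by
  set I := ∫ s in (0)..t, Real.exp (θ * s) * (N⁻¹ * ∑ j, lam j ^ 2 * h s j) with hI
  have hI0 : 0 ≤ I := intervalIntegral.integral_nonneg ht fun s hs =>
    mul_nonneg (Real.exp_pos _).le (H.forcing_nonneg hN hs.1)
  have hc := H.continuous
  have h1 : I = N⁻¹ * ∑ k, lam k ^ 2 * ∫ s in (0)..t, Real.exp (θ * s) * h s k := by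
    have : ∀ s, Real.exp (θ * s) * (N⁻¹ * ∑ j, lam j ^ 2 * h s j) =
        N⁻¹ * ∑ j, lam j ^ 2 * (Real.exp (θ * s) * h s j) := by
      intro s
      rw [mul_left_comm, Finset.mul_sum]
      congr 1
      exact Finset.sum_congr rfl fun j _ => by ring
    rw [hI]
    simp only [this]
    rw [intervalIntegral.integral_const_mul, intervalIntegral.integral_finsetSum
      fun j _ => Continuous.intervalIntegrable (by fun_prop) _ _]
    simp only [intervalIntegral.integral_const_mul]
  have h2 : I ≤ (N⁻¹ * ∑ k, lam k ^ 2 / (2 * lam k - θ)) * (1 + I) := by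
    rw [mul_assoc, Finset.sum_mul]
    conv_lhs => rw [h1]
    refine mul_le_mul_of_nonneg_left (Finset.sum_le_sum fun k _ => ?_) (by positivity)
    by_cases hk : lam k = 0
    · simp [hk]
    · rw [div_mul_eq_mul_div, mul_div_assoc]
      exact mul_le_mul_of_nonneg_left (H.integral_exp_mul_le ht (hθ k hk)) (sq_nonneg _)
  have h3 := mul_le_mul_of_nonneg_right hκ (by linarith : 0 ≤ 1 + I)
  linarith

/-- The exponentially tilted forcing term inherits the decay of its renewal kernel. -/
lemma forcing_le (hN : 0 < N) {θ : ℝ} (hθ : ∀ k, lam k ≠ 0 → θ < 2 * lam k)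
    (hκ : N⁻¹ * ∑ k, lam k ^ 2 / (2 * lam k - θ) ≤ 3 / 4) {a M C : ℝ} (ha : 1 ≤ a) (hM : 0 ≤ M)
    (hC : 0 ≤ C) (hK : ∀ t, 0 ≤ t → N⁻¹ * ∑ k, lam k ^ 2 * Real.exp (-(2 * lam k - θ) * t) ≤
      C * decayProfile a M t) {t : ℝ} (ht : 0 ≤ t) :
    N⁻¹ * ∑ j, lam j ^ 2 * h t j ≤ 8 * (C + 3 * C * (1 / (7 * a)) ^ (-a)) * decayProfile a M t *
      Real.exp (-θ * t) := by
  have hc := H.continuous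
  have key := renewal_le ha hM hC
    (K := fun t => N⁻¹ * ∑ k, lam k ^ 2 * Real.exp (-(2 * lam k - θ) * t))
    (G := fun t => Real.exp (θ * t) * (N⁻¹ * ∑ j, lam j ^ 2 * h t j))
    (by fun_prop) (by fun_prop) ?_ ?_ hK ?_
    (fun t ht => H.integral_exp_mul_forcing_le hN hθ hκ ht) ?_ t ht
  · have hE : Real.exp (-θ * t) * Real.exp (θ * t) = 1 := by
      rw [← Real.exp_add]; simp
    calc N⁻¹ * ∑ j, lam j ^ 2 * h t j = Real.exp (-θ * t) * (Real.exp (θ * t) *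
          (N⁻¹ * ∑ j, lam j ^ 2 * h t j)) := by rw [← mul_assoc, hE, one_mul]
      _ ≤ Real.exp (-θ * t) * _ := mul_le_mul_of_nonneg_left key (Real.exp_pos _).le
      _ = _ := by ring
  · intro t _
    exact mul_nonneg (by positivity) (Finset.sum_nonneg fun k _ => by positivity)
  · intro t ht
    exact mul_nonneg (Real.exp_pos _).le (H.forcing_nonneg hN ht)
  · intro t ht
    rw [intervalIntegral.integral_const_mul, intervalIntegral.integral_finsetSum
      fun j _ => Continuous.intervalIntegrable (by fun_prop) _ _]
    refine le_trans (mul_le_mul_of_nonneg_left (Finset.sum_le_sum fun k _ => ?_) (by positivity)) hκ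
    rw [intervalIntegral.integral_const_mul, div_eq_mul_inv]
    by_cases hk : lam k = 0
    · simp [hk]
    · refine mul_le_mul_of_nonneg_left ?_ (sq_nonneg _)
      have hpos : 0 < 2 * lam k - θ := by linarith [hθ k hk]
      rw [intervalIntegral.integral_comp_mul_left (fun x => Real.exp x) (neg_ne_zero.2 hpos.ne'),
        integral_exp, mul_zero, Real.exp_zero, smul_eq_mul, inv_neg]
      have h1 := mul_pos (inv_pos.2 hpos) (Real.exp_pos (-(2 * lam k - θ) * t))
      linarith
  · intro t ht
    have e1 : ∀ k, lam k ^ 2 * h t k = lam k ^ 2 * Real.exp (-(2 * lam k) * t) +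
        ∫ s in (0)..t, lam k ^ 2 * (Real.exp (-(2 * lam k) * (t - s)) *
          (N⁻¹ * ∑ j, lam j ^ 2 * h s j)) := by
      intro k
      rw [intervalIntegral.integral_const_mul, ← mul_add, ← H.eq_exp_add_integral k t]
    have e2 : ∀ s, (N⁻¹ * ∑ k, lam k ^ 2 * Real.exp (-(2 * lam k - θ) * (t - s))) *
        (Real.exp (θ * s) * (N⁻¹ * ∑ j, lam j ^ 2 * h s j)) = Real.exp (θ * t) * (N⁻¹ *
        ∑ k, lam k ^ 2 * (Real.exp (-(2 * lam k) * (t - s)) *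
          (N⁻¹ * ∑ j, lam j ^ 2 * h s j))) := by
      intro s
      have e3 : ∀ k, Real.exp (-(2 * lam k - θ) * (t - s)) * Real.exp (θ * s) =
          Real.exp (θ * t) * Real.exp (-(2 * lam k) * (t - s)) := by
        intro k
        rw [← Real.exp_add, ← Real.exp_add]; congr 1; ring
      rw [← mul_assoc, mul_assoc N⁻¹, Finset.sum_mul]
      simp only [mul_assoc (lam _ ^ 2), e3]
      simp only [← mul_assoc, ← Finset.sum_mul]
      simp only [mul_assoc, ← Finset.mul_sum, mul_left_comm _ (Real.exp (θ * t))]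
    simp only [e2]
    rw [intervalIntegral.integral_const_mul, intervalIntegral.integral_const_mul,
      intervalIntegral.integral_finsetSum
        fun j _ => Continuous.intervalIntegrable (by fun_prop) _ _,
      Finset.sum_congr rfl fun k _ => e1 k, Finset.sum_add_distrib, mul_add, mul_add]
    congr 1
    rw [mul_left_comm, Finset.mul_sum]
    congr 1
    refine Finset.sum_congr rfl fun k _ => ?_
    rw [mul_left_comm, ← Real.exp_add]
    congr 2; ring

end IsSpectralSystem

end SpectralSystem

section SpectralFunctionals

variable {κ : Type*} [Fintype κ]

/-- The energy `N⁻¹ ∑ₖ λₖ hₖ` of a solution of the spectral system. -/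
noncomputable def spectralEnergy (lam : κ → ℝ) (N : ℝ) (h : ℝ → κ → ℝ) (t : ℝ) : ℝ :=
  N⁻¹ * ∑ k, lam k * h t k

/-- The variance `N⁻¹ ∑_{k ≠ k₀} hₖ` of a solution of the spectral system. -/
noncomputable def spectralVariance [DecidableEq κ] (k₀ : κ) (N : ℝ) (h : ℝ → κ → ℝ) (t : ℝ) : ℝ :=
  N⁻¹ * ∑ k ∈ Finset.univ.erase k₀, h t k

namespace IsSpectralSystem

variable {lam : κ → ℝ} {N : ℝ} {h : ℝ → κ → ℝ} (H : IsSpectralSystem lam N h)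
include H

lemma hasDerivAt_spectralEnergy (hN : N ≠ 0) (htr : ∑ k, lam k = N) (t : ℝ) :
    HasDerivAt (spectralEnergy lam N h) (-(N⁻¹ * ∑ j, lam j ^ 2 * h t j)) t := by
  have h1 : HasDerivAt (spectralEnergy lam N h) (N⁻¹ * ∑ k, lam k *
      (-(2 * lam k) * h t k + N⁻¹ * ∑ j, lam j ^ 2 * h t j)) t := by
    unfold spectralEnergy
    exact (HasDerivAt.fun_sum fun k _ => (H.deriv t k).const_mul (lam k)).const_mul N⁻¹
  refine h1.congr_deriv ?_
  simp only [mul_add, Finset.sum_add_distrib, ← Finset.sum_mul, htr]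
  have e : ∑ k, lam k * (-(2 * lam k) * h t k) = -(2 * ∑ k, lam k ^ 2 * h t k) := by
    rw [Finset.mul_sum, ← Finset.sum_neg_distrib]
    exact Finset.sum_congr rfl fun k _ => by ring
  rw [e, mul_inv_cancel_left₀ hN]
  ring

lemma spectralEnergy_nonneg (hN : 0 < N) (hlam : ∀ k, 0 ≤ lam k) {t : ℝ} (ht : 0 ≤ t) :
    0 ≤ spectralEnergy lam N h t :=
  mul_nonneg (by positivity) (Finset.sum_nonneg fun k _ => mul_nonneg (hlam k) (H.nonneg t ht k))

lemma spectralVariance_nonneg [DecidableEq κ] (hN : 0 < N) (k₀ : κ) {t : ℝ} (ht : 0 ≤ t) :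
    0 ≤ spectralVariance k₀ N h t :=
  mul_nonneg (by positivity) (Finset.sum_nonneg fun k _ => H.nonneg t ht k)

/-- The second moment of the zero mode plus the energy is conserved. -/
lemma zero_mode_add_spectralEnergy (hN : N ≠ 0) (htr : ∑ k, lam k = N) {k₀ : κ} (hk₀ : lam k₀ = 0)
    (t : ℝ) : h t k₀ + spectralEnergy lam N h t = 2 := by
  have hd : ∀ t, HasDerivAt (fun t => h t k₀ + spectralEnergy lam N h t) 0 t := by
    intro t
    refine ((H.deriv t k₀).add (H.hasDerivAt_spectralEnergy hN htr t)).congr_deriv ?_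
    rw [hk₀]; ring
  have hc := is_const_of_deriv_eq_zero (fun t => (hd t).differentiableAt) (fun t => (hd t).deriv)
    t 0
  rw [hc, H.init, spectralEnergy]
  simp only [H.init, mul_one, htr]
  rw [inv_mul_cancel₀ hN]
  norm_num

lemma hasDerivAt_spectralVariance_add [DecidableEq κ] (hN : N ≠ 0) (htr : ∑ k, lam k = N)
    (hcard : (Fintype.card κ : ℝ) = N) {k₀ : κ} (hk₀ : lam k₀ = 0) (t : ℝ) :
    HasDerivAt (fun t => spectralVariance k₀ N h t + (1 - N⁻¹) * spectralEnergy lam N h t)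
      (-(2 * spectralEnergy lam N h t)) t := by
  have h1 : HasDerivAt (spectralVariance k₀ N h) (N⁻¹ * ∑ k ∈ Finset.univ.erase k₀,
      (-(2 * lam k) * h t k + N⁻¹ * ∑ j, lam j ^ 2 * h t j)) t := by
    unfold spectralVariance
    exact (HasDerivAt.fun_sum fun k _ => H.deriv t k).const_mul N⁻¹
  refine (h1.add ((H.hasDerivAt_spectralEnergy hN htr t).const_mul (1 - N⁻¹))).congr_deriv ?_
  rw [Finset.sum_add_distrib, Finset.sum_const, Finset.card_erase_of_mem (Finset.mem_univ _),
    Finset.card_univ, nsmul_eq_mul, Nat.cast_sub (Fintype.card_pos_iff.2 ⟨k₀⟩), hcard]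
  have h2 : ∑ k ∈ Finset.univ.erase k₀, -(2 * lam k) * h t k = -(2 * ∑ k, lam k * h t k) := by
    rw [← Finset.add_sum_erase _ (fun k => lam k * h t k) (Finset.mem_univ k₀), hk₀, zero_mul,
      zero_add, Finset.mul_sum, ← Finset.sum_neg_distrib]
    exact Finset.sum_congr rfl fun k _ => by ring
  rw [h2, spectralEnergy]
  push_cast
  field_simp
  ring

lemma integral_le_of_pos {θ : ℝ} (hN : 0 < N) (hθ0 : 0 ≤ θ)
    (hθ : ∀ k, lam k ≠ 0 → θ < 2 * lam k)
    (hκ : N⁻¹ * ∑ k, lam k ^ 2 / (2 * lam k - θ) ≤ 3 / 4) {k : κ} (hk : lam k ≠ 0) {t : ℝ}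
    (ht : 0 ≤ t) : ∫ s in (0)..t, h s k ≤ 4 / (2 * lam k - θ) := by
  have hc := H.continuous k
  calc ∫ s in (0)..t, h s k ≤ ∫ s in (0)..t, Real.exp (θ * s) * h s k := by
        refine intervalIntegral.integral_mono_on ht (hc.intervalIntegrable _ _)
          (Continuous.intervalIntegrable (by fun_prop) _ _) fun s hs => ?_
        exact le_mul_of_one_le_left (H.nonneg s hs.1 k) (Real.one_le_exp (mul_nonneg hθ0 hs.1))
    _ ≤ _ := H.integral_exp_mul_le ht (hθ k hk)
    _ ≤ _ := by
        have := hθ k hk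
        have := H.integral_exp_mul_forcing_le hN hθ hκ ht
        gcongr
        linarith

lemma exists_integral_spectralEnergy_le {θ : ℝ} (hN : 0 < N) (hθ0 : 0 ≤ θ)
    (hlam : ∀ k, 0 ≤ lam k) (hθ : ∀ k, lam k ≠ 0 → θ < 2 * lam k)
    (hκ : N⁻¹ * ∑ k, lam k ^ 2 / (2 * lam k - θ) ≤ 3 / 4) :
    ∃ B, ∀ t, 0 ≤ t → ∫ s in (0)..t, spectralEnergy lam N h s ≤ B := by
  have hc := H.continuous
  refine ⟨N⁻¹ * ∑ k, lam k * (4 / (2 * lam k - θ)), fun t ht => ?_⟩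
  simp only [spectralEnergy]
  rw [intervalIntegral.integral_const_mul, intervalIntegral.integral_finsetSum
      fun j _ => Continuous.intervalIntegrable (by fun_prop) _ _]
  refine mul_le_mul_of_nonneg_left (Finset.sum_le_sum fun k _ => ?_) (by positivity)
  rw [intervalIntegral.integral_const_mul]
  by_cases hk : lam k = 0
  · simp [hk]
  · exact mul_le_mul_of_nonneg_left (H.integral_le_of_pos hN hθ0 hθ hκ hk ht) (hlam k)

lemma exists_integral_spectralVariance_le [DecidableEq κ] {θ : ℝ} (hN : 0 < N) (hθ0 : 0 ≤ θ)
    {k₀ : κ} (hk₀ : ∀ k, k ≠ k₀ → lam k ≠ 0) (hθ : ∀ k, lam k ≠ 0 → θ < 2 * lam k)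
    (hκ : N⁻¹ * ∑ k, lam k ^ 2 / (2 * lam k - θ) ≤ 3 / 4) :
    ∃ B, ∀ t, 0 ≤ t → ∫ s in (0)..t, spectralVariance k₀ N h s ≤ B := by
  have hc := H.continuous
  refine ⟨N⁻¹ * ∑ k ∈ Finset.univ.erase k₀, (4 / (2 * lam k - θ)), fun t ht => ?_⟩
  simp only [spectralVariance]
  rw [intervalIntegral.integral_const_mul, intervalIntegral.integral_finsetSum
      fun j _ => Continuous.intervalIntegrable (by fun_prop) _ _]
  refine mul_le_mul_of_nonneg_left (Finset.sum_le_sum fun k hk => ?_) (by positivity)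
  exact H.integral_le_of_pos hN hθ0 hθ hκ (hk₀ k (Finset.ne_of_mem_erase hk)) ht

lemma continuous_spectralEnergy : Continuous (spectralEnergy lam N h) := by
  have hc := H.continuous
  unfold spectralEnergy
  fun_prop

lemma continuous_spectralVariance [DecidableEq κ] (k₀ : κ) :
    Continuous (spectralVariance k₀ N h) := by
  have hc := H.continuous
  unfold spectralVariance
  fun_prop

/-- The decay of energy and variance follows from that of the forcing term `g`, since the energy
`e` and the variance `v` satisfy `e' = -g` and `(v + (1 - N⁻¹) e)' = -2 e`. -/
lemma spectralEnergy_le_and_spectralVariance_le [DecidableEq κ] {θ a c C M₀ M₁ M₂ : ℝ}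
    (hN : 1 ≤ N) (htr : ∑ k, lam k = N) (hcard : (Fintype.card κ : ℝ) = N)
    {k₀ : κ} (hk₀ : lam k₀ = 0) (hne : ∀ k, k ≠ k₀ → lam k ≠ 0) (hlam : ∀ k, 0 ≤ lam k)
    (hθ0 : 0 ≤ θ) (hθ : ∀ k, lam k ≠ 0 → θ < 2 * lam k)
    (hκ : N⁻¹ * ∑ k, lam k ^ 2 / (2 * lam k - θ) ≤ 3 / 4)
    (hM₀ : 0 ≤ M₀) (hM₁ : 0 ≤ M₁) (hc : 0 < c) (hca : c ≤ a)
    (h21 : c * M₂ ≤ θ * M₁) (h10 : c * M₁ ≤ θ * M₀) (hC : 0 ≤ C)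
    (hg : ∀ t, 0 ≤ t → N⁻¹ * ∑ j, lam j ^ 2 * h t j ≤
      C * decayProfile (a + 1 + 1) M₂ t * Real.exp (-θ * t)) {t : ℝ} (ht : 0 ≤ t) :
    spectralEnergy lam N h t ≤ C / c * decayProfile (a + 1) M₁ t * Real.exp (-θ * t) ∧
    spectralVariance k₀ N h t ≤ 2 * (C / c) / c * decayProfile a M₀ t * Real.exp (-θ * t) := by
  have hN0 : 0 < N := by linarith
  have hNi : N⁻¹ ≤ 1 := inv_le_one_of_one_le₀ hN
  have he0 : ∀ t, 0 ≤ t → 0 ≤ spectralEnergy lam N h t :=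
    fun t ht => H.spectralEnergy_nonneg hN0 hlam ht
  obtain ⟨B₁, hB₁⟩ := H.exists_integral_spectralEnergy_le hN0 hθ0 hlam hθ hκ
  obtain ⟨B₀, hB₀⟩ := H.exists_integral_spectralVariance_le hN0 hθ0 hne hθ hκ
  have key : ∀ t, 0 ≤ t → spectralEnergy lam N h t ≤
      C / c * decayProfile (a + 1) M₁ t * Real.exp (-θ * t) :=
    le_decayProfile_of_deriv hM₁ hθ0 hc (by linarith) h21 hC
      (H.hasDerivAt_spectralEnergy hN0.ne' htr) hg he0 hB₁
  refine ⟨key t ht, ?_⟩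
  have c1 := H.continuous_spectralEnergy
  have c2 := H.continuous_spectralVariance k₀
  have h2 := le_decayProfile_of_deriv (φ := fun t => 2 * spectralEnergy lam N h t)
    (C := 2 * (C / c)) (B := B₀ + (1 - N⁻¹) * B₁) hM₀ hθ0 hc hca h10 (by positivity)
    (H.hasDerivAt_spectralVariance_add hN0.ne' htr hcard hk₀)
    (fun t ht => by linarith [key t ht]) ?_ ?_ t ht
  · have := mul_nonneg (sub_nonneg.2 hNi) (he0 t ht)
    linarith
  · intro t ht
    exact add_nonneg (H.spectralVariance_nonneg hN0 k₀ ht)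
      (mul_nonneg (sub_nonneg.2 hNi) (he0 t ht))
  · intro t ht
    rw [intervalIntegral.integral_add (c2.intervalIntegrable _ _)
      ((c1.const_mul _).intervalIntegrable _ _), intervalIntegral.integral_const_mul]
    exact add_le_add (hB₀ t ht) (mul_le_mul_of_nonneg_left (hB₁ t ht) (sub_nonneg.2 hNi))

end IsSpectralSystem

end SpectralFunctionals

section TorusSystem

variable {d n : ℕ} [NeZero n]

/-- The exponential rate of decay `2 λ₁ - 6400 / n ^ (d + 4)`, where `λ₁` is the spectral gap. -/
noncomputable def torusRate (d n : ℕ) : ℝ := 2 * cycleGap n / d - 6400 / (n : ℝ) ^ (d + 4)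

lemma card_torus : (Fintype.card (Torus d n) : ℝ) = (n : ℝ) ^ d := by
  simp [ZMod.card]

lemma cycleGap_div_le_torusRate (hd : 1 ≤ d) (hn : 800 ≤ n) : cycleGap n / d ≤ torusRate d n := by
  have hn0 := natCast_pos_of_neZero (n := n)
  have hd0 : (0 : ℝ) < d := by exact_mod_cast hd
  have h1 := le_cycleGap (n := n) (by omega)
  have h2 : 6400 / (n : ℝ) ^ (d + 4) ≤ cycleGap n / d := by
    calc 6400 / (n : ℝ) ^ (d + 4) ≤ 8 / (n : ℝ) ^ 2 / d := by
          rw [div_div, div_le_div_iff₀ (by positivity) (by positivity)]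
          have h3 : (800 : ℝ) ≤ n := by exact_mod_cast hn
          have h4 : (d : ℝ) ≤ n ^ d := by
            have : d ≤ n ^ d := (Nat.lt_pow_self (by omega)).le
            exact_mod_cast this
          have h5 : (800 : ℝ) * d ≤ n ^ 2 * n ^ d := by
            refine mul_le_mul ?_ h4 hd0.le (by positivity)
            nlinarith
          have : (n : ℝ) ^ (d + 4) = n ^ 2 * (n ^ 2 * n ^ d) := by ring
          rw [this]
          have h6 : (0 : ℝ) ≤ n ^ 2 := by positivity
          nlinarith [mul_le_mul_of_nonneg_left h5 h6]
      _ ≤ _ := by gcongr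
  have : torusRate d n = cycleGap n / d + (cycleGap n / d - 6400 / (n : ℝ) ^ (d + 4)) := by
    unfold torusRate; ring
  linarith

lemma torusEigenvalue_ne_zero (hd : 1 ≤ d) (hn : 3 ≤ n) {k : Torus d n} (hk : k ≠ 0) :
    torusEigenvalue k ≠ 0 := by
  have h1 := cycleGap_div_le_torusEigenvalue hd hk
  have h2 : 0 < cycleGap n / d := div_pos (cycleGap_pos hn) (by exact_mod_cast hd)
  linarith

lemma torusRate_lt (hd : 1 ≤ d) {k : Torus d n} (hk : torusEigenvalue k ≠ 0) :
    torusRate d n < 2 * torusEigenvalue k := by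
  have hk0 : k ≠ 0 := by rintro rfl; exact hk (torusEigenvalue_zero hd)
  have h1 := cycleGap_div_le_torusEigenvalue hd hk0
  have hn0 := natCast_pos_of_neZero (n := n)
  have h2 : 0 < 6400 / (n : ℝ) ^ (d + 4) := by positivity
  unfold torusRate
  rw [mul_div_assoc]
  linarith

lemma cycleGap_div_sq_le (hd : 1 ≤ d) (hn : 3 ≤ n) :
    (cycleGap n / d) ^ 2 * (2 * d) ≤ 800 / (n : ℝ) ^ 4 := by
  have hn0 := natCast_pos_of_neZero (n := n)
  have hd0 : (1 : ℝ) ≤ d := by exact_mod_cast hd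
  have h1 : (cycleGap n) ^ 2 ≤ 400 / (n : ℝ) ^ 4 := by
    calc (cycleGap n) ^ 2 ≤ (20 / (n : ℝ) ^ 2) ^ 2 :=
          pow_le_pow_left₀ (cycleGap_pos hn).le (cycleGap_le hn) 2
      _ = _ := by rw [div_pow]; ring_nf
  have h2 : (cycleGap n / d) ^ 2 * (2 * d) = 2 * (cycleGap n) ^ 2 / d := by field_simp
  rw [h2, div_le_iff₀ (by linarith)]
  have h3 : 0 ≤ 800 / (n : ℝ) ^ 4 := by positivity
  have h4 : 800 / (n : ℝ) ^ 4 = 2 * (400 / (n : ℝ) ^ 4) := by ring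
  nlinarith

/-- The tilted mass of the renewal kernel is at most `3 / 4`: the `2 d` lowest eigenvalues
contribute at most `1 / 8`, and the other ones `1 / 2` plus at most the spectral gap. -/
lemma renewal_mass_le (hd : 1 ≤ d) (hn : 800 ≤ n) : ((n : ℝ) ^ d)⁻¹ *
    ∑ k : Torus d n, torusEigenvalue k ^ 2 / (2 * torusEigenvalue k - torusRate d n) ≤ 3 / 4 := by
  classical
  have hn0 := natCast_pos_of_neZero (n := n)
  have hd0 : (1 : ℝ) ≤ d := by exact_mod_cast hd
  set g := cycleGap n / d with hg
  have hg0 : 0 < g := div_pos (cycleGap_pos (by omega)) (by linarith)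
  set ε := 6400 / (n : ℝ) ^ (d + 4) with hε
  have hε0 : 0 < ε := by positivity
  have hrate : torusRate d n = 2 * g - ε := by rw [torusRate, hg, hε]; ring
  have h1 : ∀ k : Torus d n, torusEigenvalue k ^ 2 / (2 * torusEigenvalue k - torusRate d n) ≤
      (if k ∈ torusAxes d n then g ^ 2 / ε else 0) + (torusEigenvalue k / 2 + g) := by
    intro k
    have hk0 := torusEigenvalue_nonneg hd k
    by_cases hk : k ∈ torusAxes d n
    · rw [if_pos hk, torusEigenvalue_of_mem_torusAxes hd (by omega) hk, hrate, ← hg]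
      rw [show 2 * g - (2 * g - ε) = ε by ring]
      linarith
    · rw [if_neg hk, zero_add]
      by_cases h0 : k = 0
      · subst h0
        rw [torusEigenvalue_zero hd]
        simp [hg0.le]
      · have h2 := two_mul_cycleGap_div_le_torusEigenvalue hd (by omega) h0 hk
        rw [← hg] at h2
        rw [hrate, div_le_iff₀ (by linarith)]
        nlinarith
  have hN0 : (0 : ℝ) < (n : ℝ) ^ d := by positivity
  have h2 : ∑ k : Torus d n, torusEigenvalue k ^ 2 / (2 * torusEigenvalue k - torusRate d n) ≤
      (2 * d) * (g ^ 2 / ε) + ((n : ℝ) ^ d / 2 + (n : ℝ) ^ d * g) := by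
    refine (Finset.sum_le_sum fun k _ => h1 k).trans ?_
    rw [Finset.sum_add_distrib, Finset.sum_add_distrib, ← Finset.sum_div,
      sum_torusEigenvalue (by omega), Finset.sum_const, Finset.card_univ, nsmul_eq_mul, card_torus,
      Finset.sum_ite_mem, Finset.univ_inter, Finset.sum_const, nsmul_eq_mul]
    gcongr
    exact_mod_cast card_torusAxes_le
  have h3 : ((n : ℝ) ^ d)⁻¹ * ((2 * d) * (g ^ 2 / ε)) ≤ 1 / 8 := by
    have h4 := cycleGap_div_sq_le hd (show 3 ≤ n by omega)
    rw [← hg] at h4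
    have h5 : ((n : ℝ) ^ d)⁻¹ * ((2 * d) * (g ^ 2 / ε)) = g ^ 2 * (2 * d) * n ^ 4 / 6400 := by
      rw [hε]; field_simp; ring
    rw [h5, div_le_iff₀ (by norm_num)]
    rw [le_div_iff₀ (by positivity)] at h4
    linarith
  have h4 : g ≤ 1 / 8 := by
    have h5 := cycleGap_le (n := n) (by omega)
    have h6 : (800 : ℝ) ≤ n := by exact_mod_cast hn
    have h7 : cycleGap n ≤ 1 / 8 := by
      refine h5.trans ?_
      rw [div_le_div_iff₀ (by positivity) (by norm_num)]
      nlinarith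
    exact (div_le_self (cycleGap_pos (by omega)).le hd0).trans h7
  calc _ ≤ ((n : ℝ) ^ d)⁻¹ * ((2 * d) * (g ^ 2 / ε) + ((n : ℝ) ^ d / 2 + (n : ℝ) ^ d * g)) :=
        mul_le_mul_of_nonneg_left h2 (by positivity)
    _ = ((n : ℝ) ^ d)⁻¹ * ((2 * d) * (g ^ 2 / ε)) + (1 / 2 + g) := by field_simp
    _ ≤ _ := by linarith

lemma sq_mul_exp_le {x t : ℝ} (hx0 : 0 ≤ x) (hx2 : x ≤ 2) (ht : 0 ≤ t) :
    x ^ 2 * Real.exp (-(x * t)) ≤ 16 * (1 + t) ^ (-2 : ℝ) * Real.exp (-(t / 2 * x)) := by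
  have h1 : x * (1 + t) ≤ 4 * Real.exp (x * t / 4) := by
    have := Real.add_one_le_exp (x * t / 4)
    linarith
  have h2 : (x * (1 + t)) ^ 2 ≤ (4 * Real.exp (x * t / 4)) ^ 2 :=
    pow_le_pow_left₀ (by positivity) h1 2
  have h3 : (4 * Real.exp (x * t / 4)) ^ 2 = 16 * Real.exp (x * t / 2) := by
    rw [mul_pow, ← Real.exp_nat_mul]; norm_num; ring_nf
  have h4 : (1 + t) ^ (-2 : ℝ) = ((1 + t) ^ 2)⁻¹ := by
    rw [Real.rpow_neg (by linarith)]; norm_num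
  have h5 : Real.exp (-(t / 2 * x)) = Real.exp (x * t / 2) * Real.exp (-(x * t)) := by
    rw [← Real.exp_add]; ring_nf
  rw [h3] at h2
  rw [h4, h5]
  have hE := Real.exp_pos (-(x * t))
  calc x ^ 2 * Real.exp (-(x * t)) =
        ((x * (1 + t)) ^ 2) * ((1 + t) ^ 2)⁻¹ * Real.exp (-(x * t)) := by field_simp
    _ ≤ (16 * Real.exp (x * t / 2)) * ((1 + t) ^ 2)⁻¹ * Real.exp (-(x * t)) := by gcongr
    _ = _ := by ring

/-- The bound of the tilted renewal kernel at the time scales below and above `n²`. -/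
lemma renewal_kernel_le (hd : 1 ≤ d) (hn : 800 ≤ n) {t : ℝ} (ht : 0 ≤ t) : ((n : ℝ) ^ d)⁻¹ *
    ∑ k : Torus d n, torusEigenvalue k ^ 2 *
      Real.exp (-(2 * torusEigenvalue k - torusRate d n) * t) ≤
    (800 + 16 * (4 * d) ^ d * (1 + 2 ^ d)) *
      decayProfile ((d : ℝ) / 2 + 1 + 1) ((n : ℝ) ^ (d + 4))⁻¹ t := by
  classical
  have hn0 := natCast_pos_of_neZero (n := n)
  have hd0 : (1 : ℝ) ≤ d := by exact_mod_cast hd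
  set g := cycleGap n / d with hg
  have hg0 : 0 < g := div_pos (cycleGap_pos (by omega)) (by linarith)
  set ε := 6400 / (n : ℝ) ^ (d + 4) with hε
  have hε0 : 0 < ε := by positivity
  have hrate : torusRate d n = 2 * g - ε := by rw [torusRate, hg, hε]; ring
  set E : ℝ := 16 * (1 + t) ^ (-2 : ℝ) with hE
  have hE0 : 0 ≤ E := by positivity
  have h1 : ∀ k : Torus d n, torusEigenvalue k ^ 2 *
      Real.exp (-(2 * torusEigenvalue k - torusRate d n) * t) ≤
      (if k ∈ torusAxes d n then g ^ 2 else 0) + E * Real.exp (-(t / 2 * torusEigenvalue k)) := by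
    intro k
    have hk0 := torusEigenvalue_nonneg hd k
    by_cases hk : k ∈ torusAxes d n
    · rw [if_pos hk, torusEigenvalue_of_mem_torusAxes hd (by omega) hk, hrate, ← hg]
      have h2 : Real.exp (-(2 * g - (2 * g - ε)) * t) ≤ 1 := by
        rw [Real.exp_le_one_iff]
        have := mul_nonneg hε0.le ht
        linarith
      have h3 : 0 ≤ E * Real.exp (-(t / 2 * g)) := by positivity
      nlinarith [sq_nonneg g]
    · rw [if_neg hk, zero_add]
      refine le_trans ?_ (sq_mul_exp_le hk0 (torusEigenvalue_le_two hd k) ht)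
      by_cases h0 : k = 0
      · subst h0
        rw [torusEigenvalue_zero hd]
        simp
      · have h2 := two_mul_cycleGap_div_le_torusEigenvalue hd (by omega) h0 hk
        rw [← hg] at h2
        refine mul_le_mul_of_nonneg_left ?_ (sq_nonneg _)
        rw [Real.exp_le_exp, neg_mul, neg_le_neg_iff, hrate]
        exact mul_le_mul_of_nonneg_right (by linarith) ht
  set w := decayProfile ((d : ℝ) / 2 + 1 + 1) ((n : ℝ) ^ (d + 4))⁻¹ t with hw
  have hp : 0 ≤ (1 + t) ^ (-((d : ℝ) / 2 + 1 + 1)) := by positivity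
  have hq : 0 ≤ ((n : ℝ) ^ (d + 4))⁻¹ := by positivity
  have hadd : (1 + t) ^ (-2 : ℝ) * (1 + t) ^ (-((d : ℝ) / 2)) =
      (1 + t) ^ (-((d : ℝ) / 2 + 1 + 1)) := by
    rw [← Real.rpow_add (by linarith)]; congr 1; ring
  have hw1 : (1 + t) ^ (-2 : ℝ) * (1 + t) ^ (-((d : ℝ) / 2)) ≤ w := by
    rw [hadd, hw, decayProfile]; linarith
  have hw2 : (1 + t) ^ (-2 : ℝ) * ((n : ℝ) ^ d)⁻¹ ≤ w := by
    have hrp : ((n : ℝ) ^ 2) ^ (-((d : ℝ) / 2)) = ((n : ℝ) ^ d)⁻¹ := by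
      rw [Real.rpow_neg (by positivity), ← Real.rpow_natCast, ← Real.rpow_mul (by positivity),
        ← Real.rpow_natCast (n : ℝ) d]
      congr 2; push_cast; ring
    rcases le_or_gt (1 + t) ((n : ℝ) ^ 2) with h | h
    · refine le_trans (mul_le_mul_of_nonneg_left ?_ (by positivity)) hw1
      rw [← hrp]
      exact Real.rpow_le_rpow_of_nonpos (by linarith) h (by linarith)
    · have h2 : (1 + t) ^ (-2 : ℝ) ≤ ((n : ℝ) ^ 4)⁻¹ := by
        rw [Real.rpow_neg (by linarith), show (1 + t) ^ (2 : ℝ) = (1 + t) ^ (2 : ℕ) by norm_num]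
        gcongr
        calc (n : ℝ) ^ 4 = (n ^ 2) ^ 2 := by ring
          _ ≤ _ := pow_le_pow_left₀ (by positivity) h.le 2
      calc (1 + t) ^ (-2 : ℝ) * ((n : ℝ) ^ d)⁻¹ ≤ ((n : ℝ) ^ 4)⁻¹ * ((n : ℝ) ^ d)⁻¹ := by gcongr
        _ = ((n : ℝ) ^ (d + 4))⁻¹ := by rw [← mul_inv]; ring_nf
        _ ≤ w := by rw [hw, decayProfile]; linarith
  have h2 : ((n : ℝ) ^ d)⁻¹ * ∑ k : Torus d n, Real.exp (-(t / 2 * torusEigenvalue k)) ≤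
      (4 * d) ^ d * (((n : ℝ) ^ d)⁻¹ + 2 ^ d * (1 + t) ^ (-((d : ℝ) / 2))) := by
    refine (average_exp_neg_torusEigenvalue_le hd (by positivity)).trans ?_
    gcongr
    calc (1 + t / 2) ^ (-((d : ℝ) / 2)) ≤ ((1 + t) / 2) ^ (-((d : ℝ) / 2)) :=
          Real.rpow_le_rpow_of_nonpos (by positivity) (by linarith) (by linarith)
      _ = 2 ^ ((d : ℝ) / 2) * (1 + t) ^ (-((d : ℝ) / 2)) := by
          rw [Real.div_rpow (by linarith) (by norm_num), Real.rpow_neg (x := 2) (by norm_num)]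
          field_simp
      _ ≤ _ := by
          gcongr
          rw [← Real.rpow_natCast]
          exact Real.rpow_le_rpow_of_exponent_le (by norm_num) (by linarith)
  have h3 : ∑ k : Torus d n, torusEigenvalue k ^ 2 *
      Real.exp (-(2 * torusEigenvalue k - torusRate d n) * t) ≤
      800 / (n : ℝ) ^ 4 + E * ∑ k : Torus d n, Real.exp (-(t / 2 * torusEigenvalue k)) := by
    refine (Finset.sum_le_sum fun k _ => h1 k).trans ?_
    rw [Finset.sum_add_distrib, ← Finset.mul_sum, Finset.sum_ite_mem, Finset.univ_inter,
      Finset.sum_const, nsmul_eq_mul]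
    gcongr
    refine le_trans ?_ (cycleGap_div_sq_le hd (show 3 ≤ n by omega))
    rw [← hg, mul_comm]
    gcongr
    exact_mod_cast card_torusAxes_le
  have h4 : ((n : ℝ) ^ d)⁻¹ * (800 / (n : ℝ) ^ 4) ≤ 800 * w := by
    have : ((n : ℝ) ^ d)⁻¹ * (800 / (n : ℝ) ^ 4) = 800 * ((n : ℝ) ^ (d + 4))⁻¹ := by
      rw [pow_add, mul_inv]; ring
    rw [this]
    gcongr
    rw [hw, decayProfile]; linarith
  calc _ ≤ ((n : ℝ) ^ d)⁻¹ * (800 / (n : ℝ) ^ 4 +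
        E * ∑ k : Torus d n, Real.exp (-(t / 2 * torusEigenvalue k))) :=
        mul_le_mul_of_nonneg_left h3 (by positivity)
    _ = ((n : ℝ) ^ d)⁻¹ * (800 / (n : ℝ) ^ 4) + E * (((n : ℝ) ^ d)⁻¹ *
        ∑ k : Torus d n, Real.exp (-(t / 2 * torusEigenvalue k))) := by ring
    _ ≤ 800 * w + E * ((4 * d) ^ d * (((n : ℝ) ^ d)⁻¹ + 2 ^ d * (1 + t) ^ (-((d : ℝ) / 2)))) :=
        add_le_add h4 (mul_le_mul_of_nonneg_left h2 hE0)
    _ = 800 * w + 16 * (4 * d) ^ d * ((1 + t) ^ (-2 : ℝ) * ((n : ℝ) ^ d)⁻¹ +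
        2 ^ d * ((1 + t) ^ (-2 : ℝ) * (1 + t) ^ (-((d : ℝ) / 2)))) := by rw [hE]; ring
    _ ≤ 800 * w + 16 * (4 * d) ^ d * (w + 2 ^ d * w) := by gcongr
    _ = _ := by ring

end TorusSystem

section TorusBounds

lemma decayProfile_le_two_div_min {a B t : ℝ} (ha : 0 ≤ a) (hB : 0 < B) (ht : 0 < t) :
    decayProfile a B⁻¹ t ≤ 2 / min (t ^ a) B := by
  have hta : 0 < t ^ a := Real.rpow_pos_of_pos ht a
  have hm : 0 < min (t ^ a) B := lt_min hta hB
  have h1 : (1 + t) ^ (-a) ≤ (min (t ^ a) B)⁻¹ := by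
    rw [Real.rpow_neg (by linarith)]
    gcongr
    exact (min_le_left _ _).trans (Real.rpow_le_rpow ht.le (by linarith) ha)
  have h2 : B⁻¹ ≤ (min (t ^ a) B)⁻¹ := by
    gcongr
    exact min_le_right _ _
  unfold decayProfile
  rw [div_eq_mul_inv]
  linarith

/-- The upper bounds of energy and variance. -/
lemma exists_spectral_upper_bound (d : ℕ) (hd : 1 ≤ d) : ∃ C : ℝ, 0 < C ∧
    ∀ (n : ℕ) [NeZero n], 800 ≤ n → ∀ h : ℝ → Torus d n → ℝ,
      IsSpectralSystem torusEigenvalue ((n : ℝ) ^ d) h → ∀ t, 0 ≤ t →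
        spectralEnergy torusEigenvalue ((n : ℝ) ^ d) h t ≤
          C * decayProfile ((d : ℝ) / 2 + 1) ((n : ℝ) ^ (d + 2))⁻¹ t *
            Real.exp (-torusRate d n * t) ∧
        spectralVariance 0 ((n : ℝ) ^ d) h t ≤
          C * decayProfile ((d : ℝ) / 2) ((n : ℝ) ^ d)⁻¹ t * Real.exp (-torusRate d n * t) := by
  have hd1 : (1 : ℝ) ≤ d := by exact_mod_cast hd
  set C₀ : ℝ := 800 + 16 * (4 * d) ^ d * (1 + 2 ^ d) with hC₀
  have hC₀0 : 0 < C₀ := by positivity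
  set C₁ : ℝ := 8 * (C₀ + 3 * C₀ * (1 / (7 * ((d : ℝ) / 2 + 1 + 1))) ^ (-((d : ℝ) / 2 + 1 + 1)))
    with hC₁
  have hC₁0 : 0 < C₁ := by positivity
  set c : ℝ := 1 / (2 * d) with hc
  have hc0 : 0 < c := by positivity
  refine ⟨C₁ / c + 2 * (C₁ / c) / c, by positivity, ?_⟩
  intro n _ hn h H t ht
  have hn0 := natCast_pos_of_neZero (n := n)
  have hn1 : (1 : ℝ) ≤ n := by exact_mod_cast (by omega : 1 ≤ n)
  have hrate : 8 / (d * (n : ℝ) ^ 2) ≤ torusRate d n := by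
    refine le_trans ?_ (cycleGap_div_le_torusRate hd hn)
    have := le_cycleGap (n := n) (by omega)
    rw [mul_comm, ← div_div]
    gcongr
  have hrate0 : 0 ≤ torusRate d n := le_trans (by positivity) hrate
  have hcr : ∀ p : ℕ, c * ((n : ℝ) ^ (p + 2))⁻¹ ≤ torusRate d n * ((n : ℝ) ^ p)⁻¹ := by
    intro p
    calc c * ((n : ℝ) ^ (p + 2))⁻¹ ≤ 8 / (d * (n : ℝ) ^ 2) * ((n : ℝ) ^ p)⁻¹ := by
          have h1 : c * ((n : ℝ) ^ (p + 2))⁻¹ = 1 / 2 * ((d * (n : ℝ) ^ 2)⁻¹ * ((n : ℝ) ^ p)⁻¹) := by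
            rw [hc]; field_simp; ring
          have h2 : 0 ≤ (d * (n : ℝ) ^ 2)⁻¹ * ((n : ℝ) ^ p)⁻¹ := by positivity
          rw [h1, div_eq_mul_inv 8]
          linarith
      _ ≤ _ := by gcongr
  have hg := fun t (ht : 0 ≤ t) => H.forcing_le (by positivity) (fun k hk => torusRate_lt hd hk)
    (renewal_mass_le hd hn) (a := (d : ℝ) / 2 + 1 + 1) (by linarith) (by positivity) hC₀0.le
    (fun t ht => renewal_kernel_le hd hn ht) ht
  obtain ⟨h1, h2⟩ := H.spectralEnergy_le_and_spectralVariance_le (a := (d : ℝ) / 2)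
    (M₀ := ((n : ℝ) ^ d)⁻¹) (M₁ := ((n : ℝ) ^ (d + 2))⁻¹) (M₂ := ((n : ℝ) ^ (d + 2 + 2))⁻¹)
    (one_le_pow₀ hn1) (sum_torusEigenvalue (by omega)) card_torus (torusEigenvalue_zero hd)
    (fun k hk => torusEigenvalue_ne_zero hd (by omega) hk) (torusEigenvalue_nonneg hd) hrate0
    (fun k hk => torusRate_lt hd hk) (renewal_mass_le hd hn) (by positivity) (by positivity) hc0
    (by rw [hc, div_le_div_iff₀ (by positivity) (by norm_num)]; nlinarith) (hcr _) (hcr _)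
    hC₁0.le hg ht
  have hE := Real.exp_pos (-torusRate d n * t)
  have hw1 := decayProfile_nonneg (a := (d : ℝ) / 2 + 1) (M := ((n : ℝ) ^ (d + 2))⁻¹)
    (by positivity) ht
  have hw0 := decayProfile_nonneg (a := (d : ℝ) / 2) (M := ((n : ℝ) ^ d)⁻¹) (by positivity) ht
  refine ⟨h1.trans ?_, h2.trans ?_⟩
  · gcongr
    exact le_add_of_nonneg_right (by positivity)
  · gcongr
    exact le_add_of_nonneg_left (by positivity)

variable {d n : ℕ} [NeZero n]

/-- At times `t` below `n²`, about `(n / √t) ^ d` frequencies have an eigenvalue of order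
`1 / t`. -/
lemma exists_finset_torusEigenvalue (hd : 1 ≤ d) {t : ℝ} (ht : 4 ≤ t)
    (htn : t ≤ (n : ℝ) ^ 2) : ∃ B : Finset (Torus d n), ((n : ℝ) / (4 * √t)) ^ d ≤ B.card ∧
      ∀ k ∈ B, 1 / (2 * t) ≤ torusEigenvalue k ∧ torusEigenvalue k ≤ 20 / t := by
  classical
  have hn0 := natCast_pos_of_neZero (n := n)
  have hd0 : (0 : ℝ) < d := by exact_mod_cast hd
  have ht0 : 0 < t := by linarith
  have hs2 : 2 ≤ √t := Real.le_sqrt_of_sq_le (by linarith)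
  have hs0 : 0 < √t := by linarith
  have hsn : √t ≤ n := by rw [Real.sqrt_le_left hn0.le]; exact htn
  have hst : √t ^ 2 = t := Real.sq_sqrt ht0.le
  set m := ⌊(n : ℝ) / √t⌋₊ with hm
  have hx1 : 1 ≤ (n : ℝ) / √t := by rw [le_div_iff₀ hs0]; linarith
  have hm1 : 1 ≤ m := Nat.le_floor (by simpa using hx1)
  have hmle : (m : ℝ) ≤ n / √t := Nat.floor_le (by positivity)
  have hmge : (n : ℝ) / √t / 2 ≤ m := by
    have h1 := Nat.lt_floor_add_one ((n : ℝ) / √t)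
    have h2 : (1 : ℝ) ≤ m := by exact_mod_cast hm1
    rw [← hm] at h1
    linarith
  have hmn : m ≤ n / 2 := by
    rw [Nat.le_div_iff_mul_le (by norm_num)]
    have : (m : ℝ) * 2 ≤ n := by
      calc (m : ℝ) * 2 ≤ n / √t * √t := by gcongr
        _ = n := by field_simp
    exact_mod_cast this
  set I := (Finset.Icc ((m + 1) / 2) m).image (Nat.cast : ℕ → ZMod n) with hI
  have hval : ∀ a ∈ Finset.Icc ((m + 1) / 2) m, ((a : ℕ) : ZMod n).valMinAbs = a := by
    intro a ha
    exact ZMod.valMinAbs_natCast_of_le_half ((Finset.mem_Icc.1 ha).2.trans hmn)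
  have hcard : I.card = m + 1 - (m + 1) / 2 := by
    rw [hI, Finset.card_image_of_injOn, Nat.card_Icc]
    intro a ha b hb hab
    have h1 := hval a ha
    have h2 := hval b hb
    have hab' : (a : ZMod n) = b := hab
    rw [hab', h2] at h1
    exact_mod_cast h1.symm
  refine ⟨Fintype.piFinset fun _ => I, ?_, fun k hk => ?_⟩
  · rw [Fintype.card_piFinset, Finset.prod_const, Finset.card_univ, Fintype.card_fin, hcard]
    push_cast
    refine pow_le_pow_left₀ (by positivity) ?_ d
    have h1 : m ≤ 2 * (m + 1 - (m + 1) / 2) := by omega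
    have h2 : (m : ℝ) ≤ 2 * ((m + 1 - (m + 1) / 2 : ℕ) : ℝ) := by exact_mod_cast h1
    have h3 : (n : ℝ) / (4 * √t) = n / √t / 2 / 2 := by field_simp; norm_num
    rw [h3]
    linarith
  · have hki : ∀ i, ∃ a : ℕ, (m + 1) / 2 ≤ a ∧ a ≤ m ∧ (k i).valMinAbs = a := by
      intro i
      have h1 := Fintype.mem_piFinset.1 hk i
      obtain ⟨a, ha, hka⟩ := Finset.mem_image.1 h1
      exact ⟨a, (Finset.mem_Icc.1 ha).1, (Finset.mem_Icc.1 ha).2, by rw [← hka, hval a ha]⟩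
    have hx : ((n : ℝ) / √t) ^ 2 = n ^ 2 / t := by rw [div_pow, hst]
    have hlow : ∀ i, 1 / (2 * t) ≤ cosGap (k i) := by
      intro i
      obtain ⟨a, ha1, -, ha⟩ := hki i
      refine le_trans ?_ (le_cosGap (k i))
      rw [ha]
      have h1 : m ≤ 2 * a := by omega
      have h2 : (m : ℝ) ≤ 2 * a := by exact_mod_cast h1
      have h3 : (n : ℝ) / √t ≤ 4 * a := by linarith
      have h4 : n ^ 2 / t ≤ (4 * (a : ℝ)) ^ 2 := by
        rw [← hx]; exact pow_le_pow_left₀ (by positivity) h3 2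
      push_cast
      rw [div_le_iff₀ ht0] at h4
      rw [div_le_div_iff₀ (by positivity) (by positivity)]
      linarith
    have hup : ∀ i, cosGap (k i) ≤ 20 / t := by
      intro i
      obtain ⟨a, -, ha2, ha⟩ := hki i
      refine (cosGap_le (k i)).trans ?_
      rw [ha]
      have h1 : (a : ℝ) ≤ n / √t := le_trans (by exact_mod_cast ha2) hmle
      have h4 : (a : ℝ) ^ 2 ≤ n ^ 2 / t := by
        rw [← hx]; exact pow_le_pow_left₀ (by positivity) h1 2
      have hpi : Real.pi ^ 2 ≤ 10 := by
        have := Real.pi_lt_d2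
        have := Real.pi_pos
        nlinarith
      push_cast
      calc 2 * Real.pi ^ 2 * (a : ℝ) ^ 2 / n ^ 2 ≤ 2 * 10 * (n ^ 2 / t) / n ^ 2 := by gcongr
        _ = 20 / t := by field_simp; norm_num
    rw [torusEigenvalue_eq hd]
    constructor
    · rw [le_inv_mul_iff₀ hd0]
      calc (d : ℝ) * (1 / (2 * t)) = ∑ _i : Fin d, 1 / (2 * t) := by simp
        _ ≤ _ := Finset.sum_le_sum fun i _ => hlow i
    · rw [inv_mul_le_iff₀ hd0]
      calc ∑ i, cosGap (k i) ≤ ∑ _i : Fin d, 20 / t := Finset.sum_le_sum fun i _ => hup i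
        _ = d * (20 / t) := by simp

/-- The constant of the lower bounds of energy and variance. -/
noncomputable def lowerConst (d : ℕ) : ℝ := ((4 : ℝ) ^ d)⁻¹ * Real.exp (-40) / (2 * d)

lemma lowerConst_pos (hd : 1 ≤ d) : 0 < lowerConst d := by
  have hd0 : (0 : ℝ) < d := by exact_mod_cast hd
  unfold lowerConst; positivity

lemma lowerConst_mul_le (hd : 1 ≤ d) : lowerConst d * (2 * d) ≤ 1 := by
  have hd0 : (0 : ℝ) < d := by exact_mod_cast hd
  have h1 : ((4 : ℝ) ^ d)⁻¹ ≤ 1 := inv_le_one_of_one_le₀ (one_le_pow₀ (by norm_num))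
  have h2 : Real.exp (-40) ≤ 1 := by rw [Real.exp_le_one_iff]; norm_num
  unfold lowerConst
  rw [div_mul_cancel₀ _ (by positivity)]
  exact mul_le_one₀ h1 (Real.exp_pos _).le h2

omit [NeZero n] in
lemma natCast_sq_rpow (p : ℕ) : ((n : ℝ) ^ 2) ^ ((p : ℝ) / 2) = (n : ℝ) ^ p := by
  rw [← Real.rpow_natCast, ← Real.rpow_mul (by positivity), ← Real.rpow_natCast (n : ℝ) p]
  congr 1; push_cast; ring

/-- The lower bounds of energy and variance: up to time `n²` there are sufficiently many small
eigenvalues, and afterwards a frequency with the smallest eigenvalue suffices. -/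
lemma spectral_lower_bound (hd : 1 ≤ d) (hn : 3 ≤ n) {h : ℝ → Torus d n → ℝ}
    (H : IsSpectralSystem torusEigenvalue ((n : ℝ) ^ d) h) {t : ℝ} (ht : 4 ≤ t) :
    lowerConst d / min (t ^ ((d : ℝ) / 2 + 1)) ((n : ℝ) ^ (d + 2)) *
      Real.exp (-(2 * cycleGap n / d) * t) ≤ spectralEnergy torusEigenvalue ((n : ℝ) ^ d) h t ∧
    lowerConst d / min (t ^ ((d : ℝ) / 2)) ((n : ℝ) ^ d) *
      Real.exp (-(2 * cycleGap n / d) * t) ≤ spectralVariance 0 ((n : ℝ) ^ d) h t := by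
  have hn0 := natCast_pos_of_neZero (n := n)
  have hd0 : (0 : ℝ) < d := by exact_mod_cast hd
  have hd1 : (1 : ℝ) ≤ d := by exact_mod_cast hd
  have ht0 : 0 < t := by linarith
  have hN : (0 : ℝ) < (n : ℝ) ^ d := by positivity
  have hlc := lowerConst_pos hd
  have hlc1 := lowerConst_mul_le hd
  have hlc2 : lowerConst d ≤ 1 := by nlinarith
  have hg := cycleGap_pos hn
  have hexp : Real.exp (-(2 * cycleGap n / d) * t) ≤ 1 := by
    rw [Real.exp_le_one_iff]
    have : 0 ≤ 2 * cycleGap n / d * t := by positivity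
    linarith
  have hene : ∀ B : Finset (Torus d n), ((n : ℝ) ^ d)⁻¹ * ∑ k ∈ B, torusEigenvalue k *
      Real.exp (-(2 * torusEigenvalue k) * t) ≤ spectralEnergy torusEigenvalue ((n : ℝ) ^ d) h t := by
    intro B
    refine mul_le_mul_of_nonneg_left ?_ (by positivity)
    refine (Finset.sum_le_sum fun k _ => mul_le_mul_of_nonneg_left (H.exp_le hN k ht0.le)
      (torusEigenvalue_nonneg hd k)).trans ?_
    exact Finset.sum_le_sum_of_subset_of_nonneg (Finset.subset_univ _) fun k _ _ =>
      mul_nonneg (torusEigenvalue_nonneg hd k) (H.nonneg t ht0.le k)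
  have hvar : ∀ B : Finset (Torus d n), (∀ k ∈ B, k ≠ 0) → ((n : ℝ) ^ d)⁻¹ * ∑ k ∈ B,
      Real.exp (-(2 * torusEigenvalue k) * t) ≤ spectralVariance 0 ((n : ℝ) ^ d) h t := by
    intro B hB
    refine mul_le_mul_of_nonneg_left ?_ (by positivity)
    refine (Finset.sum_le_sum fun k _ => H.exp_le hN k ht0.le).trans ?_
    exact Finset.sum_le_sum_of_subset_of_nonneg
      (fun k hk => Finset.mem_erase.2 ⟨hB k hk, Finset.mem_univ _⟩)
      fun k _ _ => H.nonneg t ht0.le k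
  rcases le_or_gt t ((n : ℝ) ^ 2) with htn | htn
  · obtain ⟨B, hBc, hB⟩ := exists_finset_torusEigenvalue (n := n) hd ht htn
    have hB0 : ∀ k ∈ B, k ≠ 0 := by
      rintro k hk rfl
      have := (hB 0 hk).1
      rw [torusEigenvalue_zero hd] at this
      have : 0 < 1 / (2 * t) := by positivity
      linarith
    have hexp40 : ∀ k ∈ B, Real.exp (-40) ≤ Real.exp (-(2 * torusEigenvalue k) * t) := by
      intro k hk
      have h1 := (hB k hk).2
      rw [le_div_iff₀ ht0] at h1
      rw [Real.exp_le_exp]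
      linarith
    have hs : (√t) ^ d = t ^ ((d : ℝ) / 2) := by
      rw [Real.sqrt_eq_rpow, ← Real.rpow_natCast, ← Real.rpow_mul ht0.le]
      congr 1; ring
    have hp : 0 < t ^ ((d : ℝ) / 2) := Real.rpow_pos_of_pos ht0 _
    have hcardB : ((n : ℝ) ^ d)⁻¹ * B.card ≥ ((4 : ℝ) ^ d)⁻¹ / t ^ ((d : ℝ) / 2) := by
      calc ((4 : ℝ) ^ d)⁻¹ / t ^ ((d : ℝ) / 2) = ((n : ℝ) ^ d)⁻¹ * ((n : ℝ) / (4 * √t)) ^ d := by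
            rw [div_pow, mul_pow, hs]; field_simp
        _ ≤ _ := by gcongr
    have hmin0 : min (t ^ ((d : ℝ) / 2)) ((n : ℝ) ^ d) = t ^ ((d : ℝ) / 2) := by
      refine min_eq_left ?_
      rw [← natCast_sq_rpow]
      exact Real.rpow_le_rpow ht0.le htn (by positivity)
    have hmin1 : min (t ^ ((d : ℝ) / 2 + 1)) ((n : ℝ) ^ (d + 2)) = t ^ ((d : ℝ) / 2 + 1) := by
      refine min_eq_left ?_
      rw [← natCast_sq_rpow, show (((d + 2 : ℕ) : ℝ)) / 2 = (d : ℝ) / 2 + 1 by push_cast; ring]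
      exact Real.rpow_le_rpow ht0.le htn (by positivity)
    constructor
    · refine le_trans ?_ (hene B)
      rw [hmin1, Real.rpow_add ht0, Real.rpow_one]
      have h1 : ∑ k ∈ B, 1 / (2 * t) * Real.exp (-40) ≤
          ∑ k ∈ B, torusEigenvalue k * Real.exp (-(2 * torusEigenvalue k) * t) :=
        Finset.sum_le_sum fun k hk => mul_le_mul (hB k hk).1 (hexp40 k hk) (Real.exp_pos _).le
          (torusEigenvalue_nonneg hd k)
      rw [Finset.sum_const, nsmul_eq_mul] at h1
      calc lowerConst d / (t ^ ((d : ℝ) / 2) * t) * Real.exp (-(2 * cycleGap n / d) * t)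
          ≤ lowerConst d / (t ^ ((d : ℝ) / 2) * t) * 1 := by gcongr
        _ = ((4 : ℝ) ^ d)⁻¹ / t ^ ((d : ℝ) / 2) * (1 / (2 * t) * Real.exp (-40)) / d := by
            unfold lowerConst; field_simp
        _ ≤ ((4 : ℝ) ^ d)⁻¹ / t ^ ((d : ℝ) / 2) * (1 / (2 * t) * Real.exp (-40)) :=
            div_le_self (by positivity) hd1
        _ ≤ ((n : ℝ) ^ d)⁻¹ * B.card * (1 / (2 * t) * Real.exp (-40)) := by gcongr
        _ ≤ _ := by rw [mul_assoc]; gcongr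
    · refine le_trans ?_ (hvar B hB0)
      rw [hmin0]
      have h1 : ∑ k ∈ B, Real.exp (-40) ≤ ∑ k ∈ B, Real.exp (-(2 * torusEigenvalue k) * t) :=
        Finset.sum_le_sum fun k hk => hexp40 k hk
      rw [Finset.sum_const, nsmul_eq_mul] at h1
      calc lowerConst d / t ^ ((d : ℝ) / 2) * Real.exp (-(2 * cycleGap n / d) * t)
          ≤ lowerConst d / t ^ ((d : ℝ) / 2) * 1 := by gcongr
        _ = ((4 : ℝ) ^ d)⁻¹ / t ^ ((d : ℝ) / 2) * Real.exp (-40) / (2 * d) := by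
            unfold lowerConst; field_simp
        _ ≤ ((4 : ℝ) ^ d)⁻¹ / t ^ ((d : ℝ) / 2) * Real.exp (-40) :=
            div_le_self (by positivity) (by linarith)
        _ ≤ ((n : ℝ) ^ d)⁻¹ * B.card * Real.exp (-40) := by gcongr
        _ ≤ _ := by rw [mul_assoc]; gcongr
  · set k₁ : Torus d n := Pi.single ⟨0, hd⟩ 1 with hk₁
    have hmem : k₁ ∈ torusAxes d n :=
      Finset.mem_image.2 ⟨(⟨0, hd⟩, true), Finset.mem_univ _, by simp [hk₁]⟩
    have hk0 : k₁ ≠ 0 := by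
      rw [hk₁]; simpa [Pi.single_eq_zero_iff] using one_ne_zero_zmod hn
    have hlam := torusEigenvalue_of_mem_torusAxes hd hn hmem
    have h1 := hene {k₁}
    have h2 := hvar {k₁} (by simpa using hk0)
    rw [Finset.sum_singleton, hlam, show -(2 * (cycleGap n / d)) * t =
      -(2 * cycleGap n / d) * t by ring] at h1 h2
    have hmin0 : min (t ^ ((d : ℝ) / 2)) ((n : ℝ) ^ d) = (n : ℝ) ^ d := by
      refine min_eq_right ?_
      rw [← natCast_sq_rpow]
      exact Real.rpow_le_rpow (by positivity) htn.le (by positivity)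
    have hmin1 : min (t ^ ((d : ℝ) / 2 + 1)) ((n : ℝ) ^ (d + 2)) = (n : ℝ) ^ (d + 2) := by
      refine min_eq_right ?_
      rw [← natCast_sq_rpow, show (((d + 2 : ℕ) : ℝ)) / 2 = (d : ℝ) / 2 + 1 by push_cast; ring]
      exact Real.rpow_le_rpow (by positivity) htn.le (by positivity)
    rw [hmin0, hmin1]
    constructor
    · refine le_trans ?_ h1
      rw [← mul_assoc]
      refine mul_le_mul_of_nonneg_right ?_ (Real.exp_pos _).le
      have h3 := le_cycleGap (n := n) hn
      have h4 : lowerConst d ≤ 8 / d := by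
        rw [le_div_iff₀ hd0]
        linarith
      calc lowerConst d / (n : ℝ) ^ (d + 2) ≤ 8 / d / (n : ℝ) ^ (d + 2) := by gcongr
        _ = ((n : ℝ) ^ d)⁻¹ * (8 / (n : ℝ) ^ 2 / d) := by rw [pow_add]; field_simp
        _ ≤ _ := by gcongr
    · refine le_trans ?_ h2
      refine mul_le_mul_of_nonneg_right ?_ (Real.exp_pos _).le
      rw [div_eq_mul_inv]
      exact mul_le_of_le_one_left (by positivity) hlc2

lemma measurable_smoothingUpdate {S : Type*} [Fintype S] [DecidableEq S] (p : S → S → ℝ) (k : S) :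
    Measurable (smoothingUpdate p k) := by
  refine Continuous.measurable ?_
  unfold smoothingUpdate
  refine (PiLp.continuous_toLp 2 _).comp (continuous_pi fun j => ?_)
  split_ifs <;> fun_prop

/-- The second moments of the Fourier coefficients of the smoothing process. -/
lemma exists_isSpectralSystem (hd : 1 ≤ d) (hn : 3 ≤ n) (i : Torus d n) :
    ∃ h : ℝ → Torus d n → ℝ, IsSpectralSystem torusEigenvalue ((n : ℝ) ^ d) h ∧
      ∀ (t : ℝ≥0) (k : Torus d n), ∫⁻ z, ENNReal.ofReal (Complex.normSq (torusFourier z k))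
        ∂(clockLaw (smoothingUpdate (torusWalk d n)) t (Measure.dirac (EuclideanSpace.single i 1))) =
          ENNReal.ofReal (h t k) := by
  let f : EuclideanSpace ℝ (Torus d n) → Torus d n → ℝ :=
    fun z k => Complex.normSq (torusFourier z k)
  have hf : Measurable f := by
    refine Continuous.measurable ?_
    simp only [f, torusFourier]
    refine continuous_pi fun k => Complex.continuous_normSq.comp ?_
    fun_prop
  let T₀ : (Torus d n → ℝ) →ₗ[ℝ] (Torus d n → ℝ) :=
    { toFun := fun v k => ((n : ℝ) ^ d - 2 * torusEigenvalue k) * v k +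
        ((n : ℝ) ^ d)⁻¹ * ∑ j, torusEigenvalue j ^ 2 * v j
      map_add' := by
        intro v w
        funext k
        simp only [Pi.add_apply, mul_add, Finset.sum_add_distrib]
        ring
      map_smul' := by
        intro c v
        funext k
        have : ∑ j, torusEigenvalue j ^ 2 * (c * v j) =
            c * ∑ j, torusEigenvalue j ^ 2 * v j := by
          rw [Finset.mul_sum]
          exact Finset.sum_congr rfl fun j _ => by ring
        simp only [Pi.smul_apply, smul_eq_mul, RingHom.id_apply, this]
        ring }
  let T := LinearMap.toContinuousLinearMap T₀
  have hT : ∀ z, ∑ l, f (smoothingUpdate (torusWalk d n) l z) = T (f z) := by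
    intro z
    funext k
    rw [Finset.sum_apply]
    exact sum_normSq_torusFourier_smoothingUpdate hd hn z k
  obtain ⟨F, hF0, hF1, hF2⟩ := exists_hasDerivAt_lintegral_clockLaw_dirac
    (measurable_smoothingUpdate (torusWalk d n)) hf (fun z k => Complex.normSq_nonneg _) T hT
    (EuclideanSpace.single i 1)
  refine ⟨F, ⟨fun k => ?_, fun t k => ?_, fun t ht k => (hF2 ⟨t, ht⟩ k).1⟩,
    fun t k => (hF2 t k).2⟩
  · rw [hF0]
    simp only [f]
    have : torusFourier (EuclideanSpace.single i (1 : ℝ)) k = torusChar k i := by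
      rw [torusFourier, Finset.sum_eq_single i]
      · simp
      · intro j _ hj; simp [hj]
      · simp
    rw [this, normSq_torusChar]
  · refine ((hasDerivAt_pi.1 (hF1 t)) k).congr_deriv ?_
    rw [card_torus]
    change ((n : ℝ) ^ d - 2 * torusEigenvalue k) * F t k +
      ((n : ℝ) ^ d)⁻¹ * ∑ j, torusEigenvalue j ^ 2 * F t j - (n : ℝ) ^ d * F t k = _
    ring

end TorusBounds

/-! ### Duality of the potlatch and the smoothing process -/

section Duality

variable {S : Type*} [Fintype S] [DecidableEq S] (p : S → S → ℝ)

/-- The pairing `∑ⱼ xⱼ yⱼ` of configurations. -/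
def pairing {S : Type*} [Fintype S] (x y : EuclideanSpace ℝ S) : ℝ := ∑ j, x j * y j

lemma pairing_potlatchUpdate (k : S) (x y : EuclideanSpace ℝ S) :
    pairing (potlatchUpdate p k x) y = pairing x (smoothingUpdate p k y) := by
  have e1 : ∀ j, potlatchUpdate p k x j * y j =
      x k * (p k j * y j) + if j = k then 0 else x j * y j := by
    intro j
    by_cases h : j = k
    · subst h; simp [potlatchUpdate]; ring
    · simp [potlatchUpdate, h]; ring
  have e2 : ∀ j, x j * smoothingUpdate p k y j =
      (if j = k then x k * ∑ l, p k l * y l else 0) + if j = k then 0 else x j * y j := by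
    intro j
    by_cases h : j = k
    · subst h; simp [smoothingUpdate]
    · simp [smoothingUpdate, h]
  simp only [pairing, e1, e2, Finset.sum_add_distrib]
  rw [← Finset.mul_sum]
  simp

lemma potlatchUpdate_sub (k : S) (x y : EuclideanSpace ℝ S) :
    potlatchUpdate p k (x - y) = potlatchUpdate p k x - potlatchUpdate p k y := by
  ext j
  by_cases h : j = k <;> simp [potlatchUpdate, h] <;> ring

lemma potlatchUpdate_smul (k : S) (c : ℝ) (x : EuclideanSpace ℝ S) :
    potlatchUpdate p k (c • x) = c • potlatchUpdate p k x := by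
  ext j
  by_cases h : j = k <;> simp [potlatchUpdate, h] <;> ring

lemma continuous_potlatchUpdate (k : S) : Continuous (potlatchUpdate p k) := by
  unfold potlatchUpdate
  refine (PiLp.continuous_toLp 2 _).comp (continuous_pi fun j => ?_)
  split_ifs <;> fun_prop

lemma measurable_potlatchUpdate (k : S) : Measurable (potlatchUpdate p k) :=
  (continuous_potlatchUpdate p k).measurable

omit [DecidableEq S] in
lemma measurable_pairing_sq : Measurable (Function.uncurry fun x y : EuclideanSpace ℝ S =>
    ENNReal.ofReal (pairing x y ^ 2)) := by
  unfold pairing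
  refine (ENNReal.continuous_ofReal.comp ?_).measurable
  fun_prop

lemma pairing_single (x : EuclideanSpace ℝ S) (i : S) :
    pairing x (EuclideanSpace.single i 1) = x i := by
  rw [pairing, Finset.sum_eq_single i]
  · simp
  · intro j _ hj; simp [hj]
  · simp

/-- The second moment of a coordinate of the potlatch process is expressed by the smoothing process
started from a unit mass. -/
lemma lintegral_potlatch_sq (i : S) (t : ℝ≥0) (μ : Measure (EuclideanSpace ℝ S))
    [IsFiniteMeasure μ] :
    ∫⁻ x, ENNReal.ofReal (x i ^ 2) ∂(clockLaw (potlatchUpdate p) t μ) =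
      ∫⁻ x, ∫⁻ y, ENNReal.ofReal (pairing x y ^ 2)
        ∂(clockLaw (smoothingUpdate p) t (Measure.dirac (EuclideanSpace.single i 1))) ∂μ := by
  rw [← lintegral_lintegral_clockLaw (measurable_potlatchUpdate p) (measurable_smoothingUpdate p)
    measurable_pairing_sq (fun k x y => by rw [pairing_potlatchUpdate])]
  refine lintegral_congr fun x => ?_
  rw [lintegral_dirac' (f := fun y => ENNReal.ofReal (pairing x y ^ 2)) _
    (measurable_pairing_sq.comp measurable_prodMk_left), pairing_single]

end Duality

/-! ### Couplings by common clocks -/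

section CoupledLaw

variable {ι Z Z' : Type*} [Fintype ι] [MeasurableSpace Z] [MeasurableSpace Z']

/-- A set which is invariant under all updates is invariant under the dynamics. -/
lemma clockLaw_compl_eq_zero {u : ι → Z → Z} (hu : ∀ i, Measurable (u i)) {A : Set Z}
    (hA : MeasurableSet A) (h : ∀ i z, z ∈ A → u i z ∈ A) {μ : Measure Z} (hμ : μ Aᶜ = 0)
    (t : ℝ≥0) : clockLaw u t μ Aᶜ = 0 ∧ ∀ m, (ringOp u)^[m] μ Aᶜ = 0 := by
  have key : ∀ m, (ringOp u)^[m] μ Aᶜ = 0 := by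
    intro m
    induction m with
    | zero => exact hμ
    | succ m ih =>
      rw [Function.iterate_succ_apply', ringOp_apply hu _ hA.compl]
      refine Finset.sum_eq_zero fun i _ => measure_mono_null ?_ ih
      intro z hz hzA
      exact hz (h i z hzA)
  refine ⟨?_, key⟩
  rw [clockLaw_apply _ _ _ hA.compl]
  simp [key]

/-- A component which is not affected by the rings remains independent of the process. -/
lemma clockLaw_prod_right {u : ι → Z → Z} (hu : ∀ i, Measurable (u i)) (ρ : Measure Z')
    [IsFiniteMeasure ρ] (ν : Measure Z) [IsFiniteMeasure ν] (t : ℝ≥0) :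
    clockLaw (fun i (q : Z' × Z) => (q.1, u i q.2)) t (ρ.prod ν) = ρ.prod (clockLaw u t ν) := by
  have hu' : ∀ i, Measurable fun q : Z' × Z => (q.1, u i q.2) := fun i =>
    measurable_fst.prodMk ((hu i).comp measurable_snd)
  have hfin : ∀ m, IsFiniteMeasure ((ringOp u)^[m] ν) := by
    intro m
    refine ⟨?_⟩
    rw [ringOp_iterate_univ hu]
    exact ENNReal.mul_lt_top (by simp) (measure_lt_top _ _)
  have hit : ∀ m, (ringOp fun i (q : Z' × Z) => (q.1, u i q.2))^[m] (ρ.prod ν) =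
      ρ.prod ((ringOp u)^[m] ν) := by
    intro m
    induction m with
    | zero => rfl
    | succ m ih =>
      have := hfin m
      have := hfin (m + 1)
      rw [Function.iterate_succ_apply', ih]
      refine (Measure.prod_eq fun s r hs hr => ?_).symm
      rw [ringOp_apply hu' _ (hs.prod hr), Function.iterate_succ_apply', ringOp_apply hu _ hr,
        Finset.mul_sum]
      refine Finset.sum_congr rfl fun i _ => ?_
      rw [← Measure.prod_prod]
      rfl
  have : IsFiniteMeasure (clockLaw u t ν) := by
    refine ⟨?_⟩
    rw [clockLaw_apply _ _ _ MeasurableSet.univ]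
    simp only [ringOp_iterate_univ hu, ← mul_assoc]
    rw [ENNReal.tsum_mul_right, tsum_ofReal_ringWeight_mul_card_pow]
    simp
  refine (Measure.prod_eq fun s r hs hr => ?_).symm
  rw [clockLaw_apply _ _ _ (hs.prod hr), clockLaw_apply _ _ _ hr, ← ENNReal.tsum_mul_left]
  refine tsum_congr fun m => ?_
  have := hfin m
  rw [hit, Measure.prod_prod, mul_left_comm]

/-- The law of two copies of a clock-driven process which use the same clocks. -/
noncomputable def coupledLaw (u : ι → Z → Z) (t : ℝ≥0) (π : Measure (Z × Z)) : Measure (Z × Z) :=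
  clockLaw (fun i q => (u i q.1, u i q.2)) t π

omit [Fintype ι] in
lemma measurable_coupled {u : ι → Z → Z} (hu : ∀ i, Measurable (u i)) (i : ι) :
    Measurable fun q : Z × Z => (u i q.1, u i q.2) :=
  ((hu i).comp measurable_fst).prodMk ((hu i).comp measurable_snd)

lemma coupledLaw_map_fst {u : ι → Z → Z} (hu : ∀ i, Measurable (u i)) (t : ℝ≥0)
    (π : Measure (Z × Z)) : (coupledLaw u t π).map Prod.fst = clockLaw u t (π.map Prod.fst) :=
  map_clockLaw (measurable_coupled hu) hu measurable_fst (fun _ _ => rfl) t π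

lemma coupledLaw_map_snd {u : ι → Z → Z} (hu : ∀ i, Measurable (u i)) (t : ℝ≥0)
    (π : Measure (Z × Z)) : (coupledLaw u t π).map Prod.snd = clockLaw u t (π.map Prod.snd) :=
  map_clockLaw (measurable_coupled hu) hu measurable_snd (fun _ _ => rfl) t π

lemma isProbabilityMeasure_coupledLaw {u : ι → Z → Z} (hu : ∀ i, Measurable (u i)) (t : ℝ≥0)
    (π : Measure (Z × Z)) [IsProbabilityMeasure π] : IsProbabilityMeasure (coupledLaw u t π) :=
  isProbabilityMeasure_clockLaw (measurable_coupled hu) t π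

end CoupledLaw

section PotlatchCoupling

variable {S : Type*} [Fintype S] [DecidableEq S] (p : S → S → ℝ)

/-- The mean square distance of two potlatch processes using the same clocks. -/
lemma lintegral_coupledLaw_sq (i : S) (t : ℝ≥0)
    (π : Measure (EuclideanSpace ℝ S × EuclideanSpace ℝ S)) [IsProbabilityMeasure π] :
    ∫⁻ q, ENNReal.ofReal ((q.1 i - q.2 i) ^ 2) ∂(coupledLaw (potlatchUpdate p) t π) =
      ∫⁻ y, ∫⁻ q, ENNReal.ofReal (pairing (q.1 - q.2) y ^ 2) ∂π
        ∂(clockLaw (smoothingUpdate p) t (Measure.dirac (EuclideanSpace.single i 1))) := by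
  have hu := measurable_potlatchUpdate p
  have hD : Measurable fun q : EuclideanSpace ℝ S × EuclideanSpace ℝ S => q.1 - q.2 := by fun_prop
  have hp := isProbabilityMeasure_clockLaw (measurable_smoothingUpdate p) t
    (Measure.dirac (EuclideanSpace.single i (1 : ℝ)))
  have h1 := map_clockLaw (measurable_coupled hu) hu hD
    (fun k q => (potlatchUpdate_sub p k q.1 q.2).symm) t π
  have hm : Measurable fun x : EuclideanSpace ℝ S => ENNReal.ofReal (x i ^ 2) :=
    (ENNReal.continuous_ofReal.comp (by fun_prop)).measurable
  have := Measure.isProbabilityMeasure_map (μ := π) hD.aemeasurable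
  calc _ = ∫⁻ x, ENNReal.ofReal (x i ^ 2) ∂((coupledLaw (potlatchUpdate p) t π).map
        fun q => q.1 - q.2) := by rw [lintegral_map hm hD]; rfl
    _ = ∫⁻ x, ENNReal.ofReal (x i ^ 2) ∂(clockLaw (potlatchUpdate p) t
        (π.map fun q => q.1 - q.2)) := by rw [coupledLaw, h1]
    _ = _ := by
        rw [lintegral_potlatch_sq, lintegral_map
          (f := fun x => ∫⁻ y, ENNReal.ofReal (pairing x y ^ 2) ∂(clockLaw (smoothingUpdate p) t (Measure.dirac (EuclideanSpace.single i 1))))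
          measurable_pairing_sq.lintegral_prod_right' hD]
        exact lintegral_lintegral_swap
          (measurable_pairing_sq.comp (hD.prodMap measurable_id)).aemeasurable

end PotlatchCoupling

/-! ### Wasserstein distance and weak convergence -/

section Wasserstein

variable {S : Type*} [Fintype S]

lemma edist_sq_eq (x y : EuclideanSpace ℝ S) :
    edist x y ^ 2 = ∑ i, ENNReal.ofReal ((x i - y i) ^ 2) := by
  rw [edist_dist, ← ENNReal.ofReal_pow dist_nonneg, EuclideanSpace.dist_eq,
    Real.sq_sqrt (Finset.sum_nonneg fun i _ => sq_nonneg _),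
    ENNReal.ofReal_sum_of_nonneg fun i _ => sq_nonneg _]
  simp only [Real.dist_eq, sq_abs]

lemma lintegral_edist_sq_le {π : Measure (EuclideanSpace ℝ S × EuclideanSpace ℝ S)} {c : ℝ}
    (hc : ∀ i, ∫⁻ q, ENNReal.ofReal ((q.1 i - q.2 i) ^ 2) ∂π ≤ ENNReal.ofReal c) :
    ∫⁻ q, edist q.1 q.2 ^ 2 ∂π ≤ ENNReal.ofReal (Fintype.card S * c) := by
  simp only [edist_sq_eq]
  have hm : ∀ i : S, Measurable fun q : EuclideanSpace ℝ S × EuclideanSpace ℝ S =>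
      ENNReal.ofReal ((q.1 i - q.2 i) ^ 2) := fun i =>
    (ENNReal.continuous_ofReal.comp (by fun_prop)).measurable
  rw [lintegral_finsetSum _ fun i _ => hm i]
  refine (Finset.sum_le_sum fun i _ => hc i).trans ?_
  rw [Finset.sum_const, nsmul_eq_mul, ENNReal.ofReal_mul (by positivity), ENNReal.ofReal_natCast,
    Finset.card_univ]

lemma wasserstein2_le {E : Type*} [PseudoEMetricSpace E] [MeasurableSpace E] {π : Measure (E × E)}
    {c : ℝ≥0∞} (h : ∫⁻ q, edist q.1 q.2 ^ 2 ∂π ≤ c) :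
    wasserstein2 (π.map Prod.fst) (π.map Prod.snd) ≤ c ^ (1 / 2 : ℝ) :=
  ENNReal.rpow_le_rpow ((iInf₂_le π ⟨rfl, rfl⟩).trans h) (by norm_num)

lemma wasserstein2_apply_le {π : Measure (EuclideanSpace ℝ S × EuclideanSpace ℝ S)} {c : ℝ≥0∞}
    {i : S} (h : ∫⁻ q, ENNReal.ofReal ((q.1 i - q.2 i) ^ 2) ∂π ≤ c) :
    wasserstein2 ((π.map Prod.fst).map fun x => x i) ((π.map Prod.snd).map fun x => x i) ≤
      c ^ (1 / 2 : ℝ) := by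
  have hi : Measurable fun x : EuclideanSpace ℝ S => x i := Continuous.measurable (by fun_prop)
  have hpair : Measurable fun q : EuclideanSpace ℝ S × EuclideanSpace ℝ S => (q.1 i, q.2 i) :=
    (hi.comp measurable_fst).prodMk (hi.comp measurable_snd)
  have e1 : (π.map Prod.fst).map (fun x => x i) = (π.map fun q => (q.1 i, q.2 i)).map Prod.fst := by
    rw [Measure.map_map hi measurable_fst, Measure.map_map measurable_fst hpair]; rfl
  have e2 : (π.map Prod.snd).map (fun x => x i) = (π.map fun q => (q.1 i, q.2 i)).map Prod.snd := by
    rw [Measure.map_map hi measurable_snd, Measure.map_map measurable_snd hpair]; rfl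
  rw [e1, e2]
  refine wasserstein2_le ?_
  rw [lintegral_map (Continuous.measurable (by fun_prop)) hpair]
  refine le_trans (le_of_eq (lintegral_congr fun q => ?_)) h
  rw [edist_dist, ← ENNReal.ofReal_pow dist_nonneg, Real.dist_eq, sq_abs]

/-- The marginals of a coupling are close in the bounded Lipschitz sense. -/
lemma abs_integral_sub_le {π : Measure (EuclideanSpace ℝ S × EuclideanSpace ℝ S)}
    [IsProbabilityMeasure π] {c : ℝ} (hc : 0 < c)
    (h : ∫⁻ q, edist q.1 q.2 ^ 2 ∂π ≤ ENNReal.ofReal c) {f : EuclideanSpace ℝ S → ℝ} {B : ℝ}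
    (hB : ∀ x y, dist (f x) (f y) ≤ B) {L : ℝ≥0} (hL : LipschitzWith L f) :
    |∫ x, f x ∂(π.map Prod.fst) - ∫ x, f x ∂(π.map Prod.snd)| ≤ L * √c := by
  have hf : Continuous f := hL.continuous
  have hint : ∀ {φ : EuclideanSpace ℝ S × EuclideanSpace ℝ S → EuclideanSpace ℝ S},
      Continuous φ → Integrable (fun q => f (φ q)) π := by
    intro φ hφ
    refine Integrable.of_bound (C := |f 0| + B)
      (hf.comp hφ).aestronglyMeasurable (Eventually.of_forall fun q => ?_)
    have h1 := hB (φ q) 0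
    rw [Real.dist_eq] at h1
    have h2 := abs_sub_abs_le_abs_sub (f (φ q)) (f 0)
    rw [Real.norm_eq_abs]
    linarith
  rw [integral_map measurable_fst.aemeasurable hf.aestronglyMeasurable,
    integral_map measurable_snd.aemeasurable hf.aestronglyMeasurable,
    ← integral_sub (hint continuous_fst) (hint continuous_snd)]
  have hd : ∀ q : EuclideanSpace ℝ S × EuclideanSpace ℝ S,
      edist q.1 q.2 ^ 2 = ENNReal.ofReal (dist q.1 q.2 ^ 2) := fun q => by
    rw [edist_dist, ENNReal.ofReal_pow dist_nonneg]
  simp only [hd] at h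
  have hdc : Continuous fun q : EuclideanSpace ℝ S × EuclideanSpace ℝ S => dist q.1 q.2 ^ 2 := by
    fun_prop
  have hdi : Integrable
      (fun q : EuclideanSpace ℝ S × EuclideanSpace ℝ S => dist q.1 q.2 ^ 2) π := by
    refine ⟨hdc.aestronglyMeasurable, ?_⟩
    rw [hasFiniteIntegral_iff_ofReal (Eventually.of_forall fun q => sq_nonneg _)]
    exact h.trans_lt ENNReal.ofReal_lt_top
  have hle : ∫ q, dist q.1 q.2 ^ 2 ∂π ≤ c := by
    rw [integral_eq_lintegral_of_nonneg_ae (Eventually.of_forall fun q => sq_nonneg _)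
      hdc.aestronglyMeasurable]
    exact ENNReal.toReal_le_of_le_ofReal hc.le h
  have hs : 0 < √c := Real.sqrt_pos.2 hc
  have hss : √c * √c = c := Real.mul_self_sqrt hc.le
  calc |∫ q, f q.1 - f q.2 ∂π| ≤ ∫ q, |f q.1 - f q.2| ∂π := abs_integral_le_integral_abs
    _ ≤ ∫ q, L * (dist q.1 q.2 ^ 2 * (1 / (2 * √c)) + √c / 2) ∂π := by
        -- the tangent line of the square root at `c` replaces the Cauchy-Schwarz inequality
        refine integral_mono ((hint continuous_fst).sub (hint continuous_snd)).abs
          (((hdi.mul_const _).add (integrable_const _)).const_mul _) fun q => ?_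
        have h1 := hL.dist_le_mul q.1 q.2
        rw [Real.dist_eq] at h1
        refine h1.trans (mul_le_mul_of_nonneg_left ?_ L.2)
        have h2 : dist q.1 q.2 ^ 2 * (1 / (2 * √c)) + √c / 2 - dist q.1 q.2 =
            (dist q.1 q.2 - √c) ^ 2 / (2 * √c) := by field_simp; ring
        have h3 : 0 ≤ (dist q.1 q.2 - √c) ^ 2 / (2 * √c) := by positivity
        linarith
    _ = L * ((∫ q, dist q.1 q.2 ^ 2 ∂π) * (1 / (2 * √c)) + √c / 2) := by
        rw [integral_const_mul, integral_add (hdi.mul_const _) (integrable_const _),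
          integral_mul_const]
        simp
    _ ≤ L * (c * (1 / (2 * √c)) + √c / 2) := by gcongr
    _ = L * √c := by
        congr 1
        nth_rewrite 1 [← hss]
        field_simp
        ring

end Wasserstein

/-! ### Weak continuity of the clock law -/

section Feller

variable {ι Z : Type*} [Fintype ι] [MeasurableSpace Z] [TopologicalSpace Z] [OpensMeasurableSpace Z]

/-- The Feller property: if the maps `u i` are continuous, then the clock law depends continuously
on the initial law. -/
lemma tendsto_clockLaw {u : ι → Z → Z} (hu : ∀ i, Measurable (u i)) (hc : ∀ i, Continuous (u i))
    {μ : ℕ → ProbabilityMeasure Z} {ν : ProbabilityMeasure Z} (h : Tendsto μ atTop (𝓝 ν))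
    (t : ℝ≥0) :
    Tendsto (β := ProbabilityMeasure Z)
      (fun m => ⟨clockLaw u t (μ m), isProbabilityMeasure_clockLaw hu t _⟩) atTop
      (𝓝 ⟨clockLaw u t ν, isProbabilityMeasure_clockLaw hu t _⟩) := by
  rw [ProbabilityMeasure.tendsto_iff_forall_lintegral_tendsto] at h
  have hit : ∀ (j : ℕ) (f : BoundedContinuousFunction Z ℝ≥0),
      Tendsto (fun m => ∫⁻ z, (f z : ℝ≥0∞) ∂((ringOp u)^[j] (μ m : Measure Z))) atTop
        (𝓝 (∫⁻ z, (f z : ℝ≥0∞) ∂((ringOp u)^[j] (ν : Measure Z)))) := by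
    intro j
    induction j with
    | zero => exact h
    | succ j ih =>
      intro f
      have hf : Measurable fun z => (f z : ℝ≥0∞) := f.continuous.measurable.coe_nnreal_ennreal
      simp only [Function.iterate_succ_apply', lintegral_ringOp hu _ hf]
      exact tendsto_finsetSum _ fun i _ => ih (f.compContinuous ⟨u i, hc i⟩)
  refine ProbabilityMeasure.tendsto_iff_forall_lintegral_tendsto.2 fun f => ?_
  change Tendsto (fun m => ∫⁻ z, (f z : ℝ≥0∞) ∂(clockLaw u t (μ m : Measure Z))) atTop
    (𝓝 (∫⁻ z, (f z : ℝ≥0∞) ∂(clockLaw u t (ν : Measure Z))))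
  simp only [lintegral_clockLaw, ← lintegral_count]
  refine tendsto_lintegral_of_dominated_convergence
    (fun j => ENNReal.ofReal (ringWeight ι t j) * ((Fintype.card ι : ℝ≥0∞) ^ j * nndist f 0))
    (fun _ => measurable_of_countable _) (fun m => Eventually.of_forall fun j => ?_) ?_
    (Eventually.of_forall fun j => ?_)
  · refine mul_le_mul_right ?_ _
    calc ∫⁻ z, (f z : ℝ≥0∞) ∂((ringOp u)^[j] (μ m : Measure Z))
        ≤ ∫⁻ _, (nndist f 0 : ℝ≥0∞) ∂((ringOp u)^[j] (μ m : Measure Z)) :=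
          lintegral_mono fun z =>
            ENNReal.coe_le_coe.2 (BoundedContinuousFunction.NNReal.upper_bound f z)
      _ = _ := by
          rw [lintegral_const, ringOp_iterate_univ hu, measure_univ, mul_one, mul_comm]
  · rw [lintegral_count]
    simp only [← mul_assoc]
    rw [ENNReal.tsum_mul_right, tsum_ofReal_ringWeight_mul_card_pow, one_mul]
    exact ENNReal.coe_ne_top
  · exact ENNReal.Tendsto.const_mul (hit j f) (Or.inr ENNReal.ofReal_ne_top)

end Feller

/-! ### The simplex of mass configurations -/

section Simplex

variable (S : Type*) [Fintype S]

/-- The configurations of nonnegative masses with total mass the number of sites. -/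
def massSimplex : Set (EuclideanSpace ℝ S) := {x | (∀ i, 0 ≤ x i) ∧ ∑ i, x i = Fintype.card S}

/-- The configuration of unit masses. -/
noncomputable def unitMasses : EuclideanSpace ℝ S := WithLp.toLp 2 fun _ => 1

lemma unitMasses_mem_massSimplex : unitMasses S ∈ massSimplex S := by
  constructor <;> simp [unitMasses]

variable {S}

lemma isClosed_massSimplex : IsClosed (massSimplex S) := by
  refine IsClosed.inter (s₁ := {x : EuclideanSpace ℝ S | ∀ i, 0 ≤ x i})
    (s₂ := {x : EuclideanSpace ℝ S | ∑ i, x i = Fintype.card S}) ?_ ?_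
  · simp only [Set.ofPred_forall]
    exact isClosed_iInter fun i => isClosed_le continuous_const (by fun_prop)
  · exact isClosed_eq (by fun_prop) continuous_const

lemma le_card_of_mem_massSimplex {x : EuclideanSpace ℝ S} (hx : x ∈ massSimplex S) (i : S) :
    x i ≤ Fintype.card S :=
  hx.2 ▸ Finset.single_le_sum (fun j _ => hx.1 j) (Finset.mem_univ i)

lemma isCompact_massSimplex : IsCompact (massSimplex S) := by
  refine Metric.isCompact_of_isClosed_isBounded isClosed_massSimplex ?_
  refine (Metric.isBounded_iff_subset_closedBall 0).2
    ⟨√(∑ _i : S, (Fintype.card S : ℝ) ^ 2), fun x hx => ?_⟩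
  rw [mem_closedBall_zero_iff, EuclideanSpace.norm_eq]
  refine Real.sqrt_le_sqrt (Finset.sum_le_sum fun i _ => ?_)
  rw [Real.norm_eq_abs, sq_abs]
  exact pow_le_pow_left₀ (hx.1 i) (le_card_of_mem_massSimplex hx i) 2

variable [DecidableEq S] {p : S → S → ℝ}

lemma potlatchUpdate_apply (k i : S) (x : EuclideanSpace ℝ S) :
    potlatchUpdate p k x i = (if i = k then 0 else x i) + p k i * x k := by
  by_cases h : i = k
  · subst h; simp [potlatchUpdate]
  · simp [potlatchUpdate, h]

lemma potlatchUpdate_mem_massSimplex (hp : ∀ i j, 0 ≤ p i j) (hrow : ∀ i, ∑ j, p i j = 1) (k : S)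
    {x : EuclideanSpace ℝ S} (hx : x ∈ massSimplex S) :
    potlatchUpdate p k x ∈ massSimplex S := by
  constructor
  · intro i
    rw [potlatchUpdate_apply]
    have := mul_nonneg (hp k i) (hx.1 k)
    have := hx.1 i
    split_ifs <;> linarith
  · simp only [potlatchUpdate_apply, Finset.sum_add_distrib, ← Finset.sum_mul, hrow]
    rw [← hx.2, ← Finset.add_sum_erase _ _ (Finset.mem_univ k),
      ← Finset.add_sum_erase (a := k) _ (fun i => x i) (Finset.mem_univ k)]
    rw [Finset.sum_congr rfl fun i hi => if_neg (Finset.ne_of_mem_erase hi)]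
    simp

lemma sum_potlatchUpdate_add (i : S) (x : EuclideanSpace ℝ S) :
    ∑ k, potlatchUpdate p k x i + x i = Fintype.card S * x i + ∑ k, p k i * x k := by
  simp only [potlatchUpdate_apply, Finset.sum_add_distrib]
  have : ∑ k, (if i = k then 0 else x i) + x i = Fintype.card S * x i := by
    have h : ∀ k, (if i = k then 0 else x i) = x i - if i = k then x i else 0 := by
      intro k; split_ifs <;> simp
    simp [h]
  linarith

/-- A probability law on the mass simplex under which all masses have mean one. -/
structure IsUnitMeanLaw (ρ : Measure (EuclideanSpace ℝ S)) : Prop where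
  prob : IsProbabilityMeasure ρ
  compl : ρ (massSimplex S)ᶜ = 0
  mean : ∀ i, ∫⁻ x, ENNReal.ofReal (x i) ∂ρ = 1

omit [DecidableEq S] in
lemma isUnitMeanLaw_dirac : IsUnitMeanLaw (Measure.dirac (unitMasses S)) where
  prob := inferInstance
  compl := by
    rw [Measure.dirac_apply' _ isClosed_massSimplex.measurableSet.compl]
    simp [unitMasses_mem_massSimplex S]
  mean i := by
    rw [lintegral_dirac' (f := fun x : EuclideanSpace ℝ S => ENNReal.ofReal (x i)) _
      (ENNReal.continuous_ofReal.comp (by fun_prop)).measurable]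
    simp [unitMasses]

omit [DecidableEq S] in
lemma measurable_ofReal_apply (i : S) :
    Measurable fun x : EuclideanSpace ℝ S => ENNReal.ofReal (x i) :=
  (ENNReal.continuous_ofReal.comp (by fun_prop)).measurable

/-- A doubly stochastic transition matrix preserves unit means. -/
lemma IsUnitMeanLaw.clockLaw_potlatchUpdate {ρ : Measure (EuclideanSpace ℝ S)}
    (H : IsUnitMeanLaw ρ) (hp : ∀ i j, 0 ≤ p i j) (hrow : ∀ i, ∑ j, p i j = 1)
    (hcol : ∀ j, ∑ i, p i j = 1) (t : ℝ≥0) :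
    IsUnitMeanLaw (clockLaw (potlatchUpdate p) t ρ) := by
  have := H.prob
  have hu := measurable_potlatchUpdate p
  have hA := clockLaw_compl_eq_zero hu isClosed_massSimplex.measurableSet
    (fun k x hx => potlatchUpdate_mem_massSimplex hp hrow k hx) H.compl t
  have key : ∀ m i, ∫⁻ x, ENNReal.ofReal (x i) ∂((ringOp (potlatchUpdate p))^[m] ρ) =
      (Fintype.card S : ℝ≥0∞) ^ m := by
    intro m
    induction m with
    | zero => simpa using H.mean
    | succ m ih =>
      intro i
      set σ := (ringOp (potlatchUpdate p))^[m] ρ with hσ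
      have hae : ∀ᵐ x ∂σ, x ∈ massSimplex S := hA.2 m
      rw [Function.iterate_succ_apply', lintegral_ringOp hu _ (measurable_ofReal_apply i)]
      have hpm : ∀ k, Measurable fun x : EuclideanSpace ℝ S =>
          ENNReal.ofReal (potlatchUpdate p k x i) := fun k =>
        (measurable_ofReal_apply i).comp (hu k)
      have h1 : ∫⁻ x, (∑ k, ENNReal.ofReal (potlatchUpdate p k x i) + ENNReal.ofReal (x i)) ∂σ =
          ∫⁻ x, (Fintype.card S * ENNReal.ofReal (x i) +
            ∑ k, ENNReal.ofReal (p k i) * ENNReal.ofReal (x k)) ∂σ := by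
        refine lintegral_congr_ae (hae.mono fun x hx => ?_)
        have hn : ∀ k, 0 ≤ potlatchUpdate p k x i := fun k =>
          (potlatchUpdate_mem_massSimplex hp hrow k hx).1 i
        have hn' : ∀ k, 0 ≤ p k i * x k := fun k => mul_nonneg (hp _ _) (hx.1 _)
        simp only []
        rw [← ENNReal.ofReal_sum_of_nonneg fun k _ => hn k,
          ← ENNReal.ofReal_add (Finset.sum_nonneg fun k _ => hn k) (hx.1 i),
          sum_potlatchUpdate_add, ENNReal.ofReal_add (mul_nonneg (by positivity) (hx.1 i))
            (Finset.sum_nonneg fun k _ => hn' k), ENNReal.ofReal_mul (by positivity),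
          ENNReal.ofReal_natCast, ENNReal.ofReal_sum_of_nonneg fun k _ => hn' k]
        simp only [ENNReal.ofReal_mul (hp _ _)]
      have hps : ∑ k, ENNReal.ofReal (p k i) = 1 := by
        rw [← ENNReal.ofReal_sum_of_nonneg fun k _ => hp k i, hcol, ENNReal.ofReal_one]
      rw [lintegral_add_right _ (measurable_ofReal_apply i),
        lintegral_finsetSum _ fun k _ => hpm k,
        lintegral_add_left ((measurable_ofReal_apply i).const_mul _),
        lintegral_const_mul _ (measurable_ofReal_apply i),
        lintegral_finsetSum _ fun k _ => (measurable_ofReal_apply k).const_mul _] at h1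
      simp only [lintegral_const_mul _ (measurable_ofReal_apply _), ih] at h1
      rw [← Finset.sum_mul, hps, one_mul] at h1
      rw [pow_succ']
      exact (ENNReal.add_left_inj (ENNReal.pow_ne_top (ENNReal.natCast_ne_top _))).1 h1
  exact ⟨isProbabilityMeasure_clockLaw hu t ρ, hA.1, fun i => by
    rw [lintegral_clockLaw]; simp only [key]; exact tsum_ofReal_ringWeight_mul_card_pow t⟩

omit [DecidableEq S] in
/-- A weak limit of unit mean laws is a unit mean law. -/
lemma IsUnitMeanLaw.of_tendsto {μ : ℕ → ProbabilityMeasure (EuclideanSpace ℝ S)}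
    {ν : ProbabilityMeasure (EuclideanSpace ℝ S)} (h : Tendsto μ atTop (𝓝 ν))
    (H : ∀ m, IsUnitMeanLaw (μ m : Measure (EuclideanSpace ℝ S))) :
    IsUnitMeanLaw (ν : Measure (EuclideanSpace ℝ S)) := by
  have hcompl : ν.toMeasure (massSimplex S)ᶜ = 0 := by
    have h1 := ProbabilityMeasure.le_liminf_measure_open_of_tendsto h
      (isClosed_massSimplex (S := S)).isOpen_compl
    simpa [(H _).compl] using h1
  refine ⟨inferInstance, hcompl, fun i => ?_⟩
  -- On the simplex the coordinate agrees with the bounded function obtained by truncation.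
  let f : BoundedContinuousFunction (EuclideanSpace ℝ S) ℝ≥0 :=
    BoundedContinuousFunction.mkOfBound
      ⟨fun x => min (Real.toNNReal (x i)) (Fintype.card S),
        (continuous_real_toNNReal.comp (by fun_prop)).min continuous_const⟩ (Fintype.card S)
      fun x y => by
        rw [NNReal.dist_eq]
        have h1 : ∀ z : EuclideanSpace ℝ S,
            ((min (Real.toNNReal (z i)) (Fintype.card S) : ℝ≥0) : ℝ) ≤ Fintype.card S := fun z => by
          exact_mod_cast min_le_right _ _
        have h2 := h1 x
        have h3 := h1 y
        have h4 := (min (Real.toNNReal (x i)) (Fintype.card S : ℝ≥0)).2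
        have h5 := (min (Real.toNNReal (y i)) (Fintype.card S : ℝ≥0)).2
        simp only [NNReal.val_eq_coe] at h4 h5
        simp only [ContinuousMap.coe_mk]
        rw [abs_le]; constructor <;> linarith
  have hf : ∀ ρ : Measure (EuclideanSpace ℝ S), ρ (massSimplex S)ᶜ = 0 →
      ∫⁻ x, (f x : ℝ≥0∞) ∂ρ = ∫⁻ x, ENNReal.ofReal (x i) ∂ρ := by
    intro ρ hρ
    have hae : ∀ᵐ x ∂ρ, x ∈ massSimplex S := hρ
    refine lintegral_congr_ae (hae.mono fun x hx => ?_)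
    change ((min (Real.toNNReal (x i)) (Fintype.card S) : ℝ≥0) : ℝ≥0∞) =
      (Real.toNNReal (x i) : ℝ≥0∞)
    rw [min_eq_left]
    rw [Real.toNNReal_le_iff_le_coe]
    exact_mod_cast le_card_of_mem_massSimplex hx i
  have h1 := ProbabilityMeasure.tendsto_iff_forall_lintegral_tendsto.1 h f
  simp only [hf _ (H _).compl, (H _).mean, hf _ hcompl] at h1
  exact tendsto_nhds_unique h1 tendsto_const_nhds

omit [DecidableEq S] in
/-- Bounds of second moments pass to weak limits. -/
lemma lintegral_sq_le_of_tendsto {μ : ℕ → ProbabilityMeasure (EuclideanSpace ℝ S)}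
    {ν : ProbabilityMeasure (EuclideanSpace ℝ S)} (h : Tendsto μ atTop (𝓝 ν))
    {i : S} {c : ℝ≥0∞} (H : ∀ m, ∫⁻ x, ENNReal.ofReal (x i ^ 2) ∂(μ m).toMeasure ≤ c) :
    ∫⁻ x, ENNReal.ofReal (x i ^ 2) ∂ν.toMeasure ≤ c := by
  refine (lintegral_le_liminf_lintegral_of_forall_isOpen_measure_le_liminf_measure
    (μs := fun m => (μ m).toMeasure) (f := fun x : EuclideanSpace ℝ S => x i ^ 2) (by fun_prop)
    (fun x => sq_nonneg _)
    fun G hG => ProbabilityMeasure.le_liminf_measure_open_of_tendsto h hG).trans ?_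
  exact (liminf_le_liminf (Eventually.of_forall H)).trans (by simp)

end Simplex

/-! ### Second moments of the smoothing process on the torus -/

section TorusMoments

variable {d n : ℕ} [NeZero n]

/-- The law at time `t` of the smoothing process on the torus started from a unit mass at `i`. -/
noncomputable abbrev unitSmoothingLaw (i : Torus d n) (t : ℝ≥0) :
    Measure (EuclideanSpace ℝ (Torus d n)) :=
  clockLaw (smoothingUpdate (torusWalk d n)) t (Measure.dirac (EuclideanSpace.single i 1))

lemma isProbabilityMeasure_unitSmoothingLaw (i : Torus d n) (t : ℝ≥0) :
    IsProbabilityMeasure (unitSmoothingLaw i t) :=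
  isProbabilityMeasure_clockLaw (measurable_smoothingUpdate _) t _

lemma continuous_torusFourier (k : Torus d n) :
    Continuous fun y : EuclideanSpace ℝ (Torus d n) => torusFourier y k := by
  unfold torusFourier; fun_prop

lemma continuous_torusMean : Continuous fun y : EuclideanSpace ℝ (Torus d n) => torusMean y := by
  unfold torusMean; fun_prop

/-- The second moments of the smoothing process in terms of a solution of the spectral system. -/
lemma exists_unitSmoothingLaw_moments (hd : 1 ≤ d) (hn : 3 ≤ n) (i : Torus d n) :
    ∃ h : ℝ → Torus d n → ℝ, IsSpectralSystem torusEigenvalue ((n : ℝ) ^ d) h ∧ ∀ t : ℝ≥0,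
      ∫⁻ y, ENNReal.ofReal ((∑ j, y j) ^ 2) ∂(unitSmoothingLaw i t) = ENNReal.ofReal (h t 0) ∧
      ∫⁻ y, ENNReal.ofReal (torusEnergy y) ∂(unitSmoothingLaw i t) =
        ENNReal.ofReal (((n : ℝ) ^ d)⁻¹ * spectralEnergy torusEigenvalue ((n : ℝ) ^ d) h t) ∧
      ∫⁻ y, ENNReal.ofReal (torusVariance y) ∂(unitSmoothingLaw i t) =
        ENNReal.ofReal (((n : ℝ) ^ d)⁻¹ * spectralVariance 0 ((n : ℝ) ^ d) h t) := by
  obtain ⟨h, H, hh⟩ := exists_isSpectralSystem hd hn i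
  refine ⟨h, H, fun t => ?_⟩
  have hlin : ∀ (s : Finset (Torus d n)) (a : Torus d n → ℝ), (∀ k, 0 ≤ a k) →
      ∫⁻ y, ENNReal.ofReal (((n : ℝ) ^ d)⁻¹ * (((n : ℝ) ^ d)⁻¹ *
        ∑ k ∈ s, a k * Complex.normSq (torusFourier y k))) ∂(unitSmoothingLaw i t) =
      ENNReal.ofReal (((n : ℝ) ^ d)⁻¹ * (((n : ℝ) ^ d)⁻¹ * ∑ k ∈ s, a k * h t k)) := by
    intro s a ha
    have hm : ∀ k, Measurable fun y : EuclideanSpace ℝ (Torus d n) =>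
        ENNReal.ofReal (Complex.normSq (torusFourier y k)) := fun k =>
      (ENNReal.continuous_ofReal.comp
        (Complex.continuous_normSq.comp (continuous_torusFourier k))).measurable
    have h1 : ∀ b : Torus d n → ℝ, (∀ k, 0 ≤ b k) →
        ENNReal.ofReal (((n : ℝ) ^ d)⁻¹ * (((n : ℝ) ^ d)⁻¹ * ∑ k ∈ s, a k * b k)) =
        ENNReal.ofReal (((n : ℝ) ^ d)⁻¹ * ((n : ℝ) ^ d)⁻¹) *
          ∑ k ∈ s, ENNReal.ofReal (a k) * ENNReal.ofReal (b k) := by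
      intro b hb
      rw [← mul_assoc, ENNReal.ofReal_mul (by positivity),
        ENNReal.ofReal_sum_of_nonneg fun k _ => mul_nonneg (ha k) (hb k)]
      simp only [ENNReal.ofReal_mul (ha _)]
    simp only [h1 _ fun k => Complex.normSq_nonneg _]
    rw [h1 _ fun k => H.nonneg t t.2 k, lintegral_const_mul _
      (Finset.measurable_fun_sum _ fun k _ => (hm k).const_mul _),
      lintegral_finsetSum _ fun k _ => (hm k).const_mul _]
    simp only [lintegral_const_mul _ (hm _), hh]
  refine ⟨?_, ?_, ?_⟩
  · rw [← hh t 0]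
    simp only [torusFourier_zero, Complex.normSq_ofReal, sq]
  · simp only [torusEnergy_eq hd hn]
    exact hlin _ _ (torusEigenvalue_nonneg hd)
  · have := hlin (Finset.univ.erase 0) (fun _ => 1) fun _ => zero_le_one
    simp only [one_mul] at this
    simp only [torusVariance_eq]
    exact this

/-- Bounds `v` and `e` of the second moments of the smoothing process started from a unit mass:
`v` bounds the total square deviation from the mean, and `e` bounds the defect of the second moment
of the total mass from its limit `2`. -/
structure IsMomentBound (d n : ℕ) [NeZero n] (e v : ℝ≥0 → ℝ) : Prop where
  pos : ∀ t, 0 < e t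
  nonneg : ∀ t, 0 ≤ v t
  tendsto_e : Tendsto e atTop (𝓝 0)
  tendsto_v : Tendsto v atTop (𝓝 0)
  deviation : ∀ (i : Torus d n) t,
    ∫⁻ y, ENNReal.ofReal (∑ j, (y j - torusMean y) ^ 2) ∂(unitSmoothingLaw i t) ≤
      ENNReal.ofReal (v t)
  total_le : ∀ (i : Torus d n) t,
    ∫⁻ y, ENNReal.ofReal ((∑ j, y j) ^ 2) ∂(unitSmoothingLaw i t) ≤ 2
  le_total : ∀ (i : Torus d n) t,
    2 ≤ ∫⁻ y, ENNReal.ofReal ((∑ j, y j) ^ 2) ∂(unitSmoothingLaw i t) + ENNReal.ofReal (e t)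

/-- The profile `C ((1 + t)^(-a) + B⁻¹) exp (-torusRate d n * t)`. -/
noncomputable def momentProfile (d n : ℕ) (C a B : ℝ) (t : ℝ≥0) : ℝ :=
  C * decayProfile a B⁻¹ t * Real.exp (-torusRate d n * t)

lemma tendsto_momentProfile (hd : 1 ≤ d) (hn : 800 ≤ n) {C a B : ℝ} (hC : 0 ≤ C) (ha : 0 ≤ a)
    (hB : 0 < B) : Tendsto (momentProfile d n C a B) atTop (𝓝 0) := by
  have hr : 0 < torusRate d n := lt_of_lt_of_le
    (div_pos (cycleGap_pos (by omega)) (by exact_mod_cast hd)) (cycleGap_div_le_torusRate hd hn)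
  have h1 : Tendsto (fun t : ℝ≥0 => C * (1 + B⁻¹) * Real.exp (-torusRate d n * t)) atTop (𝓝 0) := by
    rw [← mul_zero (C * (1 + B⁻¹))]
    refine Tendsto.const_mul _ (Real.tendsto_exp_atBot.comp ?_)
    simp only [neg_mul]
    exact tendsto_neg_atTop_atBot.comp (NNReal.tendsto_coe_atTop.2 tendsto_id |>.const_mul_atTop hr)
  refine squeeze_zero (fun t => ?_) (fun t => ?_) h1
  · exact mul_nonneg (mul_nonneg hC (decayProfile_nonneg (by positivity) t.2)) (Real.exp_pos _).le
  · have h2 := decayProfile_anti (M := B⁻¹) ha le_rfl t.2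
    have h3 : decayProfile a B⁻¹ 0 = 1 + B⁻¹ := by simp [decayProfile]
    rw [h3] at h2
    unfold momentProfile
    gcongr
    exact h2

/-- The spectral bounds as moment bounds. The second moment of the total mass is `2` minus the
spectral energy, since their sum is conserved. -/
lemma exists_isMomentBound (d : ℕ) (hd : 1 ≤ d) : ∃ C : ℝ, 0 < C ∧
    ∀ (n : ℕ) [NeZero n], 800 ≤ n →
      IsMomentBound d n (momentProfile d n C ((d : ℝ) / 2 + 1) ((n : ℝ) ^ (d + 2)))
        (momentProfile d n C ((d : ℝ) / 2) ((n : ℝ) ^ d)) ∧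
      ∀ h : ℝ → Torus d n → ℝ, IsSpectralSystem torusEigenvalue ((n : ℝ) ^ d) h → ∀ t : ℝ≥0,
        spectralEnergy torusEigenvalue ((n : ℝ) ^ d) h t ≤
          momentProfile d n C ((d : ℝ) / 2 + 1) ((n : ℝ) ^ (d + 2)) t ∧
        spectralVariance 0 ((n : ℝ) ^ d) h t ≤
          momentProfile d n C ((d : ℝ) / 2) ((n : ℝ) ^ d) t := by
  obtain ⟨C, hC, hb⟩ := exists_spectral_upper_bound d hd
  refine ⟨C, hC, fun n _ hn => ?_⟩
  have hn0 := natCast_pos_of_neZero (n := n)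
  have hN : (0 : ℝ) < (n : ℝ) ^ d := by positivity
  refine ⟨⟨fun t => ?_, fun t => ?_, ?_, ?_, fun i t => ?_, fun i t => ?_, fun i t => ?_⟩,
    fun h H t => hb n hn h H t t.2⟩
  · exact mul_pos (mul_pos hC (decayProfile_pos (by positivity) t.2)) (Real.exp_pos _)
  · exact mul_nonneg (mul_nonneg hC.le (decayProfile_nonneg (by positivity) t.2))
      (Real.exp_pos _).le
  · exact tendsto_momentProfile hd hn hC.le (by positivity) (by positivity)
  · exact tendsto_momentProfile hd hn hC.le (by positivity) (by positivity)
  all_goals obtain ⟨h, H, hh⟩ := exists_unitSmoothingLaw_moments (n := n) hd (by omega) i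
  · have h1 : ∀ y : EuclideanSpace ℝ (Torus d n), ENNReal.ofReal (∑ j, (y j - torusMean y) ^ 2) =
        ENNReal.ofReal ((n : ℝ) ^ d) * ENNReal.ofReal (torusVariance y) := by
      intro y
      rw [← ENNReal.ofReal_mul hN.le, torusVariance, mul_inv_cancel_left₀ hN.ne']
    simp only [h1]
    rw [lintegral_const_mul' _ _ ENNReal.ofReal_ne_top, (hh t).2.2, ← ENNReal.ofReal_mul hN.le,
      mul_inv_cancel_left₀ hN.ne']
    exact ENNReal.ofReal_le_ofReal (hb n hn h H t t.2).2
  all_goals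
    have h0 := H.zero_mode_add_spectralEnergy hN.ne' (sum_torusEigenvalue (by omega))
      (torusEigenvalue_zero hd) t
    have h2 : (2 : ℝ≥0∞) = ENNReal.ofReal 2 := by simp
    have ht : (0 : ℝ) ≤ t := t.2
    have hE := H.spectralEnergy_nonneg hN (torusEigenvalue_nonneg hd) ht
    rw [(hh t).1]
  · rw [h2]; exact ENNReal.ofReal_le_ofReal (by linarith)
  · rw [h2, show ENNReal.ofReal 2 = ENNReal.ofReal (h t 0) + ENNReal.ofReal
      (spectralEnergy torusEigenvalue ((n : ℝ) ^ d) h t) by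
        rw [← ENNReal.ofReal_add (H.nonneg t ht 0) hE, h0]]
    exact add_le_add le_rfl (ENNReal.ofReal_le_ofReal (hb n hn h H t ht).1)

end TorusMoments

/-! ### The stationary law -/

section StationaryLaw

lemma lintegral_add_mul_sq {Z : Type*} [MeasurableSpace Z] {ρ : Measure Z} [IsProbabilityMeasure ρ]
    {V : Z → ℝ} (hV : MemLp V 2 ρ) (h0 : ∫ z, V z ∂ρ = 0) (a b : ℝ) :
    ∫⁻ z, ENNReal.ofReal ((a + b * V z) ^ 2) ∂ρ =
      ENNReal.ofReal (a ^ 2) + ENNReal.ofReal (b ^ 2) * ∫⁻ z, ENNReal.ofReal (V z ^ 2) ∂ρ := by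
  have hi := hV.integrable (by norm_num)
  have hi2 := hV.integrable_sq
  have e : (fun z => (a + b * V z) ^ 2) = fun z => (a ^ 2 + 2 * a * b * V z) + b ^ 2 * V z ^ 2 := by
    funext z; ring
  have hint1 : Integrable (fun z => a ^ 2 + 2 * a * b * V z) ρ :=
    (integrable_const _).add (hi.const_mul _)
  have hint : Integrable (fun z => (a + b * V z) ^ 2) ρ := by
    rw [e]; exact hint1.add (hi2.const_mul _)
  rw [← ofReal_integral_eq_lintegral_ofReal hint (Eventually.of_forall fun z => sq_nonneg _),
    ← ofReal_integral_eq_lintegral_ofReal hi2 (Eventually.of_forall fun z => sq_nonneg _),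
    ← ENNReal.ofReal_mul (sq_nonneg b), ← ENNReal.ofReal_add (sq_nonneg a)
      (mul_nonneg (sq_nonneg b) (integral_nonneg fun z => sq_nonneg _)), e,
    integral_add hint1 (hi2.const_mul _),
    integral_add (integrable_const _) (hi.const_mul _), integral_const_mul, integral_const_mul, h0]
  simp

variable {S : Type*} [Fintype S] {ρ : Measure (EuclideanSpace ℝ S)}

lemma continuous_pairing_left (y : EuclideanSpace ℝ S) :
    Continuous fun x : EuclideanSpace ℝ S => pairing x y := by
  unfold pairing; fun_prop

lemma pairing_sub_left (x x' y : EuclideanSpace ℝ S) :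
    pairing (x - x') y = pairing x y - pairing x' y := by
  simp [pairing, sub_mul]

lemma pairing_smul_left (c : ℝ) (x y : EuclideanSpace ℝ S) :
    pairing (c • x) y = c * pairing x y := by
  simp [pairing, mul_assoc, Finset.mul_sum]

lemma pairing_unitMasses (y : EuclideanSpace ℝ S) : pairing (unitMasses S) y = ∑ j, y j := by
  simp [pairing, unitMasses]

namespace IsUnitMeanLaw

variable (H : IsUnitMeanLaw ρ)
include H

lemma memLp_pairing (y : EuclideanSpace ℝ S) :
    MemLp (fun z => pairing (z - unitMasses S) y) 2 ρ := by
  have := H.prob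
  have hc : Continuous fun z : EuclideanSpace ℝ S => pairing (z - unitMasses S) y :=
    (continuous_pairing_left y).comp (by fun_prop)
  obtain ⟨C, hC⟩ := isCompact_massSimplex.exists_bound_of_continuousOn hc.continuousOn
  have hae : ∀ᵐ x ∂ρ, x ∈ massSimplex S := H.compl
  exact MemLp.of_bound hc.aestronglyMeasurable C (hae.mono hC)

lemma integral_pairing (y : EuclideanSpace ℝ S) :
    ∫ z, pairing (z - unitMasses S) y ∂ρ = 0 := by
  have := H.prob
  have hae : ∀ᵐ x ∂ρ, x ∈ massSimplex S := H.compl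
  have hi : ∀ i, Integrable (fun z : EuclideanSpace ℝ S => z i) ρ := fun i =>
    Integrable.of_bound (C := Fintype.card S) (Continuous.aestronglyMeasurable (by fun_prop))
      (hae.mono fun x hx => by
        rw [Real.norm_eq_abs, abs_of_nonneg (hx.1 i)]; exact le_card_of_mem_massSimplex hx i)
  have h1 : ∀ i, ∫ z : EuclideanSpace ℝ S, z i ∂ρ = 1 := fun i => by
    rw [integral_eq_lintegral_of_nonneg_ae (hae.mono fun x hx => hx.1 i) (hi i).1, H.mean]
    simp
  simp only [pairing, PiLp.sub_apply, unitMasses]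
  have h2 : ∀ i, Integrable (fun z : EuclideanSpace ℝ S => (z i - 1) * y i) ρ := fun i =>
    ((hi i).sub (integrable_const _)).mul_const _
  rw [integral_finsetSum _ fun i _ => h2 i]
  refine Finset.sum_eq_zero fun i _ => ?_
  rw [integral_mul_const, integral_sub (hi i) (integrable_const _), h1]
  simp

end IsUnitMeanLaw

variable {d n : ℕ} [NeZero n] {e v : ℝ≥0 → ℝ}

/-- A unit mean law whose second moments under the potlatch process are at most `2` has small
fluctuations seen from the smoothing process. -/
lemma IsMomentBound.fluctuation_le (hM : IsMomentBound d n e v)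
    {ρ : Measure (EuclideanSpace ℝ (Torus d n))} (H : IsUnitMeanLaw ρ) {i : Torus d n} {t : ℝ≥0}
    (h2 : ∫⁻ x, ENNReal.ofReal (x i ^ 2) ∂(clockLaw (potlatchUpdate (torusWalk d n)) t ρ) ≤ 2) :
    ∫⁻ y, ∫⁻ z, ENNReal.ofReal (pairing (z - unitMasses _) y ^ 2) ∂ρ ∂(unitSmoothingLaw i t) ≤
      ENNReal.ofReal (e t) := by
  have := H.prob
  have := isProbabilityMeasure_unitSmoothingLaw i t
  rw [lintegral_potlatch_sq, lintegral_lintegral_swap measurable_pairing_sq.aemeasurable] at h2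
  have h1 : ∀ y : EuclideanSpace ℝ (Torus d n), ∫⁻ z, ENNReal.ofReal (pairing z y ^ 2) ∂ρ =
      ENNReal.ofReal ((∑ j, y j) ^ 2) +
        ∫⁻ z, ENNReal.ofReal (pairing (z - unitMasses _) y ^ 2) ∂ρ := by
    intro y
    have h := lintegral_add_mul_sq (H.memLp_pairing y) (H.integral_pairing y) (∑ j, y j) 1
    simp only [one_mul, one_pow, ENNReal.ofReal_one] at h
    rw [← h]
    refine lintegral_congr fun z => ?_
    rw [pairing_sub_left, pairing_unitMasses, add_sub_cancel]
  simp only [h1] at h2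
  have hs : Measurable fun y : EuclideanSpace ℝ (Torus d n) => ENNReal.ofReal ((∑ j, y j) ^ 2) :=
    (ENNReal.continuous_ofReal.comp (by fun_prop)).measurable
  rw [lintegral_add_left hs] at h2
  have h3 := h2.trans (hM.le_total i t)
  exact (ENNReal.add_le_add_iff_left ((hM.total_le i t).trans_lt (by simp)).ne).1 h3

end StationaryLaw

section LimitLaw

variable {d n : ℕ} [NeZero n] {e v : ℝ≥0 → ℝ}

omit [NeZero n] in
lemma torusWalk_nonneg (i j : Torus d n) : 0 ≤ torusWalk d n i j := by
  unfold torusWalk; split_ifs <;> positivity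

lemma IsUnitMeanLaw.clockLaw_torusWalk (hd : 1 ≤ d) (hn : 3 ≤ n)
    {ρ : Measure (EuclideanSpace ℝ (Torus d n))} (H : IsUnitMeanLaw ρ) (t : ℝ≥0) :
    IsUnitMeanLaw (clockLaw (potlatchUpdate (torusWalk d n)) t ρ) :=
  H.clockLaw_potlatchUpdate torusWalk_nonneg (sum_torusWalk hd hn)
    (fun j => by simpa only [torusWalk_comm] using sum_torusWalk hd hn j) t

/-- The second moments of the potlatch process started from unit masses are at most `2`. -/
lemma IsMomentBound.lintegral_sq_le (hM : IsMomentBound d n e v) (i : Torus d n) (t : ℝ≥0) :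
    ∫⁻ x, ENNReal.ofReal (x i ^ 2) ∂(clockLaw (potlatchUpdate (torusWalk d n)) t
      (Measure.dirac (unitMasses _))) ≤ 2 := by
  have := isProbabilityMeasure_unitSmoothingLaw i t
  have hm : Measurable fun x => ∫⁻ y, ENNReal.ofReal (pairing x y ^ 2) ∂(unitSmoothingLaw i t) :=
    measurable_pairing_sq.lintegral_prod_right'
  rw [lintegral_potlatch_sq, lintegral_dirac' _ hm]
  simp only [pairing_unitMasses]
  exact hM.total_le i t

/-- There is a stationary law of the potlatch process on the simplex with unit means, obtained as a
weak limit of the process started from unit masses. -/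
lemma IsMomentBound.exists_stationary (hd : 1 ≤ d) (hn : 3 ≤ n) (hM : IsMomentBound d n e v) :
    ∃ ν : ProbabilityMeasure (EuclideanSpace ℝ (Torus d n)),
      IsUnitMeanLaw ν.toMeasure ∧ (∀ i, ∫⁻ x, ENNReal.ofReal (x i ^ 2) ∂ν.toMeasure ≤ 2) ∧
      ∀ t, clockLaw (potlatchUpdate (torusWalk d n)) t ν.toMeasure = ν.toMeasure := by
  have hu := measurable_potlatchUpdate (torusWalk d n)
  set δ : Measure (EuclideanSpace ℝ (Torus d n)) := Measure.dirac (unitMasses _) with hδ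
  have hmean : ∀ t, IsUnitMeanLaw (clockLaw (potlatchUpdate (torusWalk d n)) t δ) :=
    isUnitMeanLaw_dirac.clockLaw_torusWalk hd hn
  let μ : ℕ → ProbabilityMeasure (EuclideanSpace ℝ (Torus d n)) := fun m =>
    ⟨clockLaw (potlatchUpdate (torusWalk d n)) m δ, (hmean m).prob⟩
  have htight : IsTightMeasureSet {((ρ : ProbabilityMeasure (EuclideanSpace ℝ (Torus d n))) :
      Measure (EuclideanSpace ℝ (Torus d n))) | ρ ∈ Set.range μ} := by
    refine isTightMeasureSet_iff_exists_isCompact_measure_compl_le.2 fun ε _ =>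
      ⟨massSimplex _, isCompact_massSimplex, ?_⟩
    rintro _ ⟨_, ⟨m, rfl⟩, rfl⟩
    exact ((hmean m).compl.trans_le bot_le)
  obtain ⟨ν, -, φ, hφ, hlim⟩ := (isCompact_closure_of_isTightMeasureSet htight).tendsto_subseq
    (x := μ) fun m => subset_closure ⟨m, rfl⟩
  refine ⟨ν, IsUnitMeanLaw.of_tendsto hlim fun m => hmean _, fun i =>
    lintegral_sq_le_of_tendsto hlim fun m => hM.lintegral_sq_le i _, fun t => ?_⟩
  have h1 := tendsto_clockLaw hu (continuous_potlatchUpdate _) hlim t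
  -- Running the process for a further time `t` does not change the limit, since the laws started
  -- from unit masses and from the law at time `t` become close.
  have h2 : Tendsto (β := ProbabilityMeasure (EuclideanSpace ℝ (Torus d n)))
      (fun m => ⟨clockLaw (potlatchUpdate (torusWalk d n)) t ((μ ∘ φ) m).toMeasure,
        isProbabilityMeasure_clockLaw hu t _⟩) atTop (𝓝 ν) := by
    rw [tendsto_iff_forall_lipschitz_integral_tendsto] at hlim
    refine tendsto_iff_forall_lipschitz_integral_tendsto.2 fun f hf hL => ?_
    have h3 := hlim f hf hL
    obtain ⟨B, hB⟩ := hf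
    obtain ⟨L, hL⟩ := hL
    have hprob := (hmean t).prob
    set π : Measure (EuclideanSpace ℝ (Torus d n) × EuclideanSpace ℝ (Torus d n)) :=
      (clockLaw (potlatchUpdate (torusWalk d n)) t δ).prod δ with hπ
    have hbound : ∀ m : ℕ,
        |∫ x, f x ∂(clockLaw (potlatchUpdate (torusWalk d n)) t (μ m).toMeasure) -
          ∫ x, f x ∂(μ m).toMeasure| ≤ L * √(Fintype.card (Torus d n) * e m) := by
      intro m
      have := isProbabilityMeasure_coupledLaw hu m π
      have hc : ∀ i, ∫⁻ q, ENNReal.ofReal ((q.1 i - q.2 i) ^ 2)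
          ∂(coupledLaw (potlatchUpdate (torusWalk d n)) m π) ≤ ENNReal.ofReal (e m) := by
        intro i
        rw [lintegral_coupledLaw_sq]
        refine le_trans (le_of_eq (lintegral_congr fun y => ?_)) (hM.fluctuation_le (hmean t)
          (i := i) (t := m) ?_)
        · have hmeas : Measurable fun q : EuclideanSpace ℝ (Torus d n) ×
              EuclideanSpace ℝ (Torus d n) => ENNReal.ofReal (pairing (q.1 - q.2) y ^ 2) :=
            (ENNReal.continuous_ofReal.comp
              (((continuous_pairing_left y).comp (by fun_prop)).pow 2)).measurable
          rw [hπ, lintegral_prod _ hmeas.aemeasurable]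
          refine lintegral_congr fun x => ?_
          rw [hδ]
          exact lintegral_dirac' _ (hmeas.comp measurable_prodMk_left)
        · rw [clockLaw_clockLaw hu]
          exact hM.lintegral_sq_le i _
      have hpos : 0 < Fintype.card (Torus d n) * e m :=
        mul_pos (by exact_mod_cast Fintype.card_pos) (hM.pos m)
      have h4 := abs_integral_sub_le hpos (lintegral_edist_sq_le hc) hB hL
      rw [coupledLaw_map_fst hu, coupledLaw_map_snd hu, hπ, Measure.map_fst_prod,
        Measure.map_snd_prod] at h4
      simp only [measure_univ, one_smul] at h4
      rw [clockLaw_clockLaw hu, add_comm, ← clockLaw_clockLaw hu] at h4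
      exact h4
    have hzero : Tendsto (fun m : ℕ => L * √(Fintype.card (Torus d n) * e (φ m))) atTop (𝓝 0) := by
      have h5 : Tendsto (fun m : ℕ => ((φ m : ℕ) : ℝ≥0)) atTop atTop :=
        tendsto_natCast_atTop_atTop.comp hφ.tendsto_atTop
      have h6 := ((hM.tendsto_e.comp h5).const_mul (Fintype.card (Torus d n) : ℝ)).sqrt.const_mul
        (L : ℝ)
      simpa using h6
    have h7 := (squeeze_zero_norm (fun m => hbound (φ m)) hzero).add h3
    rw [zero_add] at h7
    refine h7.congr fun m => ?_
    simp
  have h3 := tendsto_nhds_unique h1 h2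
  exact congrArg ProbabilityMeasure.toMeasure h3

end LimitLaw

/-! ### Coupling with the stationary process -/

section StationaryCoupling

variable {d n : ℕ} [NeZero n] {e v : ℝ≥0 → ℝ}

/-- The potlatch process with initial law `ρ` is coupled with the stationary process obtained from
the unit mean stationary law by rescaling to the mean mass of the initial configuration. The
deviation of the initial configuration from its mean and the fluctuations of the stationary law
contribute independently to the mean square distance. -/
lemma IsMomentBound.exists_coupling (hd : 1 ≤ d) (hn : 3 ≤ n) (hM : IsMomentBound d n e v)
    (ρ : Measure (EuclideanSpace ℝ (Torus d n))) [IsProbabilityMeasure ρ] {σ τ : ℝ} (hσ : 0 ≤ σ)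
    (hτ : 0 ≤ τ)
    (h1 : ∀ y, ∫⁻ x, ENNReal.ofReal (pairing (x - torusMean x • unitMasses _) y ^ 2) ∂ρ ≤
      ENNReal.ofReal σ * ENNReal.ofReal (∑ j, (y j - torusMean y) ^ 2))
    (h2 : ∫⁻ x, ENNReal.ofReal (torusMean x ^ 2) ∂ρ ≤ ENNReal.ofReal τ) :
    ∃ ν : ProbabilityMeasure (EuclideanSpace ℝ (Torus d n)),
      (∀ t, clockLaw (potlatchUpdate (torusWalk d n)) t ν.toMeasure = ν.toMeasure) ∧
      ∀ t, ∃ π : Measure (EuclideanSpace ℝ (Torus d n) × EuclideanSpace ℝ (Torus d n)),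
        IsProbabilityMeasure π ∧
        π.map Prod.fst = clockLaw (potlatchUpdate (torusWalk d n)) t ρ ∧
        π.map Prod.snd = ν.toMeasure ∧
        ∀ i, ∫⁻ q, ENNReal.ofReal ((q.1 i - q.2 i) ^ 2) ∂π ≤
          ENNReal.ofReal (σ * v t + τ * e t) := by
  obtain ⟨ν₁, H, hsq, hst⟩ := hM.exists_stationary hd hn
  have hu := measurable_potlatchUpdate (torusWalk d n)
  have hφ : Continuous fun q : EuclideanSpace ℝ (Torus d n) × EuclideanSpace ℝ (Torus d n) =>
      torusMean q.1 • q.2 := (continuous_torusMean.comp continuous_fst).smul continuous_snd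
  have hφm := hφ.measurable
  have hprob : IsProbabilityMeasure ((ρ.prod ν₁.toMeasure).map fun q => torusMean q.1 • q.2) :=
    Measure.isProbabilityMeasure_map hφm.aemeasurable
  have hstat : ∀ t, clockLaw (potlatchUpdate (torusWalk d n)) t
      ((ρ.prod ν₁.toMeasure).map fun q => torusMean q.1 • q.2) =
      (ρ.prod ν₁.toMeasure).map fun q => torusMean q.1 • q.2 := by
    intro t
    rw [← map_clockLaw (u := fun i q => (q.1, potlatchUpdate (torusWalk d n) i q.2))
      (fun i => measurable_fst.prodMk ((hu i).comp measurable_snd)) hu hφm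
      (fun i q => (potlatchUpdate_smul _ i _ _).symm), clockLaw_prod_right hu, hst]
  refine ⟨⟨_, hprob⟩, hstat, fun t => ?_⟩
  have hψ : Measurable fun q : EuclideanSpace ℝ (Torus d n) × EuclideanSpace ℝ (Torus d n) =>
      (q.1, torusMean q.1 • q.2) := measurable_fst.prodMk hφm
  set π₀ := (ρ.prod ν₁.toMeasure).map fun q => (q.1, torusMean q.1 • q.2) with hπ₀
  have hprob₀ : IsProbabilityMeasure π₀ := Measure.isProbabilityMeasure_map hψ.aemeasurable
  refine ⟨coupledLaw (potlatchUpdate (torusWalk d n)) t π₀, isProbabilityMeasure_coupledLaw hu t _,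
    ?_, ?_, fun i => ?_⟩
  · rw [coupledLaw_map_fst hu, hπ₀, Measure.map_map measurable_fst hψ]
    congr 1
    exact (Measure.map_fst_prod (μ := ρ) (ν := ν₁.toMeasure)).trans (by simp)
  · rw [coupledLaw_map_snd hu, hπ₀, Measure.map_map measurable_snd hψ]
    exact hstat t
  rw [lintegral_coupledLaw_sq]
  have hinner : ∀ y, ∫⁻ q, ENNReal.ofReal (pairing (q.1 - q.2) y ^ 2) ∂π₀ ≤
      ENNReal.ofReal σ * ENNReal.ofReal (∑ j, (y j - torusMean y) ^ 2) + ENNReal.ofReal τ *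
        ∫⁻ z, ENNReal.ofReal (pairing (z - unitMasses _) y ^ 2) ∂ν₁.toMeasure := by
    intro y
    have hmeas : Measurable fun q : EuclideanSpace ℝ (Torus d n) ×
        EuclideanSpace ℝ (Torus d n) => ENNReal.ofReal (pairing (q.1 - q.2) y ^ 2) :=
      (ENNReal.continuous_ofReal.comp
        (((continuous_pairing_left y).comp (by fun_prop)).pow 2)).measurable
    rw [hπ₀, lintegral_map hmeas hψ]
    have hcomp : Measurable fun q : EuclideanSpace ℝ (Torus d n) × EuclideanSpace ℝ (Torus d n) =>
        ENNReal.ofReal (pairing (q.1 - torusMean q.1 • q.2) y ^ 2) :=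
      (ENNReal.continuous_ofReal.comp
        (((continuous_pairing_left y).comp (continuous_fst.sub hφ)).pow 2)).measurable
    rw [lintegral_prod _ hcomp.aemeasurable]
    have h3 : ∀ x, ∫⁻ z, ENNReal.ofReal (pairing (x - torusMean x • z) y ^ 2) ∂ν₁.toMeasure =
        ENNReal.ofReal (pairing (x - torusMean x • unitMasses _) y ^ 2) +
          ENNReal.ofReal (torusMean x ^ 2) *
            ∫⁻ z, ENNReal.ofReal (pairing (z - unitMasses _) y ^ 2) ∂ν₁.toMeasure := by
      intro x
      have h := lintegral_add_mul_sq (H.memLp_pairing y) (H.integral_pairing y)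
        (pairing (x - torusMean x • unitMasses _) y) (-torusMean x)
      rw [neg_sq] at h
      rw [← h]
      refine lintegral_congr fun z => ?_
      congr 2
      simp only [pairing_sub_left, pairing_smul_left]
      ring
    have hm1 : Measurable fun x : EuclideanSpace ℝ (Torus d n) =>
        ENNReal.ofReal (pairing (x - torusMean x • unitMasses _) y ^ 2) :=
      (ENNReal.continuous_ofReal.comp (((continuous_pairing_left y).comp
        (continuous_id.sub (continuous_torusMean.smul continuous_const))).pow 2)).measurable
    have hm2 : Measurable fun x : EuclideanSpace ℝ (Torus d n) =>
        ENNReal.ofReal (torusMean x ^ 2) :=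
      (ENNReal.continuous_ofReal.comp (continuous_torusMean.pow 2)).measurable
    calc _ = ∫⁻ x, (ENNReal.ofReal (pairing (x - torusMean x • unitMasses _) y ^ 2) +
          ENNReal.ofReal (torusMean x ^ 2) *
            ∫⁻ z, ENNReal.ofReal (pairing (z - unitMasses _) y ^ 2) ∂ν₁.toMeasure) ∂ρ :=
          lintegral_congr h3
      _ ≤ _ := by
          rw [lintegral_add_left hm1, lintegral_mul_const _ hm2]
          exact add_le_add (h1 y) (mul_le_mul_left h2 _)
  refine (lintegral_mono hinner).trans ?_
  have hm3 : Measurable fun y : EuclideanSpace ℝ (Torus d n) =>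
      ENNReal.ofReal (∑ j, (y j - torusMean y) ^ 2) :=
    (ENNReal.continuous_ofReal.comp (continuous_finsetSum _ fun j _ =>
      ((by fun_prop : Continuous fun y : EuclideanSpace ℝ (Torus d n) => y j).sub
        continuous_torusMean).pow 2)).measurable
  rw [lintegral_add_left (hm3.const_mul _), lintegral_const_mul _ hm3,
    lintegral_const_mul' _ _ ENNReal.ofReal_ne_top,
    ENNReal.ofReal_add (mul_nonneg hσ (hM.nonneg t)) (mul_nonneg hτ (hM.pos t).le),
    ENNReal.ofReal_mul hσ, ENNReal.ofReal_mul hτ]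
  refine add_le_add (mul_le_mul_right (hM.deviation i t) _) (mul_le_mul_right
    (hM.fluctuation_le H ?_) _)
  rw [hst]
  exact hsq i

end StationaryCoupling

/-! ### Convergence of the potlatch process -/

section Convergence

variable {d n : ℕ} [NeZero n] {e v : ℝ≥0 → ℝ}

/-- Convergence to equilibrium of a potlatch process, with the rate expressed by bounds of the
moments of the smoothing process. -/
lemma IsMomentBound.exists_limit (hd : 1 ≤ d) (hn : 3 ≤ n) (hM : IsMomentBound d n e v)
    {Ω : Type*} [MeasurableSpace Ω] {P : Measure Ω} [IsProbabilityMeasure P]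
    {X : ℝ≥0 → Ω → EuclideanSpace ℝ (Torus d n)} (hX : IsPotlatch (torusWalk d n) X P)
    {σ τ : ℝ} (hσ : 0 ≤ σ) (hτ : 0 < τ)
    (h1 : ∀ y, ∫⁻ x, ENNReal.ofReal (pairing (x - torusMean x • unitMasses _) y ^ 2)
      ∂(P.map (X 0)) ≤ ENNReal.ofReal σ * ENNReal.ofReal (∑ j, (y j - torusMean y) ^ 2))
    (h2 : ∫⁻ x, ENNReal.ofReal (torusMean x ^ 2) ∂(P.map (X 0)) ≤ ENNReal.ofReal τ) :
    ∃ ν : ProbabilityMeasure (EuclideanSpace ℝ (Torus d n)),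
      TendstoInDistribution X atTop id (fun _ => P) ν.toMeasure ∧
      IsPotlatchStationary (torusWalk d n) ν.toMeasure ∧
      ∀ t : ℝ≥0,
        (∀ i : Torus d n,
          wasserstein2 (P.map fun ω => X t ω i) (ν.toMeasure.map fun x => x i) ≤
            ENNReal.ofReal (σ * v t + τ * e t) ^ (1 / 2 : ℝ)) ∧
        wasserstein2 (P.map (X t)) ν.toMeasure ≤
          ENNReal.ofReal ((n : ℝ) ^ d * (σ * v t + τ * e t)) ^ (1 / 2 : ℝ) := by
  have hu := measurable_potlatchUpdate (torusWalk d n)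
  obtain ⟨N, hN⟩ := hX
  have hXm := hN.measurable
  have hprob : IsProbabilityMeasure (P.map (X 0)) :=
    Measure.isProbabilityMeasure_map (hXm 0).aemeasurable
  obtain ⟨ν, hst, hν⟩ := hM.exists_coupling hd hn (P.map (X 0)) hσ hτ.le h1 h2
  refine ⟨ν, ⟨fun t => (hXm t).aemeasurable, aemeasurable_id, ?_⟩, ?_, fun t => ⟨fun i => ?_, ?_⟩⟩
  · refine tendsto_iff_forall_lipschitz_integral_tendsto.2 fun f hf hL => ?_
    obtain ⟨B, hB⟩ := hf
    obtain ⟨L, hL⟩ := hL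
    rw [tendsto_iff_norm_sub_tendsto_zero]
    have hlim : Tendsto (fun t => L * √(Fintype.card (Torus d n) * (σ * v t + τ * e t))) atTop
        (𝓝 0) := by
      have h := (((hM.tendsto_v.const_mul σ).add (hM.tendsto_e.const_mul τ)).const_mul
        (Fintype.card (Torus d n) : ℝ)).sqrt.const_mul (L : ℝ)
      simpa using h
    refine squeeze_zero (fun t => norm_nonneg _) (fun t => ?_) hlim
    obtain ⟨π, hπ, hfst, hsnd, hle⟩ := hν t
    have hpos : 0 < Fintype.card (Torus d n) * (σ * v t + τ * e t) :=
      mul_pos (by exact_mod_cast Fintype.card_pos)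
        (add_pos_of_nonneg_of_pos (mul_nonneg hσ (hM.nonneg t)) (mul_pos hτ (hM.pos t)))
    have h := abs_integral_sub_le hpos (lintegral_edist_sq_le hle) hB hL
    rw [hfst, hsnd, ← hN.map_eq_clockLaw hu] at h
    simpa using h
  · intro Ω' _ P' _ Z ⟨N', hZ⟩ h0 t
    rw [hZ.map_eq_clockLaw hu, h0, hst]
  · obtain ⟨π, hπ, hfst, hsnd, hle⟩ := hν t
    have h := wasserstein2_apply_le (hle i)
    have hi : Measurable fun x : EuclideanSpace ℝ (Torus d n) => x i :=
      Continuous.measurable (by fun_prop)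
    rw [hfst, hsnd, ← hN.map_eq_clockLaw hu, Measure.map_map hi (hXm t)] at h
    exact h
  · obtain ⟨π, hπ, hfst, hsnd, hle⟩ := hν t
    have h := wasserstein2_le (lintegral_edist_sq_le hle)
    rwa [hfst, hsnd, ← hN.map_eq_clockLaw hu, card_torus] at h

lemma pairing_sub_torusMean_smul (x y : EuclideanSpace ℝ (Torus d n)) :
    pairing (x - torusMean x • unitMasses _) y = ∑ j, (y j - torusMean y) * x j := by
  rw [pairing_sub_left, pairing_smul_left, pairing_unitMasses]
  simp only [sub_mul, Finset.sum_sub_distrib, ← Finset.mul_sum, pairing, torusMean]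
  rw [Finset.sum_congr rfl fun j _ => mul_comm (x j) (y j)]
  ring

lemma sum_sub_torusMean (y : EuclideanSpace ℝ (Torus d n)) : ∑ j, (y j - torusMean y) = 0 := by
  have hn := natCast_pos_of_neZero (n := n)
  have h : (n : ℝ) ^ d ≠ 0 := by positivity
  simp only [Finset.sum_sub_distrib, Finset.sum_const, nsmul_eq_mul, Finset.card_univ, card_torus,
    torusMean]
  rw [mul_inv_cancel_left₀ h, sub_self]

/-- Uncorrelated variables with a common mean: the second moment of a linear combination with
vanishing sum of coefficients. -/
lemma integral_sq_sum_le {ι Ω : Type*} [Fintype ι] [MeasurableSpace Ω] {P : Measure Ω}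
    [IsProbabilityMeasure P] {ξ : ι → Ω → ℝ} (hξ : ∀ j, MemLp (ξ j) 2 P)
    (hcov : ∀ j k, j ≠ k → covariance (ξ j) (ξ k) P = 0) {μ ζ : ℝ} (hμ : ∀ j, ∫ ω, ξ j ω ∂P = μ)
    (hζ : ∀ j, ∫ ω, ξ j ω ^ 2 ∂P ≤ ζ) {c : ι → ℝ} (hc : ∑ j, c j = 0) :
    ∫ ω, (∑ j, c j * ξ j ω) ^ 2 ∂P ≤ ζ * ∑ j, c j ^ 2 := by
  classical
  have hint : ∀ j k, Integrable (fun ω => ξ j ω * ξ k ω) P := fun j k =>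
    (hξ j).integrable_mul (hξ k)
  have hprod : ∀ j k, j ≠ k → ∫ ω, ξ j ω * ξ k ω ∂P = μ ^ 2 := by
    intro j k h
    have h1 := covariance_eq_sub (hξ j) (hξ k)
    rw [hcov j k h, hμ, hμ] at h1
    simp only [Pi.mul_apply] at h1
    linarith
  have hexp : ∀ ω, (∑ j, c j * ξ j ω) ^ 2 = ∑ j, ∑ k, c j * c k * (ξ j ω * ξ k ω) := by
    intro ω
    rw [sq, Finset.sum_mul_sum]
    exact Finset.sum_congr rfl fun j _ => Finset.sum_congr rfl fun k _ => by ring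
  simp only [hexp]
  rw [integral_finsetSum _ fun j _ => integrable_finsetSum _ fun k _ => (hint j k).const_mul _]
  have hinner : ∀ j, ∫ ω, ∑ k, c j * c k * (ξ j ω * ξ k ω) ∂P ≤
      ∑ k, (c j * c k * μ ^ 2 + if j = k then c j ^ 2 * (ζ - μ ^ 2) else 0) := by
    intro j
    rw [integral_finsetSum _ fun k _ => (hint j k).const_mul _]
    refine Finset.sum_le_sum fun k _ => ?_
    rw [integral_const_mul]
    by_cases h : j = k
    · subst h
      have h1 := mul_le_mul_of_nonneg_left (hζ j) (sq_nonneg (c j))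
      rw [if_pos rfl]
      simp only [← sq] at h1 ⊢
      linarith
    · rw [if_neg h, hprod j k h, add_zero]
  refine (Finset.sum_le_sum fun j _ => hinner j).trans ?_
  have h0 : ∑ j, ∑ k, c j * c k * μ ^ 2 = 0 := by
    simp only [← Finset.sum_mul, ← Finset.mul_sum, hc, mul_zero, zero_mul, Finset.sum_const_zero]
  simp only [Finset.sum_add_distrib, h0, Finset.sum_ite_eq, Finset.mem_univ, if_true, zero_add]
  rw [← Finset.sum_mul, mul_comm]
  refine mul_le_mul_of_nonneg_right ?_ (Finset.sum_nonneg fun j _ => sq_nonneg _)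
  linarith [sq_nonneg μ]

lemma torusMean_sq_le (x : EuclideanSpace ℝ (Torus d n)) :
    torusMean x ^ 2 ≤ ((n : ℝ) ^ d)⁻¹ * ∑ j, x j ^ 2 := by
  have hn := natCast_pos_of_neZero (n := n)
  have h := sq_sum_le_card_mul_sum_sq (s := Finset.univ) (f := fun j : Torus d n => x j)
  rw [Finset.card_univ, card_torus] at h
  rw [torusMean, mul_pow]
  calc (((n : ℝ) ^ d)⁻¹) ^ 2 * (∑ j, x j) ^ 2
      ≤ (((n : ℝ) ^ d)⁻¹) ^ 2 * ((n : ℝ) ^ d * ∑ j, x j ^ 2) := by gcongr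
    _ = _ := by field_simp

/-- Uncorrelated initial masses with a common mean satisfy the hypotheses of
`IsMomentBound.exists_limit`. -/
lemma lintegral_initial_le {Ω : Type*} [MeasurableSpace Ω] {P : Measure Ω} [IsProbabilityMeasure P]
    {ξ : Ω → EuclideanSpace ℝ (Torus d n)} (hm : Measurable ξ)
    (hξ : ∀ j, MemLp (fun ω => ξ ω j) 2 P)
    (hcov : ∀ j k, j ≠ k → covariance (fun ω => ξ ω j) (fun ω => ξ ω k) P = 0) {μ ζ : ℝ}
    (hμ : ∀ j, ∫ ω, ξ ω j ∂P = μ) (hζ : ∀ j, ∫ ω, ξ ω j ^ 2 ∂P ≤ ζ) :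
    (∀ y, ∫⁻ x, ENNReal.ofReal (pairing (x - torusMean x • unitMasses _) y ^ 2) ∂(P.map ξ) ≤
      ENNReal.ofReal ζ * ENNReal.ofReal (∑ j, (y j - torusMean y) ^ 2)) ∧
    ∫⁻ x, ENNReal.ofReal (torusMean x ^ 2) ∂(P.map ξ) ≤ ENNReal.ofReal ζ := by
  have hn := natCast_pos_of_neZero (n := n)
  have hζ0 : 0 ≤ ζ := (integral_nonneg fun ω => sq_nonneg _).trans (hζ 0)
  constructor
  · intro y
    simp only [pairing_sub_torusMean_smul]
    have hmy : Measurable fun x : EuclideanSpace ℝ (Torus d n) =>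
        ENNReal.ofReal ((∑ j, (y j - torusMean y) * x j) ^ 2) :=
      (ENNReal.continuous_ofReal.comp (by fun_prop)).measurable
    have hL : MemLp (fun ω => ∑ j, (y j - torusMean y) * ξ ω j) 2 P :=
      memLp_finsetSum _ fun j _ => (hξ j).const_mul _
    rw [lintegral_map hmy hm, ← ofReal_integral_eq_lintegral_ofReal hL.integrable_sq
      (Eventually.of_forall fun ω => sq_nonneg _), ← ENNReal.ofReal_mul hζ0]
    exact ENNReal.ofReal_le_ofReal (integral_sq_sum_le hξ hcov hμ hζ (sum_sub_torusMean y))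
  · have hmm : Measurable fun x : EuclideanSpace ℝ (Torus d n) =>
        ENNReal.ofReal (torusMean x ^ 2) :=
      (ENNReal.continuous_ofReal.comp (continuous_torusMean.pow 2)).measurable
    have hi : Integrable (fun ω => ((n : ℝ) ^ d)⁻¹ * ∑ j, ξ ω j ^ 2) P :=
      (integrable_finsetSum _ fun j _ => (hξ j).integrable_sq).const_mul _
    rw [lintegral_map hmm hm]
    refine (lintegral_mono fun ω => ENNReal.ofReal_le_ofReal (torusMean_sq_le (ξ ω))).trans ?_
    rw [← ofReal_integral_eq_lintegral_ofReal hi (Eventually.of_forall fun ω =>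
      mul_nonneg (by positivity) (Finset.sum_nonneg fun j _ => sq_nonneg _)), integral_const_mul,
      integral_finsetSum _ fun j _ => (hξ j).integrable_sq]
    refine ENNReal.ofReal_le_ofReal ?_
    rw [inv_mul_le_iff₀ (by positivity)]
    refine (Finset.sum_le_sum fun j _ => hζ j).trans (le_of_eq ?_)
    rw [Finset.sum_const, nsmul_eq_mul, Finset.card_univ, card_torus]

end Convergence

/-! ### Explicit bounds -/

section ExplicitBounds

variable {d n : ℕ}

/-- The case `D = 0`, in which the right-hand side is infinite, is that of time `0`. -/
lemma rpow_le_sqrtExpBound {c A D r : ℝ} {t : ℝ≥0} (hA : 0 < A) (hD : 0 ≤ D)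
    (h : 0 < D → c ≤ A / D * Real.exp (-(2 * r) * t)) :
    ENNReal.ofReal c ^ (1 / 2 : ℝ) ≤ sqrtExpBound A D r t := by
  unfold sqrtExpBound
  rcases hD.eq_or_lt with rfl | hD
  · rw [ENNReal.ofReal_zero, ENNReal.div_zero (by simpa using hA), ENNReal.top_rpow_of_pos
      (by norm_num), ENNReal.top_mul (by simpa using Real.exp_pos _)]
    exact le_top
  · have h1 : Real.exp (-(2 * r) * t) = Real.exp (-r * t) ^ 2 := by
      rw [← Real.exp_nat_mul]; congr 1; push_cast; ring
    refine (ENNReal.rpow_le_rpow (ENNReal.ofReal_le_ofReal (h hD)) (by norm_num)).trans ?_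
    rw [ENNReal.ofReal_mul (by positivity), ENNReal.ofReal_div_of_pos hD,
      ENNReal.mul_rpow_of_nonneg _ _ (by norm_num), h1,
      ENNReal.ofReal_rpow_of_nonneg (by positivity) (by norm_num), ← Real.sqrt_eq_rpow,
      Real.sqrt_sq (Real.exp_pos _).le]

lemma momentProfile_le {C a B : ℝ} (hC : 0 ≤ C) (ha : 0 ≤ a) (hB : 0 < B) {t : ℝ≥0} (ht : 0 < t) :
    momentProfile d n C a B t ≤ 2 * C / min ((t : ℝ) ^ a) B * Real.exp (-torusRate d n * t) := by
  unfold momentProfile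
  refine mul_le_mul_of_nonneg_right ?_ (Real.exp_pos _).le
  calc C * decayProfile a B⁻¹ t ≤ C * (2 / min ((t : ℝ) ^ a) B) :=
        mul_le_mul_of_nonneg_left (decayProfile_le_two_div_min ha hB (by exact_mod_cast ht)) hC
    _ = _ := by ring

lemma momentProfile_anti {C a a' B B' : ℝ} (hC : 0 ≤ C) (haa : a ≤ a') (hB : 0 < B) (hBB : B ≤ B')
    (t : ℝ≥0) : momentProfile d n C a' B' t ≤ momentProfile d n C a B t := by
  unfold momentProfile decayProfile
  have h1 : (1 : ℝ) ≤ 1 + t := by linarith [t.2, (rfl : (t : ℝ) = t.1)]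
  have h2 : (1 + (t : ℝ)) ^ (-a') ≤ (1 + (t : ℝ)) ^ (-a) :=
    Real.rpow_le_rpow_of_exponent_le h1 (by linarith)
  gcongr

lemma torusRate_eq : torusRate d n = 2 * (cycleGap n / d - 6400 / (2 * (n : ℝ) ^ (d + 4))) := by
  unfold torusRate; ring

variable [NeZero n]

lemma measurable_torusVariance :
    Measurable fun y : EuclideanSpace ℝ (Torus d n) => torusVariance y := by
  unfold torusVariance torusMean
  exact Continuous.measurable (by fun_prop)

lemma measurable_torusEnergy :
    Measurable fun y : EuclideanSpace ℝ (Torus d n) => torusEnergy y := by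
  unfold torusEnergy
  refine Continuous.measurable (continuous_const.mul (continuous_finsetSum _ fun i _ =>
    continuous_finsetSum _ fun j _ => ?_))
  split_ifs <;> fun_prop

lemma torusVariance_nonneg (y : EuclideanSpace ℝ (Torus d n)) : 0 ≤ torusVariance y :=
  mul_nonneg (by positivity) (Finset.sum_nonneg fun _ _ => sq_nonneg _)

lemma torusEnergy_nonneg (y : EuclideanSpace ℝ (Torus d n)) : 0 ≤ torusEnergy y :=
  mul_nonneg (by positivity) (Finset.sum_nonneg fun _ _ => Finset.sum_nonneg fun _ _ => by
    split_ifs <;> positivity)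

/-- Energy and variance of the smoothing process started from a unit mass are given by a solution of
the spectral system. -/
lemma IsSmoothing.exists_integral_eq (hd : 1 ≤ d) (hn : 3 ≤ n) {Ω : Type*} [MeasurableSpace Ω]
    {P : Measure Ω} [IsProbabilityMeasure P] {Y : ℝ≥0 → Ω → EuclideanSpace ℝ (Torus d n)}
    (hY : IsSmoothing (torusWalk d n) Y P) (h0 : ∀ᵐ ω ∂P, ∀ j, Y 0 ω j = if j = 0 then 1 else 0) :
    ∃ h : ℝ → Torus d n → ℝ, IsSpectralSystem torusEigenvalue ((n : ℝ) ^ d) h ∧ ∀ t : ℝ≥0,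
      ∫ ω, torusEnergy (Y t ω) ∂P =
        ((n : ℝ) ^ d)⁻¹ * spectralEnergy torusEigenvalue ((n : ℝ) ^ d) h t ∧
      ∫ ω, torusVariance (Y t ω) ∂P =
        ((n : ℝ) ^ d)⁻¹ * spectralVariance 0 ((n : ℝ) ^ d) h t := by
  obtain ⟨N, hN⟩ := hY
  have hinit : P.map (Y 0) = Measure.dirac (EuclideanSpace.single 0 1) := by
    have h : Y 0 =ᵐ[P] fun _ => EuclideanSpace.single 0 1 := h0.mono fun ω hω => by
      ext j
      rw [hω j]
      simp
    rw [Measure.map_congr h, Measure.map_const]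
    simp
  have hlaw : ∀ t, P.map (Y t) = unitSmoothingLaw 0 t := fun t => by
    rw [hN.map_eq_clockLaw (measurable_smoothingUpdate _), hinit]
  have hn0 := natCast_pos_of_neZero (n := n)
  obtain ⟨h, H, hh⟩ := exists_unitSmoothingLaw_moments hd hn (0 : Torus d n)
  have key : ∀ {t : ℝ≥0} {f : EuclideanSpace ℝ (Torus d n) → ℝ} {c : ℝ}, Measurable f →
      (∀ y, 0 ≤ f y) → 0 ≤ c →
      ∫⁻ y, ENNReal.ofReal (f y) ∂(unitSmoothingLaw 0 t) = ENNReal.ofReal c →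
      ∫ ω, f (Y t ω) ∂P = c := by
    intro t f c hf hf0 hc hfc
    rw [integral_eq_lintegral_of_nonneg_ae (Eventually.of_forall fun ω => hf0 _)
      (hf.comp (hN.measurable t)).aestronglyMeasurable, ← ENNReal.toReal_ofReal hc, ← hfc, ← hlaw,
      lintegral_map hf.ennreal_ofReal (hN.measurable t)]
  refine ⟨h, H, fun t => ⟨key measurable_torusEnergy torusEnergy_nonneg ?_ (hh t).2.1,
    key measurable_torusVariance torusVariance_nonneg ?_ (hh t).2.2⟩⟩
  · exact mul_nonneg (by positivity)
      (H.spectralEnergy_nonneg (by positivity) (torusEigenvalue_nonneg hd) t.2)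
  · exact mul_nonneg (by positivity) (H.spectralVariance_nonneg (by positivity) 0 t.2)

end ExplicitBounds

theorem theorem2p7 (d : ℕ) (hd : 1 ≤ d) :
    -- the constants of the smoothing bounds; they depend only on `d`
    ∃ α₁ α₂ α₃ : ℝ, 0 < α₁ ∧ 0 < α₂ ∧ 0 < α₃ ∧
      (∃ n₀ : ℕ, 3 ≤ n₀ ∧ ∃ t₀ : ℝ≥0, 0 < t₀ ∧
        ∀ (n : ℕ) [NeZero n], n₀ ≤ n → Odd n →
        ∀ (Ω : Type*) [MeasurableSpace Ω] (P : Measure Ω) [IsProbabilityMeasure P]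
          (Y : ℝ≥0 → Ω → EuclideanSpace ℝ (Torus d n)),
          IsSmoothing (torusWalk d n) Y P →
          (∀ᵐ ω ∂P, ∀ j, Y 0 ω j = if j = 0 then 1 else 0) →
          ∀ t : ℝ≥0, t₀ ≤ t →
            (α₁ * ((n : ℝ) ^ d)⁻¹ / min ((t : ℝ) ^ ((d : ℝ) / 2 + 1)) ((n : ℝ) ^ (d + 2)) *
                Real.exp (-(2 * cycleGap n / d) * t)
              ≤ ∫ ω, torusEnergy (Y t ω) ∂P) ∧
            (∫ ω, torusEnergy (Y t ω) ∂P
              ≤ α₂ * ((n : ℝ) ^ d)⁻¹ / min ((t : ℝ) ^ ((d : ℝ) / 2 + 1)) ((n : ℝ) ^ (d + 2)) *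
                Real.exp (-(2 * cycleGap n / d - α₃ / (n : ℝ) ^ (d + 4)) * t)) ∧
            (α₁ * ((n : ℝ) ^ d)⁻¹ / min ((t : ℝ) ^ ((d : ℝ) / 2)) ((n : ℝ) ^ d) *
                Real.exp (-(2 * cycleGap n / d + α₃ / (n : ℝ) ^ (d + 4)) * t)
              ≤ ∫ ω, torusVariance (Y t ω) ∂P) ∧
            (∫ ω, torusVariance (Y t ω) ∂P
              ≤ α₂ * ((n : ℝ) ^ d)⁻¹ / min ((t : ℝ) ^ ((d : ℝ) / 2)) ((n : ℝ) ^ d) *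
                Real.exp (-(2 * cycleGap n / d - α₃ / (n : ℝ) ^ (d + 4)) * t))) ∧
      -- (i) the potlatch process started from all ones; `ν` is the distribution of `X(∞)`
      (∃ n₀ : ℕ, 3 ≤ n₀ ∧ ∀ (n : ℕ) [NeZero n], n₀ ≤ n → Odd n →
        ∀ (Ω : Type*) [MeasurableSpace Ω] (P : Measure Ω) [IsProbabilityMeasure P]
          (X : ℝ≥0 → Ω → EuclideanSpace ℝ (Torus d n)),
          IsPotlatch (torusWalk d n) X P →
          (∀ᵐ ω ∂P, ∀ j, X 0 ω j = 1) →
          ∃ ν : ProbabilityMeasure (EuclideanSpace ℝ (Torus d n)),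
            TendstoInDistribution X atTop id (fun _ => P) ν.toMeasure ∧
            IsPotlatchStationary (torusWalk d n) ν.toMeasure ∧
            ∀ t : ℝ≥0,
              (∀ i : Torus d n,
                wasserstein2 (P.map fun ω => X t ω i) (ν.toMeasure.map fun x => x i) ≤
                  sqrtExpBound α₂ (min ((t : ℝ) ^ ((d : ℝ) / 2 + 1)) ((n : ℝ) ^ (d + 2)))
                    (cycleGap n / d - α₃ / (2 * (n : ℝ) ^ (d + 4))) t) ∧
              wasserstein2 (P.map (X t)) ν.toMeasure ≤
                sqrtExpBound (α₂ * (n : ℝ) ^ d)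
                  (min ((t : ℝ) ^ ((d : ℝ) / 2 + 1)) ((n : ℝ) ^ (d + 2)))
                  (cycleGap n / d - α₃ / (2 * (n : ℝ) ^ (d + 4))) t) ∧
      -- (ii) the potlatch process started from uncorrelated masses with mean `μ` and second
      -- moments at most `ζ`
      (∀ μ ζ : ℝ, ∃ η : ℝ, 0 < η ∧ ∃ n₀ : ℕ, 3 ≤ n₀ ∧ ∀ (n : ℕ) [NeZero n], n₀ ≤ n → Odd n →
        ∀ (Ω : Type*) [MeasurableSpace Ω] (P : Measure Ω) [IsProbabilityMeasure P]
          (X : ℝ≥0 → Ω → EuclideanSpace ℝ (Torus d n)),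
          IsPotlatch (torusWalk d n) X P →
          (∀ j, MemLp (fun ω => X 0 ω j) 2 P) →
          (∀ j k, j ≠ k → covariance (fun ω => X 0 ω j) (fun ω => X 0 ω k) P = 0) →
          (∀ j, ∫ ω, X 0 ω j ∂P = μ) →
          (∀ j, ∫ ω, (X 0 ω j) ^ 2 ∂P ≤ ζ) →
          ∃ ν : ProbabilityMeasure (EuclideanSpace ℝ (Torus d n)),
            TendstoInDistribution X atTop id (fun _ => P) ν.toMeasure ∧
            IsPotlatchStationary (torusWalk d n) ν.toMeasure ∧
            ∀ t : ℝ≥0,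
              (∀ i : Torus d n,
                wasserstein2 (P.map fun ω => X t ω i) (ν.toMeasure.map fun x => x i) ≤
                  sqrtExpBound η (min ((t : ℝ) ^ ((d : ℝ) / 2)) ((n : ℝ) ^ d))
                    (cycleGap n / d - α₃ / (2 * (n : ℝ) ^ (d + 4))) t) ∧
              wasserstein2 (P.map (X t)) ν.toMeasure ≤
                sqrtExpBound (η * (n : ℝ) ^ d) (min ((t : ℝ) ^ ((d : ℝ) / 2)) ((n : ℝ) ^ d))
                  (cycleGap n / d - α₃ / (2 * (n : ℝ) ^ (d + 4))) t) := by
  obtain ⟨C, hC, hM⟩ := exists_isMomentBound d hd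
  have hd0 : (0 : ℝ) < d := by exact_mod_cast hd
  refine ⟨lowerConst d, 2 * C, 6400, lowerConst_pos hd, by positivity, by norm_num, ?_, ?_, ?_⟩
  · refine ⟨800, by norm_num, 4, by norm_num, ?_⟩
    intro n _ hn _ Ω _ P _ Y hY h0 t ht
    have hn0 := natCast_pos_of_neZero (n := n)
    have ht4 : (4 : ℝ) ≤ t := by exact_mod_cast ht
    have ht0 : 0 < t := lt_of_lt_of_le (by norm_num) ht
    have ht0' : (0 : ℝ) < t := by exact_mod_cast ht0
    obtain ⟨h, H, hh⟩ := hY.exists_integral_eq hd (by omega) h0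
    obtain ⟨hE, hV⟩ := (hM n hn).2 h H t
    obtain ⟨hE', hV'⟩ := spectral_lower_bound hd (by omega) H ht4
    rw [(hh t).1, (hh t).2]
    have hN : (0 : ℝ) < ((n : ℝ) ^ d)⁻¹ := by positivity
    have hscale : ∀ A D x : ℝ, A * ((n : ℝ) ^ d)⁻¹ / D * x = ((n : ℝ) ^ d)⁻¹ * (A / D * x) :=
      fun A D x => by ring
    simp only [hscale]
    refine ⟨mul_le_mul_of_nonneg_left hE' hN.le,
      mul_le_mul_of_nonneg_left (hE.trans ?_) hN.le,
      mul_le_mul_of_nonneg_left (le_trans ?_ hV') hN.le,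
      mul_le_mul_of_nonneg_left (hV.trans ?_) hN.le⟩
    · exact momentProfile_le hC.le (by positivity) (by positivity) ht0
    · have hmin : 0 < min ((t : ℝ) ^ ((d : ℝ) / 2)) ((n : ℝ) ^ d) :=
        lt_min (Real.rpow_pos_of_pos ht0' _) (by positivity)
      refine mul_le_mul_of_nonneg_left ?_ (div_nonneg (lowerConst_pos hd).le hmin.le)
      rw [Real.exp_le_exp]
      have : 0 ≤ 6400 / (n : ℝ) ^ (d + 4) * t := by positivity
      linarith
    · exact momentProfile_le hC.le (by positivity) (by positivity) ht0
  · refine ⟨800, by norm_num, ?_⟩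
    intro n _ hn _ Ω _ P _ X hX h0
    have hn0 := natCast_pos_of_neZero (n := n)
    have hinit : P.map (X 0) = Measure.dirac (unitMasses _) := by
      have h : X 0 =ᵐ[P] fun _ => unitMasses _ := h0.mono fun ω hω => by
        ext j
        rw [hω j]
        simp [unitMasses]
      rw [Measure.map_congr h, Measure.map_const]
      simp
    have hmean : torusMean (unitMasses (Torus d n)) = 1 := by
      rw [torusMean]
      simp [unitMasses, ZMod.card]
    obtain ⟨ν, hlim, hst, hW⟩ := (hM n hn).1.exists_limit hd (by omega) hX (σ := 0) (τ := 1) le_rfl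
      one_pos (fun y => by
        have hm : Measurable fun x : EuclideanSpace ℝ (Torus d n) =>
            ENNReal.ofReal (pairing (x - torusMean x • unitMasses _) y ^ 2) :=
          (ENNReal.continuous_ofReal.comp (((continuous_pairing_left y).comp
            (continuous_id.sub (continuous_torusMean.smul continuous_const))).pow 2)).measurable
        rw [hinit, lintegral_dirac' _ hm, hmean]
        simp [pairing]) (by
        have hm : Measurable fun x : EuclideanSpace ℝ (Torus d n) =>
            ENNReal.ofReal (torusMean x ^ 2) :=
          (ENNReal.continuous_ofReal.comp (continuous_torusMean.pow 2)).measurable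
        rw [hinit, lintegral_dirac' _ hm, hmean]
        simp)
    refine ⟨ν, hlim, hst, fun t => ?_⟩
    have hD : 0 ≤ min ((t : ℝ) ^ ((d : ℝ) / 2 + 1)) ((n : ℝ) ^ (d + 2)) :=
      le_min (Real.rpow_nonneg t.2 _) (by positivity)
    have hb : 0 < min ((t : ℝ) ^ ((d : ℝ) / 2 + 1)) ((n : ℝ) ^ (d + 2)) →
        0 * momentProfile d n C ((d : ℝ) / 2) ((n : ℝ) ^ d) t +
          1 * momentProfile d n C ((d : ℝ) / 2 + 1) ((n : ℝ) ^ (d + 2)) t ≤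
        2 * C / min ((t : ℝ) ^ ((d : ℝ) / 2 + 1)) ((n : ℝ) ^ (d + 2)) *
          Real.exp (-(2 * (cycleGap n / d - 6400 / (2 * (n : ℝ) ^ (d + 4)))) * t) := by
      intro hpos
      have ht : 0 < t := pos_iff_ne_zero.2 fun h => by
        rw [h, NNReal.coe_zero, Real.zero_rpow (by positivity)] at hpos
        exact (lt_min_iff.1 hpos).1.ne rfl
      rw [← torusRate_eq, zero_mul, zero_add, one_mul]
      exact momentProfile_le hC.le (by positivity) (by positivity) ht
    refine ⟨fun i => ((hW t).1 i).trans (rpow_le_sqrtExpBound (by positivity) hD hb),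
      (hW t).2.trans (rpow_le_sqrtExpBound (by positivity) hD fun hpos => ?_)⟩
    refine (mul_le_mul_of_nonneg_left (hb hpos) (by positivity)).trans (le_of_eq ?_)
    ring
  · intro μ ζ
    refine ⟨4 * C * |ζ| + 1, by positivity, 800, by norm_num, ?_⟩
    intro n _ hn _ Ω _ P _ X hX hL2 hcov hμ hζ
    have hn0 := natCast_pos_of_neZero (n := n)
    have hXm := hX.choose_spec.measurable 0
    obtain ⟨h1, h2⟩ := lintegral_initial_le hXm hL2 hcov hμ hζ
    -- `ζ` may vanish, whereas `exists_limit` needs a positive constant; the increment `(8 * C)⁻¹`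
    -- is small enough to be absorbed by the summand `1` of `η`
    have hζ0 : 0 < |ζ| + (8 * C)⁻¹ := by positivity
    have hζ' : ENNReal.ofReal ζ ≤ ENNReal.ofReal (|ζ| + (8 * C)⁻¹) :=
      ENNReal.ofReal_le_ofReal ((le_abs_self ζ).trans (le_add_of_nonneg_right (by positivity)))
    obtain ⟨ν, hlim, hst, hW⟩ := (hM n hn).1.exists_limit hd (by omega) hX hζ0.le hζ0
      (fun y => (h1 y).trans (mul_le_mul_left hζ' _)) (h2.trans hζ')
    refine ⟨ν, hlim, hst, fun t => ?_⟩
    have hD : 0 ≤ min ((t : ℝ) ^ ((d : ℝ) / 2)) ((n : ℝ) ^ d) :=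
      le_min (Real.rpow_nonneg t.2 _) (by positivity)
    have hb : 0 < min ((t : ℝ) ^ ((d : ℝ) / 2)) ((n : ℝ) ^ d) →
        (|ζ| + (8 * C)⁻¹) * momentProfile d n C ((d : ℝ) / 2) ((n : ℝ) ^ d) t +
          (|ζ| + (8 * C)⁻¹) * momentProfile d n C ((d : ℝ) / 2 + 1) ((n : ℝ) ^ (d + 2)) t ≤
        (4 * C * |ζ| + 1) / min ((t : ℝ) ^ ((d : ℝ) / 2)) ((n : ℝ) ^ d) *
          Real.exp (-(2 * (cycleGap n / d - 6400 / (2 * (n : ℝ) ^ (d + 4)))) * t) := by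
      intro hpos
      have ht : 0 < t := pos_iff_ne_zero.2 fun h => by
        rw [h, NNReal.coe_zero, Real.zero_rpow (by positivity)] at hpos
        exact (lt_min_iff.1 hpos).1.ne rfl
      rw [← torusRate_eq]
      have h3 := momentProfile_le (d := d) (n := n) (a := (d : ℝ) / 2) (B := (n : ℝ) ^ d) hC.le
        (by positivity) (by positivity) ht
      have h4 := momentProfile_anti (d := d) (n := n) (a := (d : ℝ) / 2) (a' := (d : ℝ) / 2 + 1)
        (B := (n : ℝ) ^ d) (B' := (n : ℝ) ^ (d + 2)) hC.le (by linarith) (by positivity)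
        (pow_le_pow_right₀ (by exact_mod_cast (by omega : 1 ≤ n)) (by omega)) t
      set w := momentProfile d n C ((d : ℝ) / 2) ((n : ℝ) ^ d) t
      set D := min ((t : ℝ) ^ ((d : ℝ) / 2)) ((n : ℝ) ^ d)
      set E := Real.exp (-torusRate d n * t)
      have hE : 0 < E := Real.exp_pos _
      calc _ ≤ (|ζ| + (8 * C)⁻¹) * w + (|ζ| + (8 * C)⁻¹) * w := by gcongr
        _ = 2 * (|ζ| + (8 * C)⁻¹) * w := by ring
        _ ≤ 2 * (|ζ| + (8 * C)⁻¹) * (2 * C / D * E) := by gcongr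
        _ = (4 * C * |ζ| + 1 / 2) / D * E := by field_simp; ring
        _ ≤ (4 * C * |ζ| + 1) / D * E := by gcongr; norm_num
    refine ⟨fun i => ((hW t).1 i).trans (rpow_le_sqrtExpBound (by positivity) hD hb),
      (hW t).2.trans (rpow_le_sqrtExpBound (by positivity) hD fun hpos => ?_)⟩
    refine (mul_le_mul_of_nonneg_left (hb hpos) (by positivity)).trans (le_of_eq ?_)
    ring
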